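/- Let $(M,g)$ be a connected smooth surface with a smooth Riemannian metric $g$, Levi-Civita connection $\nabla$ and scalar curvature $R$ (twice the Gauss curvature), so that the curvature tensor is $R_{ijkl}=\frac R2(g_{ik}g_{jl}-g_{il}g_{jk})$. Indices are moved with $g$, a comma denotes covariant differentiation, $|S|^2=S^{abc}S_{abc}$. $\mathcal Y_{i_1\dots i_r}$ denotes the sum over all $r!$ permutations of the indices $i_1,\dots,i_r$, the subscript $\circ$ the tracefree part (so $\mathcal Y^\circ_{ij}A_{ij}=A_{ij}+A_{ji}-g_{ij}A^a{}_a$), and $X_{[kl]}=X_{kl}-X_{lk}$. *Systems.* A function $F=C^{ij}p_ip_j+W$ on $T^*M$ is a (second order) conformal integral of $H=g^{ij}p_ip_j+V$ if $\{F,H\}=\rho H$ with a function $\rho$ that is polynomial in the momenta. A non-degenerate conformally superintegrable system on $(M,g)$ consists of * a Hamiltonian $H=g^{ij}p_ip_j+V$ and two conformal integrals $F^{(\alpha)}=C^{(\alpha)ij}p_ip_j+W^{(\alpha)}$, $\alpha=1,2$, of $H$ (with $V$, $W^{(\alpha)}$, $C^{(\alpha)}$ smooth and $C^{(\alpha)}$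 symmetric and tracefree), such that $H,F^{(1)},F^{(2)}$ are functionally independent (on a dense set) and such that at each point the endomorphisms $C^{(1)},C^{(2)}$ have no common eigenvector (irreducibility); * a $4$-dimensional linear space $\mathcal V\ni V$ of smooth functions such that for every $U\in\mathcal V$ and every $\alpha$ the Bertrand-Darboux condition holds, i.e. locally there is a smooth $W$ such that $C^{(\alpha)ij}p_ip_j+W$ is a conformal integral of $g^{ij}p_ip_j+U$; and such that, with smooth tensor fields $T_{ijk}$ (symmetric and tracefree in $i,j$) and $\tau_{ij}$ (symmetric and tracefree), called the primary and secondary structure tensors, $$U_{,ij}=T_{ij}{}^kU_{,k}+\tfrac12g_{ij}\Delta U+\tau_{ij}U\qquad\text{for all }U\in\mathcal V.$$ Put $t_j=\frac12T_{aj}{}^a$, $S_{ijk}=T_{ijk}-\mathcal Y^\circ_{ij}\,t_ig_{jk}$ and $\Xi_{ij}=(\nabla^a+\frac23t^a)S_{ija}$. The system is in *standard gauge* if $T$ is tracefree, i.e. $t_j=0$ (so that one may take the function $t=0$). **Proposition.** (a) For a system in standard gauge, $T=S$ is totally symmetric and tracefree, $\Xi=\operatorname{div}S$ is symmetric and tracefree,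 and $$\nabla_lS_{ijk}=\tfrac16\,\mathcal Y_{ijk}\bigl(\Xi_{ij}g_{kl}-\tfrac12g_{ij}\Xi_{kl}\bigr),\tag{1}$$ $$\nabla_k\Xi_{ij}=\tfrac13S_{ijk}|S|^2+\tfrac23\,\mathcal Y^\circ_{ij}\,g_{ik}S_{jab}\Xi^{ab},\tag{2}$$ $$R=-\tfrac29|S|^2,\tag{3}$$ $$\nabla_kR=-\tfrac49S_{kab}\Xi^{ab},\qquad \tau_{ij}=\tfrac13\Xi_{ij}.\tag{4}$$ Moreover the integrability conditions (I) below hold for $T$, $\tau$. (b) Conversely, whenever smooth totally symmetric tracefree $S$ and symmetric tracefree $\Xi$ on $(M,g)$ satisfy (1), (2), (3), the following integrability conditions (of the prolongation systems for the potentials and for the tracefree conformal Killing tensors, with $t=0$) hold for $T:=S$ and $\tau:=\frac13\Xi$: (I) $T=S$ is totally symmetric and tracefree; $0=\frac13|S|^2+\frac32R$; $\mathcal Y^\circ_{ijkl}\nabla_lS_{ijk}=0$; $\tau_{ij}=(\frac13\nabla^aS_{ija})_\circ$; $$\bigl(q_{kn,l}+T_{mln}q_k{}^m+\gamma_kg_{ln}\bigr)_{[kl]}=0,\qquad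 \bigl(\gamma_{i,j}+q_i{}^m\tau_{mj}\bigr)_{[ij]}=0,$$ where $q_{jm}=Q_{ij}{}^i{}_m$, $Q_{ijkm}=T_{ijm,k}+T_{ij}{}^lT_{lkm}-R_{ijkm}+\tau_{ij}g_{km}$, $\gamma_k=\Gamma_{ak}{}^a$, $\Gamma_{ijk}=\tau_{ij,k}+T_{ij}{}^a\tau_{ak}$. (c) The integrability conditions of the closed system (1), (2) are satisfied identically: for every inner product $g$ on $\mathbb R^2$, every totally symmetric tracefree $S_{ijk}$ and every symmetric tracefree $\Xi_{ij}$, with $R:=-\frac29|S|^2$, the Ricci identities $$\nabla_m\nabla_lS_{ijk}-\nabla_l\nabla_mS_{ijk}=R_{mli}{}^aS_{ajk}+R_{mlj}{}^aS_{iak}+R_{mlk}{}^aS_{ija},$$ $$\nabla_m\nabla_k\Xi_{ij}-\nabla_k\nabla_m\Xi_{ij}=R_{mki}{}^a\Xi_{aj}+R_{mkj}{}^a\Xi_{ia}$$ become algebraic identities when the second derivatives are computed by formally differentiating the right hand sides of (1) and (2) and replacing all first derivatives of $S$ and $\Xi$ by means of (1) and (2). -/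

import Mathlib

open scoped Manifold ContDiff

noncomputable section

namespace ConfSuperint

/-- The model space of surfaces. -/
abbrev E2 := EuclideanSpace ℝ (Fin 2)

/-- The coordinate vector `∂ᵢ` of `E2`. -/
def ee (i : Fin 2) : E2 := EuclideanSpace.single i 1

/-! ## Tensor algebra in dimension two

All tensors are given by their covariant components; `h` is the matrix of the metric, `h⁻¹` its
inverse. Indices are contracted with `h⁻¹`. -/

/-- `Sᵃᵇᶜ Sₐᵦ꜀`. -/
def normSq3 (h : Matrix (Fin 2) (Fin 2) ℝ) (S : Fin 2 → Fin 2 → Fin 2 → ℝ) : ℝ :=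
  ∑ a, ∑ b, ∑ c, ∑ d, ∑ e, ∑ f, h⁻¹ a d * h⁻¹ b e * h⁻¹ c f * S a b c * S d e f

/-- `Sₖₐᵦ Ξᵃᵇ`. -/
def contr32 (h : Matrix (Fin 2) (Fin 2) ℝ) (S : Fin 2 → Fin 2 → Fin 2 → ℝ)
    (Ξ : Fin 2 → Fin 2 → ℝ) (k : Fin 2) : ℝ :=
  ∑ a, ∑ b, ∑ c, ∑ d, h⁻¹ a c * h⁻¹ b d * S k a b * Ξ c d

/-- The curvature tensor `Rᵢⱼₖₗ = (R/2) (gᵢₖ gⱼₗ - gᵢₗ gⱼₖ)` of a surface of scalar curvature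
`R`. -/
def curv (h : Matrix (Fin 2) (Fin 2) ℝ) (R : ℝ) (i j k l : Fin 2) : ℝ :=
  R / 2 * (h i k * h j l - h i l * h j k)

/-- The trace `gᵃᵇ Aₐᵦ`. -/
def tr2 (h : Matrix (Fin 2) (Fin 2) ℝ) (A : Fin 2 → Fin 2 → ℝ) : ℝ :=
  ∑ a, ∑ b, h⁻¹ a b * A a b

/-- The Young operator `(i j)_∘`: `Aᵢⱼ + Aⱼᵢ - (2/n) gᵢⱼ Aᵃₐ` with `n = 2`. -/
def youngTf2 (h : Matrix (Fin 2) (Fin 2) ℝ) (A : Fin 2 → Fin 2 → ℝ) (i j : Fin 2) : ℝ :=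
  A i j + A j i - h i j * tr2 h A

/-- The tracefree part `(Aᵢⱼ)_∘ = Aᵢⱼ - (1/n) gᵢⱼ Aᵃₐ` with `n = 2`. -/
def tracefree2 (h : Matrix (Fin 2) (Fin 2) ℝ) (A : Fin 2 → Fin 2 → ℝ) (i j : Fin 2) : ℝ :=
  A i j - 1 / 2 * h i j * tr2 h A

/-- The Young operator `(i j k)`: sum over all six permutations of the indices. -/
def young3 (A : Fin 2 → Fin 2 → Fin 2 → ℝ) (i j k : Fin 2) : ℝ :=
  A i j k + A i k j + A j i k + A j k i + A k i j + A k j i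

/-- The Young operator `(i j k l)`: sum over all twenty-four permutations of the indices. -/
def young4 (A : Fin 2 → Fin 2 → Fin 2 → Fin 2 → ℝ) (i j k l : Fin 2) : ℝ :=
  young3 (fun a b c => A a b c l) i j k + young3 (fun a b c => A a b c k) i j l +
    young3 (fun a b c => A a b c j) i k l + young3 (fun a b c => A a b c i) j k l

/-- The tracefree part of a totally symmetric tensor `Pᵢⱼₖₗ` in dimension `n = 2`: subtract
`gᵢⱼ Pᵃₐₖₗ / (n+4)` for the six ways to choose the pair `i j`, and add
`gᵢⱼ gₖₗ Pᵃₐᵇᵦ / ((n+2)(n+4))` for the three pairings. -/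
def tracefree4 (h : Matrix (Fin 2) (Fin 2) ℝ) (P : Fin 2 → Fin 2 → Fin 2 → Fin 2 → ℝ)
    (i j k l : Fin 2) : ℝ :=
  let P2 : Fin 2 → Fin 2 → ℝ := fun c d => tr2 h fun a b => P a b c d
  P i j k l
    - 1 / 6 * (h i j * P2 k l + h i k * P2 j l + h i l * P2 j k
        + h j k * P2 i l + h j l * P2 i k + h k l * P2 i j)
    + 1 / 24 * (h i j * h k l + h i k * h j l + h i l * h j k) * tr2 h P2

/-- Totally symmetric tensors of rank three. -/
def IsSymm3 (S : Fin 2 → Fin 2 → Fin 2 → ℝ) : Prop :=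
  ∀ i j k, S i j k = S j i k ∧ S i j k = S i k j

/-- Totally symmetric tracefree tensors of rank three. -/
def IsSymmTracefree3 (h : Matrix (Fin 2) (Fin 2) ℝ) (S : Fin 2 → Fin 2 → Fin 2 → ℝ) : Prop :=
  IsSymm3 S ∧ ∀ k, tr2 h (fun a b => S a b k) = 0

/-- Symmetric tracefree tensors of rank two. -/
def IsSymmTracefree2 (h : Matrix (Fin 2) (Fin 2) ℝ) (A : Fin 2 → Fin 2 → ℝ) : Prop :=
  (∀ i j, A i j = A j i) ∧ tr2 h A = 0

/-- The right hand side of the equation for `∇ₗ Sᵢⱼₖ`: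
`(1/6) (i j k) (Ξᵢⱼ gₖₗ - (1/2) gᵢⱼ Ξₖₗ)`. -/
def rhsS (h : Matrix (Fin 2) (Fin 2) ℝ) (Ξ : Fin 2 → Fin 2 → ℝ) (i j k l : Fin 2) : ℝ :=
  1 / 6 * young3 (fun a b c => Ξ a b * h c l - 1 / 2 * (h a b * Ξ c l)) i j k

/-- The right hand side of the equation for `∇ₖ Ξᵢⱼ`:
`(1/3) Sᵢⱼₖ |S|² + (2/3) (i j)_∘ gᵢₖ Sⱼₐᵦ Ξᵃᵇ`. -/
def rhsXi (h : Matrix (Fin 2) (Fin 2) ℝ) (S : Fin 2 → Fin 2 → Fin 2 → ℝ)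
    (Ξ : Fin 2 → Fin 2 → ℝ) (i j k : Fin 2) : ℝ :=
  1 / 3 * S i j k * normSq3 h S + 2 / 3 * youngTf2 h (fun a b => h a k * contr32 h S Ξ b) i j

/-- The formal covariant derivative `∇ₘ` of `rhsS`, in which the derivative of `Ξ` is replaced by
the right hand side of its equation. -/
def dRhsS (h : Matrix (Fin 2) (Fin 2) ℝ) (S : Fin 2 → Fin 2 → Fin 2 → ℝ)
    (Ξ : Fin 2 → Fin 2 → ℝ) (i j k l m : Fin 2) : ℝ :=
  deriv (fun ε : ℝ => rhsS h (fun a b => Ξ a b + ε * rhsXi h S Ξ a b m) i j k l) 0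

/-- The formal covariant derivative `∇ₘ` of `rhsXi`, in which the derivatives of `S` and `Ξ` are
replaced by the right hand sides of their equations. -/
def dRhsXi (h : Matrix (Fin 2) (Fin 2) ℝ) (S : Fin 2 → Fin 2 → Fin 2 → ℝ)
    (Ξ : Fin 2 → Fin 2 → ℝ) (i j k m : Fin 2) : ℝ :=
  deriv (fun ε : ℝ => rhsXi h (fun a b c => S a b c + ε * rhsS h Ξ a b c m)
    (fun a b => Ξ a b + ε * rhsXi h S Ξ a b m) i j k) 0

/-- The integrability condition (Ricci identity)
`∇ₘ∇ₗ Sᵢⱼₖ - ∇ₗ∇ₘ Sᵢⱼₖ = Rₘₗᵢᵃ Sₐⱼₖ + Rₘₗⱼᵃ Sᵢₐₖ + Rₘₗₖᵃ Sᵢⱼₐ` for the equation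
`∇ₗ Sᵢⱼₖ = rhsS`, all derivatives being replaced by means of the closed system. -/
def RicciIdentityS (h : Matrix (Fin 2) (Fin 2) ℝ) (R : ℝ) (S : Fin 2 → Fin 2 → Fin 2 → ℝ)
    (Ξ : Fin 2 → Fin 2 → ℝ) : Prop :=
  ∀ i j k l m, dRhsS h S Ξ i j k l m - dRhsS h S Ξ i j k m l =
    ∑ a, ∑ b, h⁻¹ a b * (curv h R m l i a * S b j k + curv h R m l j a * S i b k
      + curv h R m l k a * S i j b)

/-- The integrability condition (Ricci identity)
`∇ₘ∇ₖ Ξᵢⱼ - ∇ₖ∇ₘ Ξᵢⱼ = Rₘₖᵢᵃ Ξₐⱼ + Rₘₖⱼᵃ Ξᵢₐ` for the equation `∇ₖ Ξᵢⱼ = rhsXi`, all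
derivatives being replaced by means of the closed system. -/
def RicciIdentityXi (h : Matrix (Fin 2) (Fin 2) ℝ) (R : ℝ) (S : Fin 2 → Fin 2 → Fin 2 → ℝ)
    (Ξ : Fin 2 → Fin 2 → ℝ) : Prop :=
  ∀ i j k m, dRhsXi h S Ξ i j k m - dRhsXi h S Ξ i j m k =
    ∑ a, ∑ b, h⁻¹ a b * (curv h R m k i a * Ξ b j + curv h R m k j a * Ξ i b)

/-! ## Tensor calculus in a coordinate chart

`G` is the matrix-valued function of the components of the metric in a chart. In covariant
derivatives the index of differentiation comes last. -/

/-- The partial derivative `∂ᵢ f`. -/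
def pd (i : Fin 2) (f : E2 → ℝ) (x : E2) : ℝ := fderiv ℝ f x (ee i)

/-- The Christoffel symbols `Γᵏᵢⱼ` of the Levi-Civita connection. -/
def christoffel (G : E2 → Matrix (Fin 2) (Fin 2) ℝ) (x : E2) (k i j : Fin 2) : ℝ :=
  1 / 2 * ∑ l, (G x)⁻¹ k l *
    (pd i (fun y => G y j l) x + pd j (fun y => G y i l) x - pd l (fun y => G y i j) x)

/-- The components
`Rˡₖᵢⱼ = ∂ᵢ Γˡⱼₖ - ∂ⱼ Γˡᵢₖ + Γˡᵢₐ Γᵃⱼₖ - Γˡⱼₐ Γᵃᵢₖ` of the Riemann curvature tensor. -/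
def riem (G : E2 → Matrix (Fin 2) (Fin 2) ℝ) (x : E2) (l k i j : Fin 2) : ℝ :=
  pd i (fun y => christoffel G y l j k) x - pd j (fun y => christoffel G y l i k) x
    + ∑ a, (christoffel G x l i a * christoffel G x a j k
      - christoffel G x l j a * christoffel G x a i k)

/-- The scalar curvature `R = gᵏʲ Rⁱₖᵢⱼ` (twice the Gauss curvature). -/
def scalarCurv (G : E2 → Matrix (Fin 2) (Fin 2) ℝ) (x : E2) : ℝ :=
  ∑ k, ∑ j, (G x)⁻¹ k j * ∑ i, riem G x i k i j

/-- `∇ₖ θᵢ`. -/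
def cov1 (G : E2 → Matrix (Fin 2) (Fin 2) ℝ) (θ : E2 → Fin 2 → ℝ) (x : E2) (i k : Fin 2) : ℝ :=
  pd k (fun y => θ y i) x - ∑ a, christoffel G x a k i * θ x a

/-- `∇ₖ Aᵢⱼ`. -/
def cov2 (G : E2 → Matrix (Fin 2) (Fin 2) ℝ) (A : E2 → Fin 2 → Fin 2 → ℝ) (x : E2)
    (i j k : Fin 2) : ℝ :=
  pd k (fun y => A y i j) x
    - ∑ a, (christoffel G x a k i * A x a j + christoffel G x a k j * A x i a)

/-- `∇ₗ Sᵢⱼₖ`. -/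
def cov3 (G : E2 → Matrix (Fin 2) (Fin 2) ℝ) (S : E2 → Fin 2 → Fin 2 → Fin 2 → ℝ) (x : E2)
    (i j k l : Fin 2) : ℝ :=
  pd l (fun y => S y i j k) x
    - ∑ a, (christoffel G x a l i * S x a j k + christoffel G x a l j * S x i a k
      + christoffel G x a l k * S x i j a)

/-- The Hessian `V,ᵢⱼ`. -/
def hess (G : E2 → Matrix (Fin 2) (Fin 2) ℝ) (V : E2 → ℝ) (x : E2) (i j : Fin 2) : ℝ :=
  cov1 G (fun y i => pd i V y) x i j

/-- The divergence `∇ᵃ Sᵢⱼₐ`. -/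
def div3 (G : E2 → Matrix (Fin 2) (Fin 2) ℝ) (S : E2 → Fin 2 → Fin 2 → Fin 2 → ℝ) (x : E2)
    (i j : Fin 2) : ℝ :=
  tr2 (G x) fun a b => cov3 G S x i j a b

/-- `tⱼ = (1/2) Tₐⱼᵃ`. -/
def traceForm (h : Matrix (Fin 2) (Fin 2) ℝ) (T : Fin 2 → Fin 2 → Fin 2 → ℝ) (j : Fin 2) : ℝ :=
  1 / 2 * tr2 h fun a b => T a j b

/-- The conformal structure tensor `Sᵢⱼₖ = Tᵢⱼₖ - (i j)_∘ tᵢ gⱼₖ`. -/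
def confStruct (h : Matrix (Fin 2) (Fin 2) ℝ) (T : Fin 2 → Fin 2 → Fin 2 → ℝ) (i j k : Fin 2) :
    ℝ :=
  T i j k - youngTf2 h (fun a b => traceForm h T a * h b k) i j

/-- `Ξᵢⱼ = (∇ᵃ + (2/3) tᵃ) Sᵢⱼₐ`, computed from the primary structure tensor `T`. -/
def confXi (G : E2 → Matrix (Fin 2) (Fin 2) ℝ) (T : E2 → Fin 2 → Fin 2 → Fin 2 → ℝ) (x : E2)
    (i j : Fin 2) : ℝ :=
  div3 G (fun y => confStruct (G y) (T y)) x i j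
    + 2 / 3 * tr2 (G x) fun a b => confStruct (G x) (T x) i j a * traceForm (G x) (T x) b

/-- `Qᵢⱼₖₘ = Tᵢⱼₘ,ₖ + Tᵢⱼˡ Tₗₖₘ - Rᵢⱼₖₘ + τᵢⱼ gₖₘ`. -/
def bigQ (G : E2 → Matrix (Fin 2) (Fin 2) ℝ) (T : E2 → Fin 2 → Fin 2 → Fin 2 → ℝ)
    (τ : E2 → Fin 2 → Fin 2 → ℝ) (x : E2) (i j k m : Fin 2) : ℝ :=
  cov3 G T x i j m k + (tr2 (G x) fun a b => T x i j a * T x b k m)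
    - curv (G x) (scalarCurv G x) i j k m + τ x i j * G x k m

/-- `qⱼₘ = Qᵢⱼⁱₘ`. -/
def smallQ (G : E2 → Matrix (Fin 2) (Fin 2) ℝ) (T : E2 → Fin 2 → Fin 2 → Fin 2 → ℝ)
    (τ : E2 → Fin 2 → Fin 2 → ℝ) (x : E2) (j m : Fin 2) : ℝ :=
  tr2 (G x) fun i k => bigQ G T τ x i j k m

/-- `Γᵢⱼₖ = τᵢⱼ,ₖ + Tᵢⱼᵃ τₐₖ`. -/
def bigGamma (G : E2 → Matrix (Fin 2) (Fin 2) ℝ) (T : E2 → Fin 2 → Fin 2 → Fin 2 → ℝ)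
    (τ : E2 → Fin 2 → Fin 2 → ℝ) (x : E2) (i j k : Fin 2) : ℝ :=
  cov2 G τ x i j k + tr2 (G x) fun a b => T x i j a * τ x b k

/-- `γₖ = Γₐₖᵃ`. -/
def smallGamma (G : E2 → Matrix (Fin 2) (Fin 2) ℝ) (T : E2 → Fin 2 → Fin 2 → Fin 2 → ℝ)
    (τ : E2 → Fin 2 → Fin 2 → ℝ) (x : E2) (k : Fin 2) : ℝ :=
  tr2 (G x) fun a b => bigGamma G T τ x a k b

/-- The left hand side `qₖₙ,ₗ + Tₘₗₙ qₖᵐ + γₖ gₗₙ` of the integrability condition for `q`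
(the contribution of `t` being zero); it has to be symmetric in `k, l`. -/
def qTerm (G : E2 → Matrix (Fin 2) (Fin 2) ℝ) (T : E2 → Fin 2 → Fin 2 → Fin 2 → ℝ)
    (τ : E2 → Fin 2 → Fin 2 → ℝ) (x : E2) (k l n : Fin 2) : ℝ :=
  cov2 G (smallQ G T τ) x k n l + (tr2 (G x) fun a b => T x a l n * smallQ G T τ x k b)
    + smallGamma G T τ x k * G x l n

/-- The left hand side `γᵢ,ⱼ + qᵢᵐ τₘⱼ` of the integrability condition for `γ`
(the contribution of `t` being zero); it has to be symmetric in `i, j`. -/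
def gammaTerm (G : E2 → Matrix (Fin 2) (Fin 2) ℝ) (T : E2 → Fin 2 → Fin 2 → Fin 2 → ℝ)
    (τ : E2 → Fin 2 → Fin 2 → ℝ) (x : E2) (i j : Fin 2) : ℝ :=
  cov1 G (smallGamma G T τ) x i j + tr2 (G x) fun a b => smallQ G T τ x i a * τ x b j

/-- The integrability conditions, for `t = 0`, of the prolongation systems for the compatible
potentials and for the tracefree conformal Killing tensors. -/
structure IntegrabilityConditions (G : E2 → Matrix (Fin 2) (Fin 2) ℝ)
    (T : E2 → Fin 2 → Fin 2 → Fin 2 → ℝ) (τ : E2 → Fin 2 → Fin 2 → ℝ) (x : E2) : Prop where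
  /-- `T = S` is totally symmetric and tracefree. -/
  decomposition : IsSymmTracefree3 (G x) (T x)
  /-- `0 = Δt = (1/3) |S|² + (3/2) R`. -/
  laplace_t : 0 = 1 / 3 * normSq3 (G x) (T x) + 3 / 2 * scalarCurv G x
  /-- `(i j k l)_∘ ∇ₗ Sᵢⱼₖ = 0`. -/
  symm_deriv : ∀ i j k l, tracefree4 (G x) (young4 (cov3 G T x)) i j k l = 0
  /-- `τᵢⱼ = ((1/3) ∇ᵃ Sᵢⱼₐ)_∘`. -/
  tau : ∀ i j, τ x i j = tracefree2 (G x) (fun a b => 1 / 3 * div3 G T x a b) i j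
  /-- `[k, l] (qₖₙ,ₗ + Tₘₗₙ qₖᵐ + γₖ gₗₙ) = 0`. -/
  q : ∀ k l n, qTerm G T τ x k l n - qTerm G T τ x l k n = 0
  /-- `[i, j] (γᵢ,ⱼ + qᵢᵐ τₘⱼ) = 0`. -/
  gamma : ∀ i j, gammaTerm G T τ x i j - gammaTerm G T τ x j i = 0

/-! ## Tensor fields on a surface -/

section Surface

variable {M : Type*} [TopologicalSpace M] [ChartedSpace E2 M]

/-- The smooth charts of the surface. -/
def charts (M : Type*) [TopologicalSpace M] [ChartedSpace E2 M] : Set (OpenPartialHomeomorph M E2) :=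
  IsManifold.maximalAtlas (𝓡 2) ∞ M

/-- Covariant tensor fields of rank `k` on `M` (not necessarily smooth). -/
abbrev CovTensor (k : ℕ) (M : Type*) [TopologicalSpace M] [ChartedSpace E2 M] :=
  (p : M) → MultilinearMap ℝ (fun _ : Fin k => TangentSpace (𝓡 2) p) ℝ

/-- The coordinate vector field `∂ᵢ` of the chart `c`, at the point with coordinates `x`. -/
def frame (c : OpenPartialHomeomorph M E2) (x : E2) (i : Fin 2) :
    TangentSpace (𝓡 2) (c.symm x) :=
  mfderiv (𝓡 2) (𝓡 2) c.symm x (ee i)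

/-- The components of a tensor field in a chart, as functions of the coordinates. -/
def comp {k : ℕ} (c : OpenPartialHomeomorph M E2) (A : CovTensor k M) (x : E2)
    (idx : Fin k → Fin 2) : ℝ :=
  A (c.symm x) fun a => frame c x (idx a)

/-- The components `Aᵢⱼ` in a chart. -/
def comp2 (c : OpenPartialHomeomorph M E2) (A : CovTensor 2 M) (x : E2) (i j : Fin 2) : ℝ :=
  comp c A x ![i, j]

/-- The components `Aᵢⱼₖ` in a chart. -/
def comp3 (c : OpenPartialHomeomorph M E2) (A : CovTensor 3 M) (x : E2) (i j k : Fin 2) : ℝ :=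
  comp c A x ![i, j, k]

/-- A tensor field is smooth if its components in every chart are smooth. -/
def IsSmooth {k : ℕ} (A : CovTensor k M) : Prop :=
  ∀ c ∈ charts M, ∀ idx : Fin k → Fin 2, ContDiffOn ℝ ∞ (fun x => comp c A x idx) c.target

/-- Smooth Riemannian metrics on the surface `M`. -/
abbrev Metric (M : Type*) [TopologicalSpace M] [ChartedSpace E2 M] [IsManifold (𝓡 2) ∞ M] :=
  Bundle.ContMDiffRiemannianMetric (𝓡 2) ∞ E2 (fun p : M => TangentSpace (𝓡 2) p)

variable [IsManifold (𝓡 2) ∞ M]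

/-- The components `gᵢⱼ` of the metric in a chart. -/
def metricComp (c : OpenPartialHomeomorph M E2) (g : Metric M) (x : E2) :
    Matrix (Fin 2) (Fin 2) ℝ :=
  Matrix.of fun i j => g.inner (c.symm x) (frame c x i) (frame c x j)

/-! ## Superintegrable systems

Functions on the cotangent bundle are written in the Darboux coordinates `(x, p)` that are
associated with a chart of `M`. -/

/-- The canonical Poisson bracket in Darboux coordinates. -/
def poisson (F K : E2 × E2 → ℝ) (z : E2 × E2) : ℝ :=
  ∑ i, (fderiv ℝ F z (ee i, 0) * fderiv ℝ K z (0, ee i)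
    - fderiv ℝ K z (ee i, 0) * fderiv ℝ F z (0, ee i))

/-- The natural Hamiltonian `H = gⁱʲ pᵢ pⱼ + V` in the chart `c`. -/
def hamiltonian (c : OpenPartialHomeomorph M E2) (g : Metric M) (V : M → ℝ) (z : E2 × E2) : ℝ :=
  (∑ i, ∑ j, (metricComp c g z.1)⁻¹ i j * z.2 i * z.2 j) + V (c.symm z.1)

/-- The function `F = Cⁱʲ pᵢ pⱼ + W` in the chart `c`. -/
def quadFun (c : OpenPartialHomeomorph M E2) (g : Metric M) (C : CovTensor 2 M) (W : M → ℝ)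
    (z : E2 × E2) : ℝ :=
  (∑ i, ∑ j, ∑ a, ∑ b, (metricComp c g z.1)⁻¹ i a * (metricComp c g z.1)⁻¹ j b *
    comp2 c C z.1 a b * z.2 i * z.2 j) + W (c.symm z.1)

/-- `F = Cⁱʲ pᵢ pⱼ + W` is, over the open set `U`, a conformal integral of `H = gⁱʲ pᵢ pⱼ + V`:
`{F, H} = ρ H` with a function `ρ` that is polynomial in the momenta. -/
def IsConformalIntegralOn (g : Metric M) (V : M → ℝ) (C : CovTensor 2 M) (W : M → ℝ)
    (U : Set M) : Prop :=
  ∀ c ∈ charts M, ∀ x ∈ c.target, c.symm x ∈ U → ∃ ρ : MvPolynomial (Fin 2) ℝ, ∀ p : E2,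
    poisson (quadFun c g C W) (hamiltonian c g V) (x, p) =
      MvPolynomial.eval (fun i => p i) ρ * hamiltonian c g V (x, p)

/-- The Bertrand-Darboux condition for `C` and the potential `V`: locally there is a smooth `W`
such that `Cⁱʲ pᵢ pⱼ + W` is a conformal integral of `gⁱʲ pᵢ pⱼ + V`. By Poincaré's lemma this says
that the one-form `Cᵃᵢ V,ₐ + (1/2) Cᵃᵢ,ₐ V` is closed (for a conformal Killing tensor `C` that is
tracefree). -/
def BertrandDarboux (g : Metric M) (V : M → ℝ) (C : CovTensor 2 M) : Prop :=
  ∀ p : M, ∃ U : Set M, IsOpen U ∧ p ∈ U ∧ ∃ W : M → ℝ,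
    ContMDiffOn (𝓡 2) 𝓘(ℝ) ∞ W U ∧ IsConformalIntegralOn g V C W U

/-- A second order (maximally) conformally superintegrable system on `(M, g)`, with Hamiltonian
`H = gⁱʲ pᵢ pⱼ + V` and conformal integrals `H`, `C 0 + W 0`, `C 1 + W 1`, whose quadratic parts
`C α` are taken tracefree. -/
structure IsConfSuperintegrable (g : Metric M) (V : M → ℝ) (C : Fin 2 → CovTensor 2 M)
    (W : Fin 2 → M → ℝ) : Prop where
  smooth_V : ContMDiff (𝓡 2) 𝓘(ℝ) ∞ V
  smooth_C : ∀ α, IsSmooth (C α)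
  smooth_W : ∀ α, ContMDiff (𝓡 2) 𝓘(ℝ) ∞ (W α)
  symm_tracefree : ∀ α, ∀ c ∈ charts M, ∀ x ∈ c.target,
    IsSymmTracefree2 (metricComp c g x) (comp2 c (C α) x)
  integral : ∀ α, IsConformalIntegralOn g V (C α) (W α) Set.univ
  /-- The three integrals are functionally independent: their differentials are linearly
  independent on a dense subset of the cotangent bundle. -/
  independent : ∀ c ∈ charts M, c.target ×ˢ Set.univ ⊆ closure
    {z : E2 × E2 | z.1 ∈ c.target ∧ LinearIndependent ℝ ![fderiv ℝ (hamiltonian c g V) z,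
      fderiv ℝ (quadFun c g (C 0) (W 0)) z, fderiv ℝ (quadFun c g (C 1) (W 1)) z]}

/-- At every point, the endomorphisms associated by `g` with the tensors `C α` form an irreducible
set: they have no common eigenvector, i.e. no common invariant line. -/
def IsIrreducible (g : Metric M) (C : Fin 2 → CovTensor 2 M) : Prop :=
  ∀ (p : M) (v : TangentSpace (𝓡 2) p), v ≠ 0 →
    ¬ ∀ α, ∃ μ : ℝ, ∀ w : TangentSpace (𝓡 2) p, C α p ![v, w] = μ * g.inner p v w

/-- `T` and `τ` are the primary and secondary structure tensors of the space `𝒱` of potentials: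
`V,ᵢⱼ = Tᵢⱼᵏ V,ₖ + (1/2) gᵢⱼ ΔV + τᵢⱼ V` for all `V ∈ 𝒱`, where `T` is symmetric and tracefree in
its first two indices and `τ` is symmetric and tracefree. -/
structure IsStructureTensors (g : Metric M) (𝒱 : Submodule ℝ (M → ℝ)) (T : CovTensor 3 M)
    (τ : CovTensor 2 M) : Prop where
  smooth_T : IsSmooth T
  smooth_τ : IsSmooth τ
  symm_tracefree_T : ∀ c ∈ charts M, ∀ x ∈ c.target, ∀ k,
    IsSymmTracefree2 (metricComp c g x) (fun i j => comp3 c T x i j k)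
  symm_tracefree_τ : ∀ c ∈ charts M, ∀ x ∈ c.target,
    IsSymmTracefree2 (metricComp c g x) (comp2 c τ x)
  wilczynski : ∀ V ∈ 𝒱, ∀ c ∈ charts M, ∀ x ∈ c.target, ∀ i j,
    hess (metricComp c g) (V ∘ c.symm) x i j =
      (tr2 (metricComp c g x) fun a b => comp3 c T x i j a * pd b (V ∘ c.symm) x)
        + 1 / 2 * metricComp c g x i j *
          tr2 (metricComp c g x) (hess (metricComp c g) (V ∘ c.symm) x)
        + comp2 c τ x i j * V (c.symm x)

/-- A non-degenerate (irreducible, second order) conformally superintegrable system on `(M, g)`,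
with its four-dimensional space `𝒱` of potentials and its structure tensors `T` and `τ`. The
three-dimensional space of conformal integrals is spanned by `H` and the `C α + W α`. -/
structure IsNondegenerate (g : Metric M) (V : M → ℝ) (C : Fin 2 → CovTensor 2 M)
    (W : Fin 2 → M → ℝ) (𝒱 : Submodule ℝ (M → ℝ)) (T : CovTensor 3 M) (τ : CovTensor 2 M) :
    Prop where
  superintegrable : IsConfSuperintegrable g V C W
  irreducible : IsIrreducible g C
  smooth : ∀ U ∈ 𝒱, ContMDiff (𝓡 2) 𝓘(ℝ) ∞ U
  mem : V ∈ 𝒱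
  dim : Module.finrank ℝ 𝒱 = 4
  structureTensors : IsStructureTensors g 𝒱 T τ
  bertrandDarboux : ∀ U ∈ 𝒱, ∀ α, BertrandDarboux g U (C α)

/-- Standard gauge: the primary structure tensor is tracefree. Being tracefree and symmetric in
the first two indices, `T` has only the trace `2 tⱼ = Tₐⱼᵃ`. -/
def InStandardGauge (g : Metric M) (T : CovTensor 3 M) : Prop :=
  ∀ c ∈ charts M, ∀ x ∈ c.target, ∀ j, traceForm (metricComp c g x) (comp3 c T x) j = 0

end Surface

/-- The equations for the structure tensors `S` and `Ξ` in standard gauge: the closed system for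
`S` and `Ξ`, and the constraint `R = -(2/9) |S|²`. -/
structure ClosedSystem (G : E2 → Matrix (Fin 2) (Fin 2) ℝ) (S : E2 → Fin 2 → Fin 2 → Fin 2 → ℝ)
    (Ξ : E2 → Fin 2 → Fin 2 → ℝ) (x : E2) : Prop where
  deriv_S : ∀ i j k l, cov3 G S x i j k l = rhsS (G x) (Ξ x) i j k l
  deriv_Xi : ∀ i j k, cov2 G Ξ x i j k = rhsXi (G x) (S x) (Ξ x) i j k
  curvature : scalarCurv G x = -(2 / 9) * normSq3 (G x) (S x)

end ConfSuperint

end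

open ConfSuperint
open scoped Manifold ContDiff

/-!
The components of all tensors are taken in a chart. An algebraic identity between tensors at a point
may be checked in an orthonormal frame (`exists_frame`, `act2_surj`, `act2_inj` and their analogues
in other ranks), where a trace-free symmetric tensor on a surface has two independent components
(`IsSymmTracefree2.comps`, `IsSymmTracefree3.comps`). The integrability of the closed system
(`ricciIdentityS`, `ricciIdentityXi`) is a pair of such identities.

*From the closed system to the integrability conditions.* By the system, `div S = Ξ`,
`q = (4/3) Ξ + (11/18) |S|² g`, and `γ` is `7/18` of the differential of `|S|²`. The conditions then
reduce to pointwise identities (`ClosedSystem.integrabilityConditions`).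

*Structure equations of a system in standard gauge.* By `IsPotentialOn.pd_lapl` the equation of the
potentials prolongs to a closed linear first order system for `(U, dU, ΔU)`. On a connected surface
a potential is therefore determined by the values of these at one point (`IsNondegenerate.eq_zero`),
and as the space of potentials has dimension four, all values occur
(`IsNondegenerate.exists_potential`). Relations that are linear in `(U, dU, ΔU)` and hold for all
potentials thus hold for their coefficients (`closed_coefficients`).

Sorting `{F, H} = ρ H` by degree in the momenta shows that `C` is a conformal Killing tensor and
that `dW = C dU + (1/2) (div C) U` (`MetricOn.conformalIntegral`). This one-form being closed for
all potentials `U` gives two relations, `div C = (2/3) T C` (`divergence_eq_of_bertrandDarboux`) and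
one for `τ`. A trace-free conformal Killing tensor on a surface has its covariant derivative
determined by its divergence, so now `∇C` is an algebraic expression in `T` and `C`. By
irreducibility the two tensors `C` span all trace-free symmetric tensors at each point, so their
Ricci identity holds with arbitrary `C`; this determines `∇T` in terms of `Ξ = div T`, and gives
`R = -(2/9) |T|²` (`rhsS_of_ricci`). The relation for `τ` becomes `τ = (1/3) Ξ`
(`secondary_of_bertrandDarboux`). Finally `∇Ξ` is determined by the Ricci identity for `T` together
with the symmetry of the second derivatives of `ΔU` (`rhsXi_of_ricci`).
-/

namespace ConfSuperint

/-! ### Change of frame for covariant tensors of the plane -/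

section

open Matrix

/-- Change of frame for one-forms: `θ` are the components in an auxiliary frame, `L` expresses the
coordinate frame in the auxiliary one. With `h = L Lᵀ` the auxiliary frame is orthonormal. -/
def act1 (L : Matrix (Fin 2) (Fin 2) ℝ) (θ : Fin 2 → ℝ) (i : Fin 2) : ℝ := ∑ α, L i α * θ α

/-- Change of frame for covariant tensors of rank two. -/
def act2 (L : Matrix (Fin 2) (Fin 2) ℝ) (A : Fin 2 → Fin 2 → ℝ) (i j : Fin 2) : ℝ :=
  ∑ α, ∑ β, L i α * L j β * A α β

/-- Change of frame for covariant tensors of rank three. -/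
def act3 (L : Matrix (Fin 2) (Fin 2) ℝ) (A : Fin 2 → Fin 2 → Fin 2 → ℝ) (i j k : Fin 2) : ℝ :=
  ∑ α, ∑ β, ∑ γ, L i α * L j β * L k γ * A α β γ

/-- Change of frame for covariant tensors of rank four. -/
def act4 (L : Matrix (Fin 2) (Fin 2) ℝ) (A : Fin 2 → Fin 2 → Fin 2 → Fin 2 → ℝ)
    (i j k l : Fin 2) : ℝ :=
  ∑ α, ∑ β, ∑ γ, ∑ δ, L i α * L j β * L k γ * L l δ * A α β γ δ

variable {L : Matrix (Fin 2) (Fin 2) ℝ}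

theorem act1_surj (hL : IsUnit L.det) (θ : Fin 2 → ℝ) : ∃ η, act1 L η = θ := by
  refine ⟨L⁻¹ *ᵥ θ, ?_⟩
  have : L *ᵥ (L⁻¹ *ᵥ θ) = θ := by
    rw [Matrix.mulVec_mulVec, Matrix.mul_nonsing_inv _ hL, Matrix.one_mulVec]
  exact this

theorem act2_surj (hL : IsUnit L.det) (A : Fin 2 → Fin 2 → ℝ) : ∃ B, act2 L B = A := by
  choose B hB using fun i => act1_surj hL (A i)
  choose D hD using fun j => act1_surj hL (fun i => B i j)
  refine ⟨fun α β => D β α, ?_⟩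
  ext i j
  have h1 := congrFun (hB i) j
  have h2 := fun β => congrFun (hD β) i
  simp only [act1, act2, Fin.sum_univ_two] at *
  rw [← h1, ← h2, ← h2]; ring

theorem act3_surj (hL : IsUnit L.det) (A : Fin 2 → Fin 2 → Fin 2 → ℝ) : ∃ B, act3 L B = A := by
  choose B hB using fun i => act2_surj hL (A i)
  choose D hD using fun p : Fin 2 × Fin 2 => act1_surj hL (fun i => B i p.1 p.2)
  refine ⟨fun α β γ => D (β, γ) α, ?_⟩
  ext i j k
  have h1 := congrFun (congrFun (hB i) j) k
  have h2 := fun β => congrFun (hD β) i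
  simp only [act1, act2, act3, Fin.sum_univ_two] at *
  rw [← h1]
  linear_combination L j 0 * L k 0 * h2 (0, 0) + L j 0 * L k 1 * h2 (0, 1)
    + L j 1 * L k 0 * h2 (1, 0) + L j 1 * L k 1 * h2 (1, 1)

theorem act4_surj (hL : IsUnit L.det) (A : Fin 2 → Fin 2 → Fin 2 → Fin 2 → ℝ) :
    ∃ B, act4 L B = A := by
  choose B hB using fun i => act3_surj hL (A i)
  choose D hD using fun p : Fin 2 × Fin 2 × Fin 2 => act1_surj hL (fun i => B i p.1 p.2.1 p.2.2)
  refine ⟨fun α β γ δ => D (β, γ, δ) α, ?_⟩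
  ext i j k l
  have h1 := congrFun (congrFun (congrFun (hB i) j) k) l
  have h2 := fun β => congrFun (hD β) i
  simp only [act1, act3, act4, Fin.sum_univ_two] at *
  rw [← h1]
  linear_combination L j 0 * L k 0 * (L l 0 * h2 (0, 0, 0) + L l 1 * h2 (0, 0, 1))
    + L j 0 * L k 1 * (L l 0 * h2 (0, 1, 0) + L l 1 * h2 (0, 1, 1))
    + L j 1 * L k 0 * (L l 0 * h2 (1, 0, 0) + L l 1 * h2 (1, 0, 1))
    + L j 1 * L k 1 * (L l 0 * h2 (1, 1, 0) + L l 1 * h2 (1, 1, 1))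

theorem act1_inj (hL : IsUnit L.det) {θ η : Fin 2 → ℝ} (h : act1 L θ = act1 L η) : θ = η :=
  Matrix.mulVec_injective_of_isUnit ((Matrix.isUnit_iff_isUnit_det L).2 hL) h

theorem act2_inj (hL : IsUnit L.det) {A B : Fin 2 → Fin 2 → ℝ} (h : act2 L A = act2 L B) :
    A = B := by
  have h1 : (fun i => act1 L (fun α => act1 L (A α) i)) =
      fun i => act1 L (fun α => act1 L (B α) i) := by
    ext j i
    have := congrFun (congrFun h i) j
    simp only [act1, act2, Fin.sum_univ_two] at *
    linarith
  ext α β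
  have h2 : act1 L (A α) = act1 L (B α) := by
    ext j; exact congrFun (act1_inj hL (congrFun h1 j)) α
  exact congrFun (act1_inj hL h2) β

theorem act3_inj (hL : IsUnit L.det) {A B : Fin 2 → Fin 2 → Fin 2 → ℝ} (h : act3 L A = act3 L B) :
    A = B := by
  have h1 : ∀ i j, act1 L (fun α => act2 L (A α) i j) = act1 L (fun α => act2 L (B α) i j) := by
    intro i j; ext k
    have := congrFun (congrFun (congrFun h k) i) j
    simp only [act1, act2, act3, Fin.sum_univ_two] at *
    linarith
  ext α β γ
  have h2 : act2 L (A α) = act2 L (B α) := by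
    ext i j; exact congrFun (act1_inj hL (h1 i j)) α
  exact congrFun (congrFun (act2_inj hL h2) β) γ

theorem act4_inj (hL : IsUnit L.det) {A B : Fin 2 → Fin 2 → Fin 2 → Fin 2 → ℝ}
    (h : act4 L A = act4 L B) : A = B := by
  have h1 : ∀ i j k, act1 L (fun α => act3 L (A α) i j k) =
      act1 L (fun α => act3 L (B α) i j k) := by
    intro i j k; ext l
    have := congrFun (congrFun (congrFun (congrFun h l) i) j) k
    simp only [act1, act3, act4, Fin.sum_univ_two] at *
    linarith
  ext α β γ δ
  have h2 : act3 L (A α) = act3 L (B α) := by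
    ext i j k; exact congrFun (act1_inj hL (h1 i j k)) α
  exact congrFun (congrFun (congrFun (act3_inj hL h2) β) γ) δ

theorem metric_symm {h : Matrix (Fin 2) (Fin 2) ℝ} (hh : h.PosDef) (i j : Fin 2) :
    h i j = h j i := by
  simpa using hh.isHermitian.apply j i

/-- Every metric has an orthonormal frame. Here `L` is its Cholesky factor. -/
theorem exists_frame {h : Matrix (Fin 2) (Fin 2) ℝ} (hh : h.PosDef) :
    ∃ L : Matrix (Fin 2) (Fin 2) ℝ, IsUnit L.det ∧ h = L * Lᵀ := by
  have h0 : 0 < h 0 0 := hh.diag_pos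
  have hs : h 1 0 = h 0 1 := by simpa using hh.isHermitian.apply 0 1
  have hd : 0 < h 0 0 * h 1 1 - h 0 1 * h 0 1 := by
    have := hh.det_pos
    rwa [Matrix.det_fin_two, hs] at this
  have hp := Real.sqrt_pos.2 h0
  have hr := Real.sqrt_pos.2 (div_pos hd h0)
  have hp2 := Real.mul_self_sqrt h0.le
  have hr2 := Real.mul_self_sqrt (div_pos hd h0).le
  set p := √(h 0 0)
  set r := √((h 0 0 * h 1 1 - h 0 1 * h 0 1) / h 0 0)
  refine ⟨!![p, 0; h 0 1 / p, r], ?_, ?_⟩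
  · rw [Matrix.det_fin_two_of]
    rw [zero_mul, sub_zero]
    exact (mul_pos hp hr).ne'.isUnit
  · ext i j
    fin_cases i <;> fin_cases j <;> simp [Matrix.mul_apply, Fin.sum_univ_two]
    · exact hp2.symm
    · field_simp
    · rw [hs]; field_simp
    · rw [hr2]
      field_simp
      rw [show p ^ 2 = h 0 0 by rw [← hp2]; ring]
      field_simp
      ring

theorem tr2_eq_trace (h : Matrix (Fin 2) (Fin 2) ℝ) (A : Fin 2 → Fin 2 → ℝ) :
    tr2 h A = (h⁻¹ * (Matrix.of A)ᵀ).trace := by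
  simp [tr2, Matrix.trace, Matrix.mul_apply]

/-- In an orthonormal frame a metric trace is a sum of diagonal entries. -/
theorem tr2_act (hL : IsUnit L.det) (A : Fin 2 → Fin 2 → ℝ) :
    tr2 (L * Lᵀ) (fun a b => ∑ α, ∑ β, L a α * L b β * A α β) = A 0 0 + A 1 1 := by
  rw [tr2_eq_trace]
  have : (Matrix.of fun a b => ∑ α, ∑ β, L a α * L b β * A α β) = L * Matrix.of A * Lᵀ := by
    ext i j; simp [Matrix.mul_apply]; ring
  rw [this, Matrix.mul_inv_rev, Matrix.transpose_mul, Matrix.transpose_mul,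
      Matrix.transpose_transpose,
    Matrix.trace_mul_comm]
  have hL' : IsUnit Lᵀ.det := by simpa using hL
  rw [show L * ((Matrix.of A)ᵀ * Lᵀ) * (Lᵀ⁻¹ * L⁻¹) = L * ((Matrix.of A)ᵀ * (Lᵀ * Lᵀ⁻¹) * L⁻¹) by
    simp only [Matrix.mul_assoc], Matrix.mul_nonsing_inv _ hL', Matrix.mul_one,
        Matrix.trace_mul_comm,
    Matrix.mul_assoc, Matrix.nonsing_inv_mul _ hL]
  simp [Matrix.trace]

theorem contr32_eq (h : Matrix (Fin 2) (Fin 2) ℝ) (S Ξ k) :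
    contr32 h S Ξ k = tr2 h fun a c => tr2 h fun b d => S k a b * Ξ c d := by
  simp only [contr32, tr2, Fin.sum_univ_two]; ring

/-- The inner product `Sᵃᵇᶜ Tₐᵦ꜀` of tensors of rank three, as an iterated trace. -/
noncomputable def inner3 (h : Matrix (Fin 2) (Fin 2) ℝ) (S T : Fin 2 → Fin 2 → Fin 2 → ℝ) : ℝ :=
  tr2 h fun a d => tr2 h fun b e => tr2 h fun c f => S a b c * T d e f

theorem normSq3_eq (h : Matrix (Fin 2) (Fin 2) ℝ) (S) : normSq3 h S = inner3 h S S := by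
  simp only [normSq3, inner3, tr2, Fin.sum_univ_two]; ring

theorem contr32_act (hL : IsUnit L.det) (S Ξ) :
    contr32 (L * Lᵀ) (act3 L S) (act2 L Ξ) = act1 L (contr32 1 S Ξ) := by
  ext k
  rw [contr32_eq]
  have h1 : ∀ a c, (tr2 (L * Lᵀ) fun b d => act3 L S k a b * act2 L Ξ c d) =
      ∑ α, ∑ β, L a α * L c β * (∑ κ, ∑ b, L k κ * S κ α b * Ξ β b) := by
    intro a c
    rw [show (fun b d => act3 L S k a b * act2 L Ξ c d) = fun b d => ∑ α, ∑ β, L b α * L d β *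
      (∑ κ, ∑ μ, ∑ ν, L k κ * L a μ * L c ν * S κ μ α * Ξ ν β) by
        ext b d; simp only [act3, act2, Fin.sum_univ_two]; ring]
    rw [tr2_act hL]
    simp only [Fin.sum_univ_two]; ring
  simp only [h1]
  rw [tr2_act hL]
  simp [contr32, act1, Fin.sum_univ_two, Matrix.one_apply]; ring

theorem inner3_act (hL : IsUnit L.det) (S T) :
    inner3 (L * Lᵀ) (act3 L S) (act3 L T) = inner3 1 S T := by
  have h0 : ∀ a d b e, (tr2 (L * Lᵀ) fun c f => act3 L S a b c * act3 L T d e f) =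
      ∑ α, ∑ β, L b α * L e β * (∑ μ, ∑ ν, ∑ c, L a μ * L d ν * S μ α c * T ν β c) := by
    intro a d b e
    rw [show (fun c f => act3 L S a b c * act3 L T d e f) = fun c f => ∑ α, ∑ β, L c α * L f β *
      ((∑ μ, ∑ ν, L a μ * L b ν * S μ ν α) * (∑ μ, ∑ ν, L d μ * L e ν * T μ ν β)) by
        ext c f; simp only [act3, Fin.sum_univ_two]; ring]
    rw [tr2_act hL]
    simp only [Fin.sum_univ_two]; ring
  have h1 : ∀ a d, (tr2 (L * Lᵀ) fun b e => tr2 (L * Lᵀ) fun c f => act3 L S a b c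
      * act3 L T d e f) =
      ∑ α, ∑ β, L a α * L d β * (∑ b, ∑ c, S α b c * T β b c) := by
    intro a d
    simp only [h0]
    rw [tr2_act hL]
    simp only [Fin.sum_univ_two]; ring
  simp only [inner3, h1]
  rw [tr2_act hL]
  simp [tr2, Fin.sum_univ_two, Matrix.one_apply]

theorem normSq3_act (hL : IsUnit L.det) (S) :
    normSq3 (L * Lᵀ) (act3 L S) = normSq3 1 S := by
  rw [normSq3_eq, inner3_act hL, normSq3_eq]

end

/-! ### Integrability of the closed system: the Ricci identity of `S` -/

section

open Matrix

variable {L : Matrix (Fin 2) (Fin 2) ℝ}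

theorem mul_transpose_apply_two (L : Matrix (Fin 2) (Fin 2) ℝ) (i j : Fin 2) :
    (L * Lᵀ) i j = L i 0 * L j 0 + L i 1 * L j 1 := by
  simp [Matrix.mul_apply]

theorem posDef_mul_transpose (hL : IsUnit L.det) : (L * Lᵀ).PosDef := by
  have := Matrix.PosDef.mul_conjTranspose_self L
    (Matrix.vecMul_injective_of_isUnit ((Matrix.isUnit_iff_isUnit_det L).2 hL))
  rwa [Matrix.conjTranspose_eq_transpose_of_trivial] at this

theorem tr2_one (A : Fin 2 → Fin 2 → ℝ) : tr2 1 A = A 0 0 + A 1 1 := by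
  simp [tr2, Matrix.one_apply]

theorem tr2_act2 (hL : IsUnit L.det) (A : Fin 2 → Fin 2 → ℝ) :
    tr2 (L * Lᵀ) (act2 L A) = tr2 1 A := by
  rw [tr2_one]; exact tr2_act hL A

theorem isSymmTracefree2_act (hL : IsUnit L.det) (A : Fin 2 → Fin 2 → ℝ) :
    IsSymmTracefree2 (L * Lᵀ) (act2 L A) ↔ IsSymmTracefree2 1 A := by
  unfold IsSymmTracefree2
  rw [tr2_act2 hL]
  refine and_congr_left fun _ => ⟨fun h => ?_, fun h i j => ?_⟩
  · have : act2 L A = act2 L (fun i j => A j i) := by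
      ext i j
      rw [h]; simp only [act2, Fin.sum_univ_two]; ring
    intro i j
    exact congrFun (congrFun (act2_inj hL this) i) j
  · simp only [act2, Fin.sum_univ_two, h 1 0]; ring

theorem tr2_act3 (hL : IsUnit L.det) (S : Fin 2 → Fin 2 → Fin 2 → ℝ) (k : Fin 2) :
    tr2 (L * Lᵀ) (fun a b => act3 L S a b k) = act1 L (fun γ => tr2 1 fun a b => S a b γ) k := by
  have : (fun a b => act3 L S a b k) = fun a b => ∑ α, ∑ β, L a α * L b β *
      ∑ γ, L k γ * S α β γ := by
    ext a b; simp only [act3, Fin.sum_univ_two]; ring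
  rw [this, tr2_act hL]; simp only [act1, tr2_one, Fin.sum_univ_two]; ring

theorem isSymmTracefree3_act (hL : IsUnit L.det) (S : Fin 2 → Fin 2 → Fin 2 → ℝ) :
    IsSymmTracefree3 (L * Lᵀ) (act3 L S) ↔ IsSymmTracefree3 1 S := by
  unfold IsSymmTracefree3
  refine and_congr ⟨fun h => ?_, fun h i j k => ?_⟩ ⟨fun h => ?_, fun h k => ?_⟩
  · have h1 : act3 L S = act3 L (fun i j k => S j i k) := by
      ext i j k
      rw [(h i j k).1]; simp only [act3, Fin.sum_univ_two]; ring
    have h2 : act3 L S = act3 L (fun i j k => S i k j) := by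
      ext i j k
      rw [(h i j k).2]; simp only [act3, Fin.sum_univ_two]; ring
    intro i j k
    exact ⟨congrFun (congrFun (congrFun (act3_inj hL h1) i) j) k,
      congrFun (congrFun (congrFun (act3_inj hL h2) i) j) k⟩
  · simp only [act3, Fin.sum_univ_two, (h 1 0 0).1, (h 0 1 0).2, (h 1 1 0).2, (h 1 0 1).1]
    constructor <;> ring
  · have : act1 L (fun γ => tr2 1 fun a b => S a b γ) = act1 L (fun _ => 0) := by
      ext k; rw [← tr2_act3 hL, h]; simp [act1]
    intro k
    exact congrFun (act1_inj hL this) k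
  · rw [tr2_act3 hL]
    simp [act1, h]

/-- A trace-free symmetric tensor of rank three has two independent components in an orthonormal
frame, `S 0 0 0` and `S 0 0 1`. -/
theorem IsSymmTracefree3.comps {S : Fin 2 → Fin 2 → Fin 2 → ℝ} (h : IsSymmTracefree3 1 S) :
    S 0 1 0 = S 0 0 1 ∧ S 1 0 0 = S 0 0 1 ∧ S 0 1 1 = - S 0 0 0 ∧ S 1 0 1 = - S 0 0 0 ∧
      S 1 1 0 = - S 0 0 0 ∧ S 1 1 1 = - S 0 0 1 := by
  obtain ⟨h1, h2⟩ := h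
  simp only [tr2_one] at h2
  have := h2 0; have := h2 1
  have := (h1 1 1 0).2; have := (h1 1 0 1).1; have := (h1 0 1 0).2; have := (h1 1 0 0).1
  refine ⟨?_, ?_, ?_, ?_, ?_, ?_⟩ <;> linarith

/-- A trace-free symmetric tensor of rank two has two independent components in an orthonormal
frame, `A 0 0` and `A 0 1`. -/
theorem IsSymmTracefree2.comps {A : Fin 2 → Fin 2 → ℝ} (h : IsSymmTracefree2 1 A) :
    A 1 0 = A 0 1 ∧ A 1 1 = - A 0 0 := by
  obtain ⟨h1, h2⟩ := h
  rw [tr2_one] at h2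
  exact ⟨h1 1 0, by linarith⟩

/-- A tensor is symmetric and trace-free in its first two indices if it is so in some frame. -/
theorem isSymmTracefree2_of_act3 (hL : IsUnit L.det) {N : Fin 2 → Fin 2 → Fin 2 → ℝ}
    (h : ∀ k, IsSymmTracefree2 (L * Lᵀ) fun i j => act3 L N i j k) (k : Fin 2) :
    IsSymmTracefree2 1 fun i j => N i j k := by
  refine ⟨fun i j => ?_, ?_⟩
  · have : act3 L N = act3 L fun i j k => N j i k := by
      ext i j k
      refine ((h k).1 i j).trans ?_
      simp only [act3, Fin.sum_univ_two]; ring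
    exact congrFun (congrFun (congrFun (act3_inj hL this) i) j) k
  · have : act1 L (fun k => tr2 1 fun a b => N a b k) = act1 L fun _ => 0 := by
      ext k
      rw [← tr2_act3 hL, (h k).2]; simp [act1]
    exact congrFun (act1_inj hL this) k

theorem tr2_act3_outer (hL : IsUnit L.det) (N : Fin 2 → Fin 2 → Fin 2 → ℝ) (k : Fin 2) :
    (tr2 (L * Lᵀ) fun a b => act3 L N a k b) = act1 L (fun k => N 0 k 0 + N 1 k 1) k := by
  rw [show (fun a b => act3 L N a k b) = fun a b => ∑ α, ∑ β, L a α * L b β *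
    ∑ γ, L k γ * N α γ β by
      ext a b; simp only [act3, Fin.sum_univ_two]; ring, tr2_act hL]
  simp only [act1, Fin.sum_univ_two]; ring

theorem tr2_act3_mul_act2 (hL : IsUnit L.det) (S : Fin 2 → Fin 2 → Fin 2 → ℝ)
    (A : Fin 2 → Fin 2 → ℝ) (k l n : Fin 2) :
    (tr2 (L * Lᵀ) fun a b => act3 L S a l n * act2 L A b k) =
      ∑ α, ∑ κ, ∑ μ, ∑ ν, L k κ * L l μ * L n ν * (S α μ ν * A α κ) := by
  rw [show (fun a b => act3 L S a l n * act2 L A b k) = fun a b => ∑ α, ∑ β, L a α * L b β *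
    ∑ κ, ∑ μ, ∑ ν, L k κ * L l μ * L n ν * (S α μ ν * A β κ) by
      ext a b; simp only [act3, act2, Fin.sum_univ_two]; ring, tr2_act hL]
  simp only [Fin.sum_univ_two]

theorem rhsS_act (Ξ : Fin 2 → Fin 2 → ℝ) :
    rhsS (L * Lᵀ) (act2 L Ξ) = act4 L (rhsS 1 Ξ) := by
  ext i j k l
  simp only [rhsS, young3, act2, act4, mul_transpose_apply_two, Fin.sum_univ_two, Matrix.one_apply]
  norm_num
  ring

/-- Lowering the index that the contraction has raised: `gᵃᵇ gₐₖ θᵦ = θₖ`. -/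
theorem tr2_metric_mul {h : Matrix (Fin 2) (Fin 2) ℝ} (hh : h.PosDef) (θ : Fin 2 → ℝ) (k : Fin 2) :
    tr2 h (fun a b => h a k * θ b) = θ k := by
  obtain ⟨L, hL, rfl⟩ := exists_frame hh
  obtain ⟨θ, rfl⟩ := act1_surj hL θ
  rw [show (fun a b => (L * Lᵀ) a k * act1 L θ b) = fun a b => ∑ α, ∑ β, L a α * L b β *
      (L k α * θ β) by
    ext a b; simp only [act1, mul_transpose_apply_two, Fin.sum_univ_two]; ring, tr2_act hL]
  simp only [act1, Fin.sum_univ_two]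

theorem rhsXi_eq {h : Matrix (Fin 2) (Fin 2) ℝ} (hh : h.PosDef) (S Ξ) (i j k : Fin 2) :
    rhsXi h S Ξ i j k = 1 / 3 * S i j k * normSq3 h S + 2 / 3 * (h i k * contr32 h S Ξ j
      + h j k * contr32 h S Ξ i - h i j * contr32 h S Ξ k) := by
  rw [rhsXi, youngTf2, tr2_metric_mul hh]

theorem rhsXi_act (hL : IsUnit L.det) (S Ξ) :
    rhsXi (L * Lᵀ) (act3 L S) (act2 L Ξ) = act3 L (rhsXi 1 S Ξ) := by
  have hh := posDef_mul_transpose hL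
  ext i j k
  rw [rhsXi_eq hh, normSq3_act hL, contr32_act hL]
  simp only [act3, rhsXi_eq Matrix.PosDef.one]
  simp only [act1, mul_transpose_apply_two, Fin.sum_univ_two, Matrix.one_apply]
  norm_num
  ring

theorem contr32_one {S Ξ} (hS : IsSymmTracefree3 1 S) (hX : IsSymmTracefree2 1 Ξ) :
    contr32 1 S Ξ 0 = 2 * (S 0 0 0 * Ξ 0 0 + S 0 0 1 * Ξ 0 1) ∧
    contr32 1 S Ξ 1 = 2 * (S 0 0 1 * Ξ 0 0 - S 0 0 0 * Ξ 0 1) := by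
  obtain ⟨h1, h2, h3, h4, h5, h6⟩ := hS.comps
  obtain ⟨h7, h8⟩ := hX.comps
  constructor <;> simp [contr32, Fin.sum_univ_two, Matrix.one_apply, *] <;> ring

theorem normSq3_one {S} (hS : IsSymmTracefree3 1 S) :
    normSq3 1 S = 4 * (S 0 0 0 ^ 2 + S 0 0 1 ^ 2) := by
  obtain ⟨h1, h2, h3, h4, h5, h6⟩ := hS.comps
  simp [normSq3, Fin.sum_univ_two, Matrix.one_apply, *] ; ring

/-- The formal derivatives `dRhsS` and `dRhsXi` are derivatives at `0` of polynomials in `ε` of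
degree at most three. -/
theorem deriv_quad {f : ℝ → ℝ} (a b c d : ℝ) (hf : ∀ ε, f ε = a + ε * b + ε ^ 2 * c + ε ^ 3 * d) :
    deriv f 0 = b := by
  have : HasDerivAt (fun ε : ℝ => a + ε * b + ε ^ 2 * c + ε ^ 3 * d)
      (1 * b + (2 * 0 ^ 1 * 1) * c + (3 * 0 ^ 2 * 1) * d) 0 := by
    have h := hasDerivAt_id (0 : ℝ)
    exact (((h.mul_const b).const_add a).add ((h.pow 2).mul_const c)).add ((h.pow 3).mul_const d)
  rw [show f = _ from funext hf, this.deriv]; ring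

/-- As `rhsS` is linear in `Ξ`, its formal derivative is `rhsS` of the derivative of `Ξ`. -/
theorem dRhsS_eq (h : Matrix (Fin 2) (Fin 2) ℝ) (S Ξ i j k l m) :
    dRhsS h S Ξ i j k l m = rhsS h (fun a b => rhsXi h S Ξ a b m) i j k l := by
  refine deriv_quad (rhsS h Ξ i j k l) _ 0 0 fun ε => ?_
  simp only [rhsS, young3]; ring

/-- The formal derivative of `rhsXi`, by the product rule. -/
theorem dRhsXi_eq {h : Matrix (Fin 2) (Fin 2) ℝ} (hh : h.PosDef) (S Ξ) (i j k m : Fin 2) :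
    dRhsXi h S Ξ i j k m =
      1 / 3 * (rhsS h Ξ i j k m * normSq3 h S
        + S i j k * (inner3 h S (fun a b c => rhsS h Ξ a b c m)
          + inner3 h (fun a b c => rhsS h Ξ a b c m) S))
      + 2 / 3 * (h i k * (contr32 h (fun a b c => rhsS h Ξ a b c m) Ξ j
          + contr32 h S (fun a b => rhsXi h S Ξ a b m) j)
        + h j k * (contr32 h (fun a b c => rhsS h Ξ a b c m) Ξ i
          + contr32 h S (fun a b => rhsXi h S Ξ a b m) i)
        - h i j * (contr32 h (fun a b c => rhsS h Ξ a b c m) Ξ k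
          + contr32 h S (fun a b => rhsXi h S Ξ a b m) k)) := by
  set S' : Fin 2 → Fin 2 → Fin 2 → ℝ := fun a b c => rhsS h Ξ a b c m with hS'
  set Ξ' : Fin 2 → Fin 2 → ℝ := fun a b => rhsXi h S Ξ a b m with hΞ'
  have hN : ∀ ε : ℝ, normSq3 h (fun a b c => S a b c + ε * S' a b c) = normSq3 h S
      + ε * (inner3 h S S' + inner3 h S' S) + ε ^ 2 * normSq3 h S' := by
    intro ε
    simp only [normSq3_eq, inner3, tr2, Fin.sum_univ_two]; ring
  have hc : ∀ (ε : ℝ) k, contr32 h (fun a b c => S a b c + ε * S' a b c)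
      (fun a b => Ξ a b + ε * Ξ' a b) k = contr32 h S Ξ k
      + ε * (contr32 h S' Ξ k + contr32 h S Ξ' k) + ε ^ 2 * contr32 h S' Ξ' k := by
    intro ε k
    simp only [contr32, Fin.sum_univ_two]; ring
  refine deriv_quad (rhsXi h S Ξ i j k) _
    (1 / 3 * (S' i j k * (inner3 h S S' + inner3 h S' S) + S i j k * normSq3 h S')
      + 2 / 3 * (h i k * contr32 h S' Ξ' j + h j k * contr32 h S' Ξ' i
        - h i j * contr32 h S' Ξ' k))
    (1 / 3 * (S' i j k * normSq3 h S')) fun ε => ?_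
  rw [rhsXi_eq hh, rhsXi_eq hh]
  change 1 / 3 * (S i j k + ε * S' i j k) * normSq3 h (fun a b c => S a b c + ε * S' a b c)
    + 2 / 3 * (h i k * contr32 h (fun a b c => S a b c + ε * S' a b c)
      (fun a b => Ξ a b + ε * Ξ' a b) j + h j k * contr32 h (fun a b c => S a b c + ε * S' a b c)
      (fun a b => Ξ a b + ε * Ξ' a b) i - h i j * contr32 h (fun a b c => S a b c + ε * S' a b c)
      (fun a b => Ξ a b + ε * Ξ' a b) k) = _
  rw [hN, hc, hc, hc]
  ring

/-- Contraction of the curvature tensor with a one-form. -/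
theorem sum_inv_curv {h : Matrix (Fin 2) (Fin 2) ℝ} (hh : h.PosDef) (R : ℝ) (m l i : Fin 2)
    (θ : Fin 2 → ℝ) :
    ∑ a, ∑ b, h⁻¹ a b * (curv h R m l i a * θ b) = R / 2 * (h m i * θ l - h l i * θ m) := by
  have hs := metric_symm hh
  have h1 := tr2_metric_mul hh θ l
  have h2 := tr2_metric_mul hh θ m
  simp only [tr2] at h1 h2
  rw [← h1, ← h2, Finset.mul_sum, Finset.mul_sum, ← Finset.sum_sub_distrib, Finset.mul_sum]
  refine Finset.sum_congr rfl fun a _ => ?_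
  rw [Finset.mul_sum, Finset.mul_sum, ← Finset.sum_sub_distrib, Finset.mul_sum]
  refine Finset.sum_congr rfl fun b _ => ?_
  rw [curv, hs l a, hs m a]; ring

/-- The Ricci identity of `S`. The formal second derivative of `S` is `rhsS` of `rhsXi`, so in an
orthonormal frame both sides are polynomials in the components of `S` and `Ξ`; the terms that
involve `Ξ` cancel, and `R = -(2/9) |S|²` makes the cubic terms in `S` agree. -/
theorem ricciIdentityS {h : Matrix (Fin 2) (Fin 2) ℝ} (hh : h.PosDef) {S Ξ}
    (hS : IsSymmTracefree3 h S) (hX : IsSymmTracefree2 h Ξ) :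
    RicciIdentityS h (-(2 / 9) * normSq3 h S) S Ξ := by
  intro i j k l m
  simp only [mul_add, Finset.sum_add_distrib]
  rw [sum_inv_curv hh, sum_inv_curv hh _ _ _ _ (fun b => S i b k),
    sum_inv_curv hh _ _ _ _ (fun b => S i j b), dRhsS_eq, dRhsS_eq]
  simp only [rhsS, young3, rhsXi_eq hh]
  obtain ⟨L, hL, rfl⟩ := exists_frame hh
  obtain ⟨S, rfl⟩ := act3_surj hL S
  obtain ⟨Ξ, rfl⟩ := act2_surj hL Ξ
  rw [isSymmTracefree3_act hL] at hS
  rw [isSymmTracefree2_act hL] at hX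
  rw [normSq3_act hL, contr32_act hL]
  obtain ⟨h1, h2, h3, h4, h5, h6⟩ := hS.comps
  simp only [normSq3_one hS, act1, act3, mul_transpose_apply_two, Fin.sum_univ_two,
    (contr32_one hS hX).1, (contr32_one hS hX).2, h1, h2, h3, h4, h5, h6]
  ring

end

/-! ### Integrability of the closed system: the Ricci identity of `Ξ` -/

section

open Matrix

variable {L : Matrix (Fin 2) (Fin 2) ℝ}

theorem act4_fix (L : Matrix (Fin 2) (Fin 2) ℝ) (A : Fin 2 → Fin 2 → Fin 2 → Fin 2 → ℝ)
    (m : Fin 2) :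
    (fun a b c => act4 L A a b c m) = act3 L fun α β γ => act1 L (A α β γ) m := by
  ext a b c; simp only [act4, act3, act1, Fin.sum_univ_two]; ring

theorem act3_fix (L : Matrix (Fin 2) (Fin 2) ℝ) (A : Fin 2 → Fin 2 → Fin 2 → ℝ) (m : Fin 2) :
    (fun a b => act3 L A a b m) = act2 L fun α β => act1 L (A α β) m := by
  ext a b; simp only [act3, act2, act1, Fin.sum_univ_two]; ring

theorem inner3_comm (h : Matrix (Fin 2) (Fin 2) ℝ) (hs : h.IsSymm) (S T) :
    inner3 h S T = inner3 h T S := by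
  have hs : ∀ i j, h⁻¹ i j = h⁻¹ j i := fun i j => by
    have := (hs.inv).apply j i
    exact this
  simp only [inner3, tr2, Fin.sum_univ_two, hs 1 0]; ring

/-- The contraction of `S` with `∇S`, which gives the derivative of `|S|²`. -/
theorem inner3_rhsS {h : Matrix (Fin 2) (Fin 2) ℝ} (hh : h.PosDef) {S Ξ}
    (hS : IsSymmTracefree3 h S) (hX : IsSymmTracefree2 h Ξ) (m : Fin 2) :
    inner3 h S (fun a b c => rhsS h Ξ a b c m) = contr32 h S Ξ m := by
  obtain ⟨L, hL, rfl⟩ := exists_frame hh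
  obtain ⟨S, rfl⟩ := act3_surj hL S
  obtain ⟨Ξ, rfl⟩ := act2_surj hL Ξ
  rw [isSymmTracefree3_act hL] at hS
  rw [isSymmTracefree2_act hL] at hX
  rw [contr32_act hL, rhsS_act, act4_fix, inner3_act hL]
  obtain ⟨h1, h2, h3, h4, h5, h6⟩ := hS.comps
  obtain ⟨h7, h8⟩ := hX.comps
  simp [inner3, tr2_one, act1, Fin.sum_univ_two, rhsS, young3, Matrix.one_apply,
    (contr32_one hS hX).1, (contr32_one hS hX).2, h1, h2, h3, h4, h5, h6, h7, h8]
  ring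

/-- The part of the derivative of `Sₖₐᵦ Ξᵃᵇ` that comes from `∇S`; it is a multiple of the
metric. -/
theorem contr32_rhsS {h : Matrix (Fin 2) (Fin 2) ℝ} (hh : h.PosDef) {Ξ}
    (hX : IsSymmTracefree2 h Ξ) (m k : Fin 2) :
    contr32 h (fun a b c => rhsS h Ξ a b c m) Ξ k =
      1 / 2 * (tr2 h fun a c => tr2 h fun b d => Ξ a b * Ξ c d) * h k m := by
  obtain ⟨L, hL, rfl⟩ := exists_frame hh
  obtain ⟨Ξ, rfl⟩ := act2_surj hL Ξ
  rw [isSymmTracefree2_act hL] at hX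
  rw [rhsS_act, act4_fix, contr32_act hL]
  have h0 : (fun a c => tr2 (L * Lᵀ) fun b d => act2 L Ξ a b * act2 L Ξ c d) =
      fun a c => ∑ α, ∑ γ, L a α * L c γ * ∑ β, Ξ α β * Ξ γ β := by
    ext a c
    rw [show (fun b d => act2 L Ξ a b * act2 L Ξ c d) = fun b d => ∑ β, ∑ δ, L b β * L d δ *
      ((∑ α, L a α * Ξ α β) * ∑ γ, L c γ * Ξ γ δ) by
        ext b d; simp only [act2, Fin.sum_univ_two]; ring, tr2_act hL]
    simp only [Fin.sum_univ_two]; ring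
  rw [h0, tr2_act hL]
  obtain ⟨h7, h8⟩ := hX.comps
  simp [contr32, act1, Fin.sum_univ_two, rhsS, young3, Matrix.one_apply, h7, h8,
    mul_transpose_apply_two]
  ring

theorem tr2_mul_act1 (hL : IsUnit L.det) (θ η : Fin 2 → ℝ) :
    (tr2 (L * Lᵀ) fun a b => act1 L θ a * act1 L η b) = θ 0 * η 0 + θ 1 * η 1 := by
  rw [show (fun a b => act1 L θ a * act1 L η b) = fun a b => ∑ α, ∑ β, L a α * L b β *
    (θ α * η β) by ext a b; simp only [act1, Fin.sum_univ_two]; ring, tr2_act hL]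

theorem act3_eq_act1 (L : Matrix (Fin 2) (Fin 2) ℝ) (S) (k m : Fin 2) :
    act3 L S k m = act1 L fun γ => act2 L (fun α β => S α β γ) k m := by
  ext a; simp only [act3, act2, act1, Fin.sum_univ_two]; ring

/-- The part of the derivative of `Sₖₐᵦ Ξᵃᵇ` that comes from `∇Ξ`; it is symmetric. -/
theorem contr32_rhsXi {h : Matrix (Fin 2) (Fin 2) ℝ} (hh : h.PosDef) {S Ξ}
    (hS : IsSymmTracefree3 h S) (hX : IsSymmTracefree2 h Ξ) (m k : Fin 2) :
    contr32 h S (fun a b => rhsXi h S Ξ a b m) k =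
      1 / 6 * normSq3 h S ^ 2 * h k m +
        4 / 3 * tr2 h fun a b => S k m a * contr32 h S Ξ b := by
  obtain ⟨L, hL, rfl⟩ := exists_frame hh
  obtain ⟨S, rfl⟩ := act3_surj hL S
  obtain ⟨Ξ, rfl⟩ := act2_surj hL Ξ
  rw [isSymmTracefree3_act hL] at hS
  rw [isSymmTracefree2_act hL] at hX
  rw [rhsXi_act hL, act3_fix, normSq3_act hL, contr32_act hL, contr32_act hL, act3_eq_act1,
    tr2_mul_act1 hL]
  obtain ⟨h1, h2, h3, h4, h5, h6⟩ := hS.comps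
  obtain ⟨h7, h8⟩ := hX.comps
  have c0 := (contr32_one hS hX).1
  have c1 := (contr32_one hS hX).2
  simp only [act1, act2, Fin.sum_univ_two, rhsXi_eq PosDef.one, normSq3_one hS, c0, c1]
  simp [contr32, h1, h2, h3, h4, h5, h6, h7, h8, Matrix.one_apply,
    mul_transpose_apply_two, Fin.sum_univ_two]
  ring

/-- The Ricci identity of `Ξ`. After `inner3_rhsS`, `contr32_rhsS` and `contr32_rhsXi` only terms of
low degree remain, which are compared in an orthonormal frame; the multiple `|Ξ|²` of the metric
drops out. -/
theorem ricciIdentityXi {h : Matrix (Fin 2) (Fin 2) ℝ} (hh : h.PosDef) {S Ξ}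
    (hS : IsSymmTracefree3 h S) (hX : IsSymmTracefree2 h Ξ) :
    RicciIdentityXi h (-(2 / 9) * normSq3 h S) S Ξ := by
  intro i j k m
  have hs := metric_symm hh
  simp only [mul_add, Finset.sum_add_distrib]
  rw [sum_inv_curv hh, sum_inv_curv hh _ _ _ _ (fun b => Ξ i b), dRhsXi_eq hh, dRhsXi_eq hh]
  simp only [inner3_comm h hh.isHermitian (fun a b c => rhsS h Ξ a b c _) S,
    inner3_rhsS hh hS hX, contr32_rhsS hh hX, contr32_rhsXi hh hS hX]
  obtain ⟨L, hL, rfl⟩ := exists_frame hh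
  obtain ⟨S, rfl⟩ := act3_surj hL S
  obtain ⟨Ξ, rfl⟩ := act2_surj hL Ξ
  rw [isSymmTracefree3_act hL] at hS
  rw [isSymmTracefree2_act hL] at hX
  simp only [normSq3_act hL, contr32_act hL, rhsS_act]
  -- the value of this trace does not matter, as its coefficient is symmetric in `k` and `m`
  generalize (tr2 (L * Lᵀ) fun a c => tr2 (L * Lᵀ) fun b d => act2 L Ξ a b * act2 L Ξ c d) = n
  simp only [act3_eq_act1, tr2_mul_act1 hL]
  obtain ⟨h1, h2, h3, h4, h5, h6⟩ := hS.comps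
  obtain ⟨h7, h8⟩ := hX.comps
  simp only [normSq3_one hS, act1, act2, act4, mul_transpose_apply_two, Fin.sum_univ_two,
    (contr32_one hS hX).1, (contr32_one hS hX).2, h1, h2, h3, h4, h5, h6, h7, h8, rhsS, young3]
  simp
  ring

end

/-! ### Partial derivatives and metrics in a chart -/

section

open Matrix

theorem pd_add {f g : E2 → ℝ} {x : E2} (k : Fin 2) (hf : DifferentiableAt ℝ f x)
    (hg : DifferentiableAt ℝ g x) : pd k (fun y => f y + g y) x = pd k f x + pd k g x := by
  simp only [pd]; rw [fderiv_fun_add hf hg]; rfl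

theorem pd_sub {f g : E2 → ℝ} {x : E2} (k : Fin 2) (hf : DifferentiableAt ℝ f x)
    (hg : DifferentiableAt ℝ g x) : pd k (fun y => f y - g y) x = pd k f x - pd k g x := by
  simp only [pd]; rw [fderiv_fun_sub hf hg]; rfl

theorem pd_mul {f g : E2 → ℝ} {x : E2} (k : Fin 2) (hf : DifferentiableAt ℝ f x)
    (hg : DifferentiableAt ℝ g x) :
    pd k (fun y => f y * g y) x = pd k f x * g x + f x * pd k g x := by
  simp only [pd]; rw [fderiv_fun_mul hf hg]
  simp; ring

theorem pd_const_mul {f : E2 → ℝ} {x : E2} (k : Fin 2) (a : ℝ) (hf : DifferentiableAt ℝ f x) :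
    pd k (fun y => a * f y) x = a * pd k f x := by
  simp only [pd]; rw [fderiv_const_mul hf]; rfl

theorem pd_const {x : E2} (k : Fin 2) (a : ℝ) : pd k (fun _ => a) x = 0 := by
  simp [pd]

theorem pd_sum {ι : Type*} {s : Finset ι} {f : ι → E2 → ℝ} {x : E2} (k : Fin 2)
    (hf : ∀ i ∈ s, DifferentiableAt ℝ (f i) x) :
    pd k (fun y => ∑ i ∈ s, f i y) x = ∑ i ∈ s, pd k (f i) x := by
  simp only [pd]; rw [fderiv_fun_sum hf]; simp

theorem pd_congr {f g : E2 → ℝ} {Ω : Set E2} (hΩ : IsOpen Ω) {x : E2} (hx : x ∈ Ω) (k : Fin 2)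
    (h : ∀ y ∈ Ω, f y = g y) : pd k f x = pd k g x := by
  simp only [pd]
  rw [Filter.EventuallyEq.fderiv_eq (Filter.eventually_of_mem (hΩ.mem_nhds hx) h)]

theorem contDiffOn_pd {f : E2 → ℝ} {Ω : Set E2} (hΩ : IsOpen Ω) (hf : ContDiffOn ℝ ∞ f Ω)
    (k : Fin 2) : ContDiffOn ℝ ∞ (pd k f) Ω := by
  have := hf.fderiv_of_isOpen (m := ∞) hΩ (by simp)
  exact this.clm_apply contDiffOn_const

theorem differentiableAt_of_contDiffOn {f : E2 → ℝ} {Ω : Set E2} (hΩ : IsOpen Ω)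
    (hf : ContDiffOn ℝ ∞ f Ω) {x : E2} (hx : x ∈ Ω) : DifferentiableAt ℝ f x :=
  (hf.contDiffAt (hΩ.mem_nhds hx)).differentiableAt (by simp)

/-- Symmetry of second derivatives. -/
theorem pd_pd_comm {f : E2 → ℝ} {Ω : Set E2} (hΩ : IsOpen Ω) (hf : ContDiffOn ℝ ∞ f Ω) {x : E2}
    (hx : x ∈ Ω) (i j : Fin 2) : pd i (pd j f) x = pd j (pd i f) x := by
  have hc := hf.contDiffAt (hΩ.mem_nhds hx)
  have h2 : (2 : WithTop ℕ∞) ≤ ∞ := WithTop.coe_le_coe.2 (le_top : (2 : ℕ∞) ≤ ⊤)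
  have hs := hc.isSymmSndFDerivAt (by simpa using h2)
  have hd : DifferentiableAt ℝ (fderiv ℝ f) x :=
    (hc.fderiv_right (m := 1) (by rwa [one_add_one_eq_two])).differentiableAt (by simp)
  have key : ∀ i j, pd i (pd j f) x = fderiv ℝ (fderiv ℝ f) x (ee i) (ee j) := by
    intro i j
    have : pd j f = fun y => fderiv ℝ f y (ee j) := rfl
    rw [this, pd, fderiv_clm_apply hd (by fun_prop)]
    simp
  rw [key, key]
  exact hs _ _

/-- `G` is the matrix of a smooth Riemannian metric on the open set `Ω` of the plane. -/
structure MetricOn (G : E2 → Matrix (Fin 2) (Fin 2) ℝ) (Ω : Set E2) : Prop where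
  isOpen : IsOpen Ω
  smooth : ∀ i j, ContDiffOn ℝ ∞ (fun y => G y i j) Ω
  posDef : ∀ x ∈ Ω, (G x).PosDef

namespace MetricOn

variable {G : E2 → Matrix (Fin 2) (Fin 2) ℝ} {Ω : Set E2} {x : E2}

theorem symm (hG : MetricOn G Ω) (hx : x ∈ Ω) (i j : Fin 2) : G x i j = G x j i :=
  metric_symm (hG.posDef x hx) i j

theorem isUnit_det (hG : MetricOn G Ω) (hx : x ∈ Ω) : IsUnit (G x).det :=
  (hG.posDef x hx).det_pos.ne'.isUnit

theorem diff (hG : MetricOn G Ω) (hx : x ∈ Ω) {f : E2 → ℝ} (hf : ContDiffOn ℝ ∞ f Ω) :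
    DifferentiableAt ℝ f x := differentiableAt_of_contDiffOn hG.isOpen hf hx

theorem smooth_inv (hG : MetricOn G Ω) (i j : Fin 2) :
    ContDiffOn ℝ ∞ (fun y => (G y)⁻¹ i j) Ω := by
  have hd : ContDiffOn ℝ ∞ (fun y => (G y 0 0 * G y 1 1 - G y 0 1 * G y 1 0)⁻¹) Ω := by
    refine ContDiffOn.inv (((hG.smooth 0 0).mul (hG.smooth 1 1)).sub
      ((hG.smooth 0 1).mul (hG.smooth 1 0))) fun y hy => ?_
    rw [← Matrix.det_fin_two]; exact (hG.posDef y hy).det_pos.ne'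
  have h : ∀ i j, ContDiffOn ℝ ∞ (fun y => (G y).adjugate i j) Ω := by
    intro i j
    simp only [Matrix.adjugate_fin_two]
    fin_cases i <;> fin_cases j
    · exact hG.smooth 1 1
    · exact (hG.smooth 0 1).neg
    · exact (hG.smooth 1 0).neg
    · exact hG.smooth 0 0
  refine (hd.mul (h i j)).congr fun y _ => ?_
  rw [Matrix.inv_def, Ring.inverse_eq_inv', Matrix.det_fin_two]; rfl

theorem smooth_christoffel (hG : MetricOn G Ω) (k i j : Fin 2) :
    ContDiffOn ℝ ∞ (fun y => christoffel G y k i j) Ω := by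
  unfold christoffel
  refine contDiffOn_const.mul (ContDiffOn.sum fun l _ => (hG.smooth_inv k l).mul ?_)
  have h := fun i j l => contDiffOn_pd hG.isOpen (hG.smooth i j) l
  exact ((h _ _ _).add (h _ _ _)).sub (h _ _ _)

theorem christoffel_symm (hG : MetricOn G Ω) (hx : x ∈ Ω) (k i j : Fin 2) :
    christoffel G x k i j = christoffel G x k j i := by
  unfold christoffel
  congr 1
  refine Finset.sum_congr rfl fun l _ => ?_
  rw [pd_congr hG.isOpen hx l fun y hy => hG.symm hy i j]; ring

/-- The Christoffel symbols of the first kind. -/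
theorem lower_christoffel (hG : MetricOn G Ω) (hx : x ∈ Ω) (i j l : Fin 2) :
    ∑ a, christoffel G x a i j * G x a l = 1 / 2 * (pd i (fun y => G y j l) x
      + pd j (fun y => G y i l) x - pd l (fun y => G y i j) x) := by
  have h : ∀ b, ∑ a, G x l a * (G x)⁻¹ a b = if l = b then 1 else 0 := by
    intro b
    have := congrFun (congrFun (Matrix.mul_nonsing_inv _ (hG.isUnit_det hx)) l) b
    rwa [Matrix.mul_apply, Matrix.one_apply] at this
  simp only [christoffel, hG.symm hx _ l]
  have h0 := h 0
  have h1 := h 1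
  simp only [Fin.sum_univ_two] at h0 h1 ⊢
  set F : Fin 2 → ℝ := fun l => pd i (fun y => G y j l) x
      + pd j (fun y => G y i l) x - pd l (fun y => G y i j) x with hF
  have : F l = (if l = 0 then 1 else 0) * F 0 + (if l = 1 then 1 else 0) * F 1 := by
    fin_cases l <;> simp
  change _ = 1 / 2 * F l
  rw [this, ← h0, ← h1]
  ring

/-- Metric compatibility of the Levi-Civita connection. -/
theorem pd_metric (hG : MetricOn G Ω) (hx : x ∈ Ω) (i j k : Fin 2) :
    pd k (fun y => G y i j) x =
      ∑ a, (christoffel G x a k i * G x a j + christoffel G x a k j * G x i a) := by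
  have h1 := hG.lower_christoffel hx k i j
  have h2 := hG.lower_christoffel hx k j i
  rw [Finset.sum_add_distrib]
  simp only [hG.symm hx i]
  rw [h1, h2, pd_congr hG.isOpen hx k fun y hy => hG.symm hy j i]
  ring

theorem cov2_metric (hG : MetricOn G Ω) (hx : x ∈ Ω) (i j k : Fin 2) : cov2 G G x i j k = 0 := by
  unfold cov2
  rw [hG.pd_metric hx]; ring

/-- The inverse metric is parallel. This follows from the derivative of `g⁻¹ g = 1`. -/
theorem pd_inv (hG : MetricOn G Ω) (hx : x ∈ Ω) (i j k : Fin 2) :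
    pd k (fun y => (G y)⁻¹ i j) x =
      - ∑ a, (christoffel G x i k a * (G x)⁻¹ a j + christoffel G x j k a * (G x)⁻¹ i a) := by
  set D : Matrix (Fin 2) (Fin 2) ℝ := Matrix.of fun i j => pd k (fun y => (G y)⁻¹ i j) x with hD
  set C : Matrix (Fin 2) (Fin 2) ℝ := Matrix.of fun a i => christoffel G x a k i with hC
  have h1 : D * G x + (G x)⁻¹ * (Cᵀ * G x + G x * C) = 0 := by
    ext i j
    have : pd k (fun y => ∑ a, (G y)⁻¹ i a * G y a j) x = 0 := by
      rw [pd_congr hG.isOpen hx k (g := fun _ => (1 : Matrix (Fin 2) (Fin 2) ℝ) i j), pd_const]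
      intro y hy
      have := congrFun (congrFun (Matrix.nonsing_inv_mul _ (hG.isUnit_det hy)) i) j
      rwa [Matrix.mul_apply] at this
    rw [pd_sum k fun a _ => (hG.diff hx ((hG.smooth_inv i a).mul (hG.smooth a j)))] at this
    simp only [pd_mul k (hG.diff hx (hG.smooth_inv _ _)) (hG.diff hx (hG.smooth _ _)),
      hG.pd_metric hx] at this
    rw [Matrix.zero_apply, ← this]
    simp [Matrix.mul_apply, hD, hC, Matrix.add_apply]
    ring
  have h2 := hG.isUnit_det hx
  have h3 : D = -(C * (G x)⁻¹ + (G x)⁻¹ * Cᵀ) := by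
    have := congrArg (· * (G x)⁻¹) h1
    simp only [Matrix.add_mul, Matrix.zero_mul, Matrix.mul_add] at this
    rw [Matrix.mul_assoc D, Matrix.mul_nonsing_inv _ h2, Matrix.mul_one,
      ← Matrix.mul_assoc ((G x)⁻¹) (Cᵀ) (G x), Matrix.mul_assoc ((G x)⁻¹ * Cᵀ),
      Matrix.mul_nonsing_inv _ h2, Matrix.mul_one, ← Matrix.mul_assoc _ (G x) C,
      Matrix.nonsing_inv_mul _ h2, Matrix.one_mul] at this
    rw [eq_neg_iff_add_eq_zero, ← this]; abel
  have h4 := congrFun (congrFun h3 i) j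
  rw [hD, Matrix.of_apply] at h4
  rw [h4]
  simp [Matrix.mul_apply, hC]
  ring

theorem smooth_tr2 (hG : MetricOn G Ω) {A : E2 → Fin 2 → Fin 2 → ℝ}
    (hA : ∀ a b, ContDiffOn ℝ ∞ (fun y => A y a b) Ω) :
    ContDiffOn ℝ ∞ (fun y => tr2 (G y) (A y)) Ω :=
  ContDiffOn.sum fun a _ => ContDiffOn.sum fun b _ => (hG.smooth_inv a b).mul (hA a b)

/-- Covariant differentiation commutes with metric traces. -/
theorem pd_tr2 (hG : MetricOn G Ω) (hx : x ∈ Ω) {A : E2 → Fin 2 → Fin 2 → ℝ}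
    (hA : ∀ a b, ContDiffOn ℝ ∞ (fun y => A y a b) Ω) (k : Fin 2) :
    pd k (fun y => tr2 (G y) (A y)) x = tr2 (G x) (fun a b => cov2 G A x a b k) := by
  unfold tr2 cov2
  rw [pd_sum k fun a _ => hG.diff hx
    (ContDiffOn.sum fun b _ => (hG.smooth_inv a b).mul (hA a b))]
  simp only [pd_sum k fun b _ => hG.diff hx ((hG.smooth_inv _ b).mul (hA _ b)),
    pd_mul k (hG.diff hx (hG.smooth_inv _ _)) (hG.diff hx (hA _ _)), hG.pd_inv hx]
  simp only [Fin.sum_univ_two]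
  ring

end MetricOn

end

/-! ### Ricci identities in a chart -/

section

open Matrix

/-- `∇ₘ Pᵢⱼₖₗ`. -/
noncomputable def cov4 (G : E2 → Matrix (Fin 2) (Fin 2) ℝ)
    (P : E2 → Fin 2 → Fin 2 → Fin 2 → Fin 2 → ℝ) (x : E2) (i j k l m : Fin 2) : ℝ :=
  pd m (fun y => P y i j k l) x
    - ∑ a, (christoffel G x a m i * P x a j k l + christoffel G x a m j * P x i a k l
      + christoffel G x a m k * P x i j a l + christoffel G x a m l * P x i j k a)

namespace MetricOn

variable {G : E2 → Matrix (Fin 2) (Fin 2) ℝ} {Ω : Set E2} {x : E2}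

theorem smooth_cov1 (hG : MetricOn G Ω) {θ : E2 → Fin 2 → ℝ}
    (hθ : ∀ i, ContDiffOn ℝ ∞ (fun y => θ y i) Ω) (i k : Fin 2) :
    ContDiffOn ℝ ∞ (fun y => cov1 G θ y i k) Ω :=
  (contDiffOn_pd hG.isOpen (hθ i) k).sub
    (ContDiffOn.sum fun a _ => (hG.smooth_christoffel a k i).mul (hθ a))

theorem smooth_cov2 (hG : MetricOn G Ω) {A : E2 → Fin 2 → Fin 2 → ℝ}
    (hA : ∀ i j, ContDiffOn ℝ ∞ (fun y => A y i j) Ω) (i j k : Fin 2) :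
    ContDiffOn ℝ ∞ (fun y => cov2 G A y i j k) Ω :=
  (contDiffOn_pd hG.isOpen (hA i j) k).sub
    (ContDiffOn.sum fun a _ => ((hG.smooth_christoffel a k i).mul (hA a j)).add
      ((hG.smooth_christoffel a k j).mul (hA i a)))

theorem smooth_cov3 (hG : MetricOn G Ω) {S : E2 → Fin 2 → Fin 2 → Fin 2 → ℝ}
    (hS : ∀ i j k, ContDiffOn ℝ ∞ (fun y => S y i j k) Ω) (i j k l : Fin 2) :
    ContDiffOn ℝ ∞ (fun y => cov3 G S y i j k l) Ω :=
  (contDiffOn_pd hG.isOpen (hS i j k) l).sub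
    (ContDiffOn.sum fun a _ => (((hG.smooth_christoffel a l i).mul (hS a j k)).add
      ((hG.smooth_christoffel a l j).mul (hS i a k))).add
        ((hG.smooth_christoffel a l k).mul (hS i j a)))

theorem pd_cov1 (hG : MetricOn G Ω) (hx : x ∈ Ω) {θ : E2 → Fin 2 → ℝ}
    (hθ : ∀ i, ContDiffOn ℝ ∞ (fun y => θ y i) Ω) (i l m : Fin 2) :
    pd m (fun y => cov1 G θ y i l) x = pd m (pd l fun y => θ y i) x
      - ∑ a, (pd m (fun y => christoffel G y a l i) x * θ x a
        + christoffel G x a l i * pd m (fun y => θ y a) x) := by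
  unfold cov1
  have h := fun a => (hG.smooth_christoffel a l i).mul (hθ a)
  rw [pd_sub m (hG.diff hx (contDiffOn_pd hG.isOpen (hθ i) l))
    (hG.diff hx (ContDiffOn.sum fun a _ => h a)), pd_sum m fun a _ => hG.diff hx (h a)]
  simp only [pd_mul m (hG.diff hx (hG.smooth_christoffel _ l i)) (hG.diff hx (hθ _))]

/-- The Ricci identity for one-forms, in terms of the components of the Riemann tensor. -/
theorem ricci1_riem (hG : MetricOn G Ω) (hx : x ∈ Ω) {θ : E2 → Fin 2 → ℝ}
    (hθ : ∀ i, ContDiffOn ℝ ∞ (fun y => θ y i) Ω) (i l m : Fin 2) :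
    cov2 G (cov1 G θ) x i l m - cov2 G (cov1 G θ) x i m l = -∑ a, riem G x a i m l * θ x a := by
  unfold cov2
  rw [hG.pd_cov1 hx hθ, hG.pd_cov1 hx hθ, pd_pd_comm hG.isOpen (hθ i) hx m l]
  unfold cov1 riem
  simp only [Fin.sum_univ_two, hG.christoffel_symm hx _ l m]
  ring

/-- The derivative of `∇A`, expanded with the product rule; the covariant derivatives of second
order that enter the Ricci identity are built from it. -/
theorem pd_cov2 (hG : MetricOn G Ω) (hx : x ∈ Ω) {A : E2 → Fin 2 → Fin 2 → ℝ}
    (hA : ∀ i j, ContDiffOn ℝ ∞ (fun y => A y i j) Ω) (i j l m : Fin 2) :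
    pd m (fun y => cov2 G A y i j l) x = pd m (pd l fun y => A y i j) x
      - ∑ a, (pd m (fun y => christoffel G y a l i) x * A x a j
        + christoffel G x a l i * pd m (fun y => A y a j) x
        + (pd m (fun y => christoffel G y a l j) x * A x i a
        + christoffel G x a l j * pd m (fun y => A y i a) x)) := by
  unfold cov2
  have h1 := fun a => (hG.smooth_christoffel a l i).mul (hA a j)
  have h2 := fun a => (hG.smooth_christoffel a l j).mul (hA i a)
  rw [pd_sub m (hG.diff hx (contDiffOn_pd hG.isOpen (hA i j) l))
    (hG.diff hx (ContDiffOn.sum fun a _ => (h1 a).add (h2 a))),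
    pd_sum m fun a _ => hG.diff hx ((h1 a).add (h2 a))]
  simp only [pd_add m (hG.diff hx (h1 _)) (hG.diff hx (h2 _)),
    pd_mul m (hG.diff hx (hG.smooth_christoffel _ l _)) (hG.diff hx (hA _ _))]

theorem ricci2_riem (hG : MetricOn G Ω) (hx : x ∈ Ω) {A : E2 → Fin 2 → Fin 2 → ℝ}
    (hA : ∀ i j, ContDiffOn ℝ ∞ (fun y => A y i j) Ω) (i j l m : Fin 2) :
    cov3 G (cov2 G A) x i j l m - cov3 G (cov2 G A) x i j m l =
      -∑ a, (riem G x a i m l * A x a j + riem G x a j m l * A x i a) := by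
  unfold cov3
  rw [hG.pd_cov2 hx hA, hG.pd_cov2 hx hA, pd_pd_comm hG.isOpen (hA i j) hx m l]
  unfold cov2 riem
  simp only [Fin.sum_univ_two, hG.christoffel_symm hx _ l m]
  ring

theorem pd_cov3 (hG : MetricOn G Ω) (hx : x ∈ Ω) {S : E2 → Fin 2 → Fin 2 → Fin 2 → ℝ}
    (hS : ∀ i j k, ContDiffOn ℝ ∞ (fun y => S y i j k) Ω) (i j k l m : Fin 2) :
    pd m (fun y => cov3 G S y i j k l) x = pd m (pd l fun y => S y i j k) x
      - ∑ a, (pd m (fun y => christoffel G y a l i) x * S x a j k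
        + christoffel G x a l i * pd m (fun y => S y a j k) x
        + (pd m (fun y => christoffel G y a l j) x * S x i a k
        + christoffel G x a l j * pd m (fun y => S y i a k) x)
        + (pd m (fun y => christoffel G y a l k) x * S x i j a
        + christoffel G x a l k * pd m (fun y => S y i j a) x)) := by
  unfold cov3
  have h1 := fun a => (hG.smooth_christoffel a l i).mul (hS a j k)
  have h2 := fun a => (hG.smooth_christoffel a l j).mul (hS i a k)
  have h3 := fun a => (hG.smooth_christoffel a l k).mul (hS i j a)
  rw [pd_sub m (hG.diff hx (contDiffOn_pd hG.isOpen (hS i j k) l))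
    (hG.diff hx (ContDiffOn.sum fun a _ => ((h1 a).add (h2 a)).add (h3 a))),
    pd_sum m fun a _ => hG.diff hx (((h1 a).add (h2 a)).add (h3 a))]
  simp only [pd_add m (hG.diff hx ((h1 _).add (h2 _))) (hG.diff hx (h3 _)),
    pd_add m (hG.diff hx (h1 _)) (hG.diff hx (h2 _)),
    pd_mul m (hG.diff hx (hG.smooth_christoffel _ l _)) (hG.diff hx (hS _ _ _))]

theorem ricci3_riem (hG : MetricOn G Ω) (hx : x ∈ Ω) {S : E2 → Fin 2 → Fin 2 → Fin 2 → ℝ}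
    (hS : ∀ i j k, ContDiffOn ℝ ∞ (fun y => S y i j k) Ω) (i j k l m : Fin 2) :
    cov4 G (cov3 G S) x i j k l m - cov4 G (cov3 G S) x i j k m l =
      -∑ a, (riem G x a i m l * S x a j k + riem G x a j m l * S x i a k
        + riem G x a k m l * S x i j a) := by
  unfold cov4
  rw [hG.pd_cov3 hx hS, hG.pd_cov3 hx hS, pd_pd_comm hG.isOpen (hS i j k) hx m l]
  unfold cov3 riem
  simp only [Fin.sum_univ_two, hG.christoffel_symm hx _ l m]
  ring

/-- Antisymmetry of the lowered Riemann tensor: the Ricci identity applied to the parallel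
metric. -/
theorem lower_riem_antisymm (hG : MetricOn G Ω) (hx : x ∈ Ω) (i j m l : Fin 2) :
    ∑ a, (riem G x a i m l * G x a j + riem G x a j m l * G x i a) = 0 := by
  have h := hG.ricci2_riem hx hG.smooth i j l m
  have h0 : ∀ l m, cov3 G (cov2 G G) x i j l m = 0 := by
    intro l m
    unfold cov3
    rw [pd_congr hG.isOpen hx m (g := fun _ => 0) fun y hy => hG.cov2_metric hy i j l, pd_const]
    simp [hG.cov2_metric hx]
  rw [h0, h0] at h
  linarith

theorem riem_antisymm (x : E2) (a i m l : Fin 2) : riem G x a i m l = - riem G x a i l m := by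
  unfold riem; simp only [Fin.sum_univ_two]; ring

/-- In dimension two the Riemann tensor is determined by the scalar curvature: by its two
antisymmetries the lowered tensor `Q` has a single component `Q 0 1 0 1 = (R / 2) det g`. -/
theorem lower_riem (hG : MetricOn G Ω) (hx : x ∈ Ω) (p k i j : Fin 2) :
    ∑ a, G x p a * riem G x a k i j = curv (G x) (scalarCurv G x) p k i j := by
  set Q : Fin 2 → Fin 2 → Fin 2 → Fin 2 → ℝ := fun p k i j => ∑ a,
      G x p a * riem G x a k i j with hQ
  have h1 : ∀ p k i j, Q p k i j = - Q p k j i := by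
    intro p k i j
    simp only [hQ, Fin.sum_univ_two, riem_antisymm x _ k i j]; ring
  have h2 : ∀ p k i j, Q p k i j = - Q k p i j := by
    intro p k i j
    have := hG.lower_riem_antisymm hx p k i j
    simp only [hQ, Fin.sum_univ_two] at *
    rw [hG.symm hx p 0, hG.symm hx p 1] at *
    rw [hG.symm hx k 0, hG.symm hx k 1]
    linarith
  have hdet := (hG.isUnit_det hx).ne_zero
  have hR : scalarCurv G x * (G x).det = 2 * Q 0 1 0 1 := by
    have hr : ∀ a k i j, riem G x a k i j = ∑ p, (G x)⁻¹ a p * Q p k i j := by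
      intro a k i j
      have : (fun a => riem G x a k i j) = (G x)⁻¹ *ᵥ (G x *ᵥ fun a => riem G x a k i j) := by
        rw [Matrix.mulVec_mulVec, Matrix.nonsing_inv_mul _ (hG.isUnit_det hx), Matrix.one_mulVec]
      exact congrFun this a
    have e1 : (G x)⁻¹ 0 0 = (G x).det⁻¹ * G x 1 1 := by
      rw [Matrix.inv_def, Ring.inverse_eq_inv', Matrix.adjugate_fin_two]; rfl
    have e2 : (G x)⁻¹ 1 1 = (G x).det⁻¹ * G x 0 0 := by
      rw [Matrix.inv_def, Ring.inverse_eq_inv', Matrix.adjugate_fin_two]; rfl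
    have e3 : (G x)⁻¹ 0 1 = (G x).det⁻¹ * (- G x 0 1) := by
      rw [Matrix.inv_def, Ring.inverse_eq_inv', Matrix.adjugate_fin_two]; rfl
    have e4 : (G x)⁻¹ 1 0 = (G x).det⁻¹ * (- G x 1 0) := by
      rw [Matrix.inv_def, Ring.inverse_eq_inv', Matrix.adjugate_fin_two]; rfl
    unfold scalarCurv
    simp only [hr, Fin.sum_univ_two, e1, e2, e3, e4]
    have a1 := h1 0 1 1 0
    have a2 := h2 1 0 0 1
    have a3 := h2 1 0 1 0
    have q1 : ∀ i j, Q 0 0 i j = 0 := fun i j => by linarith [h2 0 0 i j]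
    have q2 : ∀ i j, Q 1 1 i j = 0 := fun i j => by linarith [h2 1 1 i j]
    have q3 : ∀ i p k, Q p k i i = 0 := fun i p k => by linarith [h1 p k i i]
    simp only [q1, q2, q3, a3, a1, a2]
    field_simp
    rw [Matrix.det_fin_two, hG.symm hx 1 0]
    ring
  have hR' : scalarCurv G x = 2 * Q 0 1 0 1 / (G x).det := by field_simp; linarith
  have q1 : ∀ i j, Q 0 0 i j = 0 := fun i j => by linarith [h2 0 0 i j]
  have q2 : ∀ i j, Q 1 1 i j = 0 := fun i j => by linarith [h2 1 1 i j]
  have q3 : ∀ i p k, Q p k i i = 0 := fun i p k => by linarith [h1 p k i i]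
  change Q p k i j = _
  have a1 := h1 0 1 1 0
  have a2 := h2 1 0 0 1
  have a3 := h2 1 0 1 0
  rw [curv, hR']
  rw [Matrix.det_fin_two] at hdet ⊢
  have h10 := hG.symm hx 1 0
  fin_cases p <;> fin_cases k <;> fin_cases i <;> fin_cases j <;>
    simp only [Fin.zero_eta, Fin.mk_one, q1, q2, q3, a3, a1, a2] <;> field_simp <;> ring

/-- The contraction of the Riemann tensor with a one-form, raised back from `lower_riem`. -/
theorem sum_riem_mul (hG : MetricOn G Ω) (hx : x ∈ Ω) (k i j : Fin 2) (θ : Fin 2 → ℝ) :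
    ∑ a, riem G x a k i j * θ a =
      scalarCurv G x / 2 * (G x k j * θ i - G x k i * θ j) := by
  have hr : ∀ a, riem G x a k i j =
      scalarCurv G x / 2 * ((1 : Matrix (Fin 2) (Fin 2) ℝ) a i * G x k j
        - (1 : Matrix (Fin 2) (Fin 2) ℝ) a j * G x k i) := by
    intro a
    have : (fun a => riem G x a k i j) = (G x)⁻¹ *ᵥ (G x *ᵥ fun a => riem G x a k i j) := by
      rw [Matrix.mulVec_mulVec, Matrix.nonsing_inv_mul _ (hG.isUnit_det hx), Matrix.one_mulVec]
    have h1 := congrFun this a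
    have h2 : (G x *ᵥ fun a => riem G x a k i j) =
        fun p => curv (G x) (scalarCurv G x) p k i j := by
      ext p; exact hG.lower_riem hx p k i j
    rw [h2] at h1
    rw [h1, ← Matrix.nonsing_inv_mul _ (hG.isUnit_det hx)]
    simp only [Matrix.mulVec, dotProduct, Matrix.mul_apply, curv, Fin.sum_univ_two]
    ring
  have h1 : ∀ i : Fin 2, (1 : Matrix (Fin 2) (Fin 2) ℝ) 0 i * θ 0
      + (1 : Matrix (Fin 2) (Fin 2) ℝ) 1 i * θ 1 = θ i := by
    simp [Fin.forall_fin_two]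
  simp only [hr, Fin.sum_univ_two]
  rw [← h1 i, ← h1 j]; ring

theorem ricci1 (hG : MetricOn G Ω) (hx : x ∈ Ω) {θ : E2 → Fin 2 → ℝ}
    (hθ : ∀ i, ContDiffOn ℝ ∞ (fun y => θ y i) Ω) (i l m : Fin 2) :
    cov2 G (cov1 G θ) x i l m - cov2 G (cov1 G θ) x i m l =
      scalarCurv G x / 2 * (G x i m * θ x l - G x i l * θ x m) := by
  rw [hG.ricci1_riem hx hθ, hG.sum_riem_mul hx]; ring

theorem ricci2 (hG : MetricOn G Ω) (hx : x ∈ Ω) {A : E2 → Fin 2 → Fin 2 → ℝ}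
    (hA : ∀ i j, ContDiffOn ℝ ∞ (fun y => A y i j) Ω) (i j l m : Fin 2) :
    cov3 G (cov2 G A) x i j l m - cov3 G (cov2 G A) x i j m l =
      scalarCurv G x / 2 * (G x i m * A x l j - G x i l * A x m j
        + (G x j m * A x i l - G x j l * A x i m)) := by
  rw [hG.ricci2_riem hx hA, Finset.sum_add_distrib, hG.sum_riem_mul hx i m l (fun a => A x a j),
    hG.sum_riem_mul hx]; ring

theorem ricci3 (hG : MetricOn G Ω) (hx : x ∈ Ω) {S : E2 → Fin 2 → Fin 2 → Fin 2 → ℝ}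
    (hS : ∀ i j k, ContDiffOn ℝ ∞ (fun y => S y i j k) Ω) (i j k l m : Fin 2) :
    cov4 G (cov3 G S) x i j k l m - cov4 G (cov3 G S) x i j k m l =
      scalarCurv G x / 2 * (G x i m * S x l j k - G x i l * S x m j k
        + (G x j m * S x i l k - G x j l * S x i m k)
        + (G x k m * S x i j l - G x k l * S x i j m)) := by
  rw [hG.ricci3_riem hx hS, Finset.sum_add_distrib, Finset.sum_add_distrib,
    hG.sum_riem_mul hx i m l (fun a => S x a j k), hG.sum_riem_mul hx j m l (fun a => S x i a k),
    hG.sum_riem_mul hx]; ring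

end MetricOn

end

/-! ### Traces and the Leibniz rule -/

section

open Matrix

theorem tr2_congr {h : Matrix (Fin 2) (Fin 2) ℝ} {A B : Fin 2 → Fin 2 → ℝ}
    (hAB : ∀ a b, A a b = B a b) :
    tr2 h A = tr2 h B := by
  rw [show A = B from funext fun a => funext (hAB a)]

theorem tr2_add (h : Matrix (Fin 2) (Fin 2) ℝ) (A B : Fin 2 → Fin 2 → ℝ) :
    (tr2 h fun a b => A a b + B a b) = tr2 h A + tr2 h B := by
  simp only [tr2, Fin.sum_univ_two]; ring

theorem tr2_sub (h : Matrix (Fin 2) (Fin 2) ℝ) (A B : Fin 2 → Fin 2 → ℝ) :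
    (tr2 h fun a b => A a b - B a b) = tr2 h A - tr2 h B := by
  simp only [tr2, Fin.sum_univ_two]; ring

theorem tr2_const_mul (h : Matrix (Fin 2) (Fin 2) ℝ) (c : ℝ) (A : Fin 2 → Fin 2 → ℝ) :
    (tr2 h fun a b => c * A a b) = c * tr2 h A := by
  simp only [tr2, Fin.sum_univ_two]; ring

theorem tr2_mul_const (h : Matrix (Fin 2) (Fin 2) ℝ) (c : ℝ) (A : Fin 2 → Fin 2 → ℝ) :
    (tr2 h fun a b => A a b * c) = tr2 h A * c := by
  simp only [tr2, Fin.sum_univ_two]; ring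

theorem tr2_swap {h : Matrix (Fin 2) (Fin 2) ℝ} (hh : h.PosDef) (A : Fin 2 → Fin 2 → ℝ) :
    (tr2 h fun a b => A b a) = tr2 h A := by
  have hs : h⁻¹ 1 0 = h⁻¹ 0 1 := by simpa using hh.inv.isHermitian.apply 0 1
  simp only [tr2, Fin.sum_univ_two, hs]; ring

theorem tr2_mul_metric {h : Matrix (Fin 2) (Fin 2) ℝ} (hh : h.PosDef) (θ : Fin 2 → ℝ) (k : Fin 2) :
    tr2 h (fun a b => θ a * h b k) = θ k := by
  rw [← tr2_metric_mul hh θ k, ← tr2_swap hh]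
  exact tr2_congr fun a b => mul_comm _ _

theorem tr2_metric {h : Matrix (Fin 2) (Fin 2) ℝ} (hh : h.PosDef) :
    (tr2 h fun a b => h a b) = 2 := by
  have h1 : (Matrix.of h)ᵀ = h := hh.isHermitian
  rw [tr2_eq_trace, h1, Matrix.nonsing_inv_mul _ hh.det_pos.ne'.isUnit]
  simp

theorem tr2_metric_mul_const {h : Matrix (Fin 2) (Fin 2) ℝ} (hh : h.PosDef) (c : ℝ) :
    (tr2 h fun a b => h a b * c) = 2 * c := by
  rw [← tr2_metric hh]
  simp only [tr2, Fin.sum_univ_two]; ring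

namespace MetricOn

variable {G : E2 → Matrix (Fin 2) (Fin 2) ℝ} {Ω : Set E2} {x : E2}

/-- The Leibniz rule for `Sₖₐᵦ Ξᵃᵇ`. -/
theorem cov1_contr32 (hG : MetricOn G Ω) (hx : x ∈ Ω) {S : E2 → Fin 2 → Fin 2 → Fin 2 → ℝ}
    {Ξ : E2 → Fin 2 → Fin 2 → ℝ}
    (hS : ∀ i j k, ContDiffOn ℝ ∞ (fun y => S y i j k) Ω)
    (hΞ : ∀ i j, ContDiffOn ℝ ∞ (fun y => Ξ y i j) Ω) (k m : Fin 2) :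
    cov1 G (fun y => contr32 (G y) (S y) (Ξ y)) x k m =
      contr32 (G x) (fun a b c => cov3 G S x a b c m) (Ξ x) k
        + contr32 (G x) (S x) (fun a b => cov2 G Ξ x a b m) k := by
  unfold cov1
  simp only [contr32_eq]
  have h1 := fun a c b d => (hS k a b).mul (hΞ c d)
  have h2 := fun a c => hG.smooth_tr2 (A := fun y b d => S y k a b * Ξ y c d) (h1 a c)
  rw [hG.pd_tr2 hx h2, ← tr2_add]
  have h3 : ∀ a c, pd m (fun y => tr2 (G y) fun b d => S y k a b * Ξ y c d) x = _ :=
    fun a c => hG.pd_tr2 hx (A := fun y b d => S y k a b * Ξ y c d) (h1 a c) m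
  simp only [cov2, h3, pd_mul m (hG.diff hx (hS k _ _)) (hG.diff hx (hΞ _ _)), cov3]
  simp only [tr2, Fin.sum_univ_two]
  ring

theorem pd_normSq3 (hG : MetricOn G Ω) (hx : x ∈ Ω) {S : E2 → Fin 2 → Fin 2 → Fin 2 → ℝ}
    (hS : ∀ i j k, ContDiffOn ℝ ∞ (fun y => S y i j k) Ω) (m : Fin 2) :
    pd m (fun y => normSq3 (G y) (S y)) x =
      2 * inner3 (G x) (S x) (fun a b c => cov3 G S x a b c m) := by
  rw [two_mul]
  nth_rw 2 [inner3_comm (G x) (hG.posDef x hx).isHermitian]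
  simp only [normSq3_eq, inner3]
  have h1 := fun a d b e c f => (hS a b c).mul (hS d e f)
  have h2 := fun a d b e => hG.smooth_tr2 (A := fun y c f => S y a b c * S y d e f) (h1 a d b e)
  have h3 := fun a d => hG.smooth_tr2
    (A := fun y b e => tr2 (G y) fun c f => S y a b c * S y d e f) (h2 a d)
  have e2 : ∀ a d b e, pd m (fun y => tr2 (G y) fun c f => S y a b c * S y d e f) x = _ :=
    fun a d b e => hG.pd_tr2 hx (A := fun y c f => S y a b c * S y d e f) (h1 a d b e) m
  have e3 : ∀ a d, pd m (fun y => tr2 (G y) fun b e => tr2 (G y) fun c f => S y a b c * S y d e f) x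
      = _ :=
    fun a d => hG.pd_tr2 hx
      (A := fun y b e => tr2 (G y) fun c f => S y a b c * S y d e f) (h2 a d) m
  rw [hG.pd_tr2 hx h3, ← tr2_add]
  simp only [cov2, e3, e2, pd_mul m (hG.diff hx (hS _ _ _)) (hG.diff hx (hS _ _ _)), cov3]
  simp only [tr2, Fin.sum_univ_two]
  ring

theorem cov1_congr {θ η : E2 → Fin 2 → ℝ} (hΩ : IsOpen Ω) (hx : x ∈ Ω)
    (h : ∀ y ∈ Ω, ∀ i, θ y i = η y i) (i k : Fin 2) : cov1 G θ x i k = cov1 G η x i k := by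
  unfold cov1
  rw [pd_congr hΩ hx k fun y hy => h y hy i]
  simp only [h x hx]

theorem cov2_congr {A B : E2 → Fin 2 → Fin 2 → ℝ} (hΩ : IsOpen Ω) (hx : x ∈ Ω)
    (h : ∀ y ∈ Ω, ∀ i j, A y i j = B y i j) (i j k : Fin 2) :
    cov2 G A x i j k = cov2 G B x i j k := by
  unfold cov2
  rw [pd_congr hΩ hx k fun y hy => h y hy i j]
  simp only [h x hx]

theorem cov3_congr {A B : E2 → Fin 2 → Fin 2 → Fin 2 → ℝ} (hΩ : IsOpen Ω) (hx : x ∈ Ω)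
    (h : ∀ y ∈ Ω, ∀ i j k, A y i j k = B y i j k) (i j k l : Fin 2) :
    cov3 G A x i j k l = cov3 G B x i j k l := by
  unfold cov3
  rw [pd_congr hΩ hx l fun y hy => h y hy i j k]
  simp only [h x hx]

theorem cov4_congr {A B : E2 → Fin 2 → Fin 2 → Fin 2 → Fin 2 → ℝ} (hΩ : IsOpen Ω) (hx : x ∈ Ω)
    (h : ∀ y ∈ Ω, ∀ i j k l, A y i j k l = B y i j k l) (i j k l m : Fin 2) :
    cov4 G A x i j k l m = cov4 G B x i j k l m := by
  unfold cov4
  rw [pd_congr hΩ hx m fun y hy => h y hy i j k l]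
  simp only [h x hx]

/-- Covariant derivatives preserve trace-free symmetric tensors. -/
theorem cov2_symmTracefree (hG : MetricOn G Ω) (hx : x ∈ Ω) {A : E2 → Fin 2 → Fin 2 → ℝ}
    (hA : ∀ i j, ContDiffOn ℝ ∞ (fun y => A y i j) Ω)
    (h : ∀ y ∈ Ω, IsSymmTracefree2 (G y) (A y)) (k : Fin 2) :
    IsSymmTracefree2 (G x) fun i j => cov2 G A x i j k := by
  refine ⟨fun i j => ?_, ?_⟩
  · simp only [cov2]
    rw [pd_congr hG.isOpen hx k fun y hy => (h y hy).1 i j]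
    have := (h x hx).1
    simp only [Fin.sum_univ_two, this j, this _ i]; ring
  · rw [← hG.pd_tr2 hx hA, pd_congr hG.isOpen hx k (g := fun _ => 0) fun y hy => (h y hy).2,
      pd_const]

theorem cov3_symmTracefree (hG : MetricOn G Ω) (hx : x ∈ Ω) {S : E2 → Fin 2 → Fin 2 → Fin 2 → ℝ}
    (hS : ∀ i j k, ContDiffOn ℝ ∞ (fun y => S y i j k) Ω)
    (h : ∀ y ∈ Ω, IsSymmTracefree3 (G y) (S y)) (l : Fin 2) :
    IsSymmTracefree3 (G x) fun i j k => cov3 G S x i j k l := by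
  refine ⟨fun i j k => ⟨?_, ?_⟩, fun k => ?_⟩
  · simp only [cov3]
    rw [pd_congr hG.isOpen hx l fun y hy => ((h y hy).1 i j k).1]
    have := fun i j k => ((h x hx).1 i j k).1
    have := fun i j k => ((h x hx).1 i j k).2
    simp only [Fin.sum_univ_two]
    grind
  · simp only [cov3]
    rw [pd_congr hG.isOpen hx l fun y hy => ((h y hy).1 i j k).2]
    have := fun i j k => ((h x hx).1 i j k).1
    have := fun i j k => ((h x hx).1 i j k).2
    simp only [Fin.sum_univ_two]
    grind
  · have h1 := hG.pd_tr2 hx (A := fun y a b => S y a b k) (fun a b => hS a b k) l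
    rw [pd_congr hG.isOpen hx l (g := fun _ => 0) fun y hy => (h y hy).2 k, pd_const] at h1
    have h2 := (h x hx).2
    rw [show (fun a b => cov3 G S x a b k l) = fun a b => cov2 G (fun y a b => S y a b k) x a b l
      - (christoffel G x 0 l k * S x a b 0 + christoffel G x 1 l k * S x a b 1) by
        ext a b; simp only [cov3, cov2, Fin.sum_univ_two]; ring,
      tr2_sub, tr2_add, tr2_const_mul, tr2_const_mul, h2, h2, ← h1]
    ring

end MetricOn

end

/-! ### From the closed system to the integrability conditions -/

section

open Matrix

variable {h : Matrix (Fin 2) (Fin 2) ℝ}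

/-- The symmetrisation of `∇S` is a symmetrised product of `g` and `Ξ`, hence has no trace-free
part. -/
theorem tracefree4_young4_rhsS (hh : h.PosDef) {Ξ} (hX : IsSymmTracefree2 h Ξ) (i j k l : Fin 2) :
    tracefree4 h (young4 (rhsS h Ξ)) i j k l = 0 := by
  have hs := metric_symm hh
  have hy : ∀ i j k l, young4 (rhsS h Ξ) i j k l =
      2 * (h i j * Ξ k l + h i k * Ξ j l + h i l * Ξ j k + h j k * Ξ i l + h j l * Ξ i k
        + h k l * Ξ i j) := by
    intro i j k l
    simp only [young4, young3, rhsS]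
    rw [hs j i, hs k i, hs l i, hs k j, hs l j, hs l k, hX.1 j i, hX.1 k i, hX.1 l i, hX.1 k j,
      hX.1 l j, hX.1 l k]
    ring
  have h2 : ∀ c d, (tr2 h fun a b => young4 (rhsS h Ξ) a b c d) = 12 * Ξ c d := by
    intro c d
    rw [show (fun a b => young4 (rhsS h Ξ) a b c d) = fun a b =>
      2 * (((h a b * Ξ c d + h a c * Ξ b d) + (h a d * Ξ b c + Ξ a d * h b c))
        + (Ξ a c * h b d + Ξ a b * h c d)) by
      ext a b; rw [hy]; ring, tr2_const_mul, tr2_add, tr2_add, tr2_add, tr2_add, tr2_add,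
      tr2_metric_mul_const hh, tr2_metric_mul hh (fun b => Ξ b d), tr2_metric_mul hh
          (fun b => Ξ b c),
      tr2_mul_metric hh (fun a => Ξ a d), tr2_mul_metric hh (fun a => Ξ a c), tr2_mul_const, hX.2,
      hX.1 d c]
    ring
  simp only [tracefree4, h2]
  rw [tr2_const_mul, hX.2, hy]
  ring

/-- The divergence of `S` in the closed system is `Ξ`. -/
theorem div_rhsS (hh : h.PosDef) {Ξ} (hX : IsSymmTracefree2 h Ξ) (i j : Fin 2) :
    (tr2 h fun a b => rhsS h Ξ i j a b) = Ξ i j := by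
  rw [show (fun a b => rhsS h Ξ i j a b) = fun a b =>
      (1 / 3 * (h a b * Ξ i j + Ξ i a * h b j + Ξ j a * h b i))
        - 1 / 6 * (h i j * Ξ a b + h a i * Ξ b j + h a j * Ξ b i) by
    ext a b
    have hs := metric_symm hh
    simp only [rhsS, young3]
    rw [hs j i, hs i a, hs j a, hs i b, hs j b, hX.1 j i, hX.1 a i, hX.1 a j, hX.1 b i, hX.1 b j]
    ring, tr2_sub, tr2_const_mul, tr2_const_mul, tr2_add, tr2_add, tr2_add, tr2_add,
    tr2_metric_mul_const hh, tr2_const_mul, hX.2, tr2_mul_metric hh (fun a => Ξ i a),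
    tr2_mul_metric hh (fun a => Ξ j a), tr2_metric_mul hh (fun b => Ξ b j),
    tr2_metric_mul hh (fun b => Ξ b i), hX.1 j i]
  ring

/-- In dimension two, `Sᵢₐᵦ Sⱼᵃᵇ = (1/2) |S|² gᵢⱼ` for trace-free symmetric `S`. -/
theorem tr2_tr2_mul_self (hh : h.PosDef) {S} (hS : IsSymmTracefree3 h S) (j m : Fin 2) :
    (tr2 h fun i k => tr2 h fun a b => S i j a * S b k m) = 1 / 2 * normSq3 h S * h j m := by
  obtain ⟨L, hL, rfl⟩ := exists_frame hh
  obtain ⟨S, rfl⟩ := act3_surj hL S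
  rw [isSymmTracefree3_act hL] at hS
  rw [normSq3_act hL]
  have h0 : ∀ i k, (tr2 (L * Lᵀ) fun a b => act3 L S i j a * act3 L S b k m) =
      ∑ α, ∑ γ, L i α * L k γ * (∑ β, ∑ μ, ∑ ν, L j μ * L m ν * (S α μ β * S β γ ν)) := by
    intro i k
    rw [show (fun a b => act3 L S i j a * act3 L S b k m) = fun a b => ∑ β, ∑ δ, L a β * L b δ *
      ((∑ α, ∑ μ, L i α * L j μ * S α μ β) * ∑ γ, ∑ ν, L k γ * L m ν * S δ γ ν) by
        ext b d; simp only [act3, Fin.sum_univ_two]; ring, tr2_act hL]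
    simp only [Fin.sum_univ_two]; ring
  simp only [h0]
  rw [tr2_act hL, normSq3_one hS]
  obtain ⟨h1, h2, h3, h4, h5, h6⟩ := hS.comps
  simp only [Fin.sum_univ_two, h1, h2, h3, h4, h5, h6, mul_transpose_apply_two]
  ring

theorem contr32_eq_of_symm {T τ} (hT : IsSymmTracefree3 h T)
    (hτ : IsSymmTracefree2 h τ) (k : Fin 2) :
    (tr2 h fun a b => tr2 h fun c d => T a k c * τ d b) = contr32 h T τ k := by
  rw [contr32_eq]
  refine tr2_congr fun a b => tr2_congr fun c d => ?_
  rw [(hT.1 a k c).1, hτ.1 d b]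

namespace MetricOn

variable {G : E2 → Matrix (Fin 2) (Fin 2) ℝ} {Ω : Set E2} {x : E2}
  {T : E2 → Fin 2 → Fin 2 → Fin 2 → ℝ} {τ : E2 → Fin 2 → Fin 2 → ℝ}

/-- The tensor `q` for totally symmetric trace-free `T`: `q = div T + (1/2) (|T|² - R) g + τ`. -/
theorem smallQ_eq (hG : MetricOn G Ω) (hx : x ∈ Ω)
    (hT : ∀ i j k, ContDiffOn ℝ ∞ (fun y => T y i j k) Ω)
    (hTs : ∀ y ∈ Ω, IsSymmTracefree3 (G y) (T y)) (hτ : IsSymmTracefree2 (G x) (τ x))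
    (j m : Fin 2) :
    smallQ G T τ x j m = div3 G T x j m
      + 1 / 2 * (normSq3 (G x) (T x) - scalarCurv G x) * G x j m + τ x j m := by
  have hh := hG.posDef x hx
  have hM := fun l => hG.cov3_symmTracefree hx hT hTs l
  unfold smallQ bigQ
  rw [tr2_add, tr2_sub, tr2_add, tr2_tr2_mul_self hh (hTs x hx),
    tr2_mul_metric hh (fun i => τ x i j)]
  have h1 : (tr2 (G x) fun a b => cov3 G T x a j m b) = div3 G T x j m := by
    refine tr2_congr fun a b => ?_
    exact ((hM b).1 a j m).1.trans ((hM b).1 j a m).2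
  have h2 : (tr2 (G x) fun a b => curv (G x) (scalarCurv G x) a j b m) =
      scalarCurv G x / 2 * G x j m := by
    rw [show (fun a b => curv (G x) (scalarCurv G x) a j b m) = fun a b => scalarCurv G x / 2 *
      (G x a b * G x j m - G x a m * G x b j) by
        ext a b; rw [curv, hG.symm hx j b], tr2_const_mul, tr2_sub, tr2_metric_mul_const hh,
      tr2_metric_mul hh (fun b => G x b j), hG.symm hx m j]
    ring
  rw [h1, h2, hτ.1 m j]
  ring

/-- The one-form `γ` for totally symmetric trace-free `T`: `γₖ = ∇ᵃ τₐₖ + Tₖₐᵦ τᵃᵇ`. -/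
theorem smallGamma_eq
    (hT : IsSymmTracefree3 (G x) (T x)) (hτs : IsSymmTracefree2 (G x) (τ x))
    (k : Fin 2) :
    smallGamma G T τ x k = (tr2 (G x) fun a b => cov2 G τ x a k b)
      + contr32 (G x) (T x) (τ x) k := by
  unfold smallGamma bigGamma
  rw [tr2_add, contr32_eq_of_symm hT hτs]

theorem smooth_normSq3 (hG : MetricOn G Ω)
    (hT : ∀ i j k, ContDiffOn ℝ ∞ (fun y => T y i j k) Ω) :
    ContDiffOn ℝ ∞ (fun y => normSq3 (G y) (T y)) Ω := by
  simp only [normSq3_eq, inner3]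
  exact hG.smooth_tr2 fun a d => hG.smooth_tr2 fun b e => hG.smooth_tr2 fun c f =>
    (hT a b c).mul (hT d e f)

end MetricOn

theorem div_rhsXi (hh : h.PosDef) {S Ξ} (hS : IsSymmTracefree3 h S) (k : Fin 2) :
    (tr2 h fun a b => rhsXi h S Ξ a k b) = 4 / 3 * contr32 h S Ξ k := by
  have hs := metric_symm hh
  rw [show (fun a b => rhsXi h S Ξ a k b) = fun a b => 1 / 3 * normSq3 h S * S a b k
      + 2 / 3 * (h a b * contr32 h S Ξ k + contr32 h S Ξ a * h b k - h a k * contr32 h S Ξ b) by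
    ext a b; rw [rhsXi_eq hh, (hS.1 a k b).2, hs k b]; ring, tr2_add, tr2_const_mul,
    hS.2, tr2_const_mul, tr2_sub, tr2_add, tr2_metric_mul_const hh,
    tr2_mul_metric hh (fun a => contr32 h S Ξ a), tr2_metric_mul hh (fun a => contr32 h S Ξ a)]
  ring

/-- The pointwise identity behind the integrability condition for `q`, where
`q = (4/3) Ξ + c g` with `c = (11/18) |S|²` and `γₖ = (7/9) Sₖₐᵦ Ξᵃᵇ`. -/
theorem qTerm_symm_aux (hh : h.PosDef) {S Ξ} (hS : IsSymmTracefree3 h S)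
    (hX : IsSymmTracefree2 h Ξ) (c : ℝ) (k l n : Fin 2) :
    (4 / 3 * rhsXi h S Ξ k n l + 11 / 9 * contr32 h S Ξ l * h k n)
      + (tr2 h fun a b => S a l n * (4 / 3 * Ξ k b + c * h k b)) + 7 / 9 * contr32 h S Ξ k * h l n =
    (4 / 3 * rhsXi h S Ξ l n k + 11 / 9 * contr32 h S Ξ k * h l n)
      + (tr2 h fun a b => S a k n * (4 / 3 * Ξ l b + c * h l b))
          + 7 / 9 * contr32 h S Ξ l * h k n := by
  have hs := metric_symm hh
  have h0 : ∀ k l, (tr2 h fun a b => S a l n * (4 / 3 * Ξ k b + c * h k b)) =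
      4 / 3 * (tr2 h fun a b => S a l n * Ξ b k) + c * S k l n := by
    intro k l
    rw [← tr2_const_mul, ← tr2_mul_metric hh (fun a => S a l n) k, ← tr2_const_mul, ← tr2_add]
    exact tr2_congr fun a b => by rw [hX.1 k b, hs k b]; ring
  rw [h0, h0, (hS.1 k l n).1]
  obtain ⟨L, hL, rfl⟩ := exists_frame hh
  obtain ⟨S, rfl⟩ := act3_surj hL S
  obtain ⟨Ξ, rfl⟩ := act2_surj hL Ξ
  rw [isSymmTracefree3_act hL] at hS
  rw [isSymmTracefree2_act hL] at hX
  simp only [tr2_act3_mul_act2 hL, rhsXi_eq hh, normSq3_act hL, contr32_act hL]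
  obtain ⟨h1, h2, h3, h4, h5, h6⟩ := hS.comps
  obtain ⟨h7, h8⟩ := hX.comps
  simp only [normSq3_one hS, act1, act3, mul_transpose_apply_two, Fin.sum_univ_two,
    (contr32_one hS hX).1, (contr32_one hS hX).2, h1, h2, h3, h4, h5, h6, h7, h8]
  ring

theorem cov2_const_mul_add_mul_metric {G : E2 → Matrix (Fin 2) (Fin 2) ℝ} {Ω : Set E2} {x : E2}
    (hG : MetricOn G Ω) (hx : x ∈ Ω) {A : E2 → Fin 2 → Fin 2 → ℝ} {f : E2 → ℝ}
    (hA : ∀ i j, ContDiffOn ℝ ∞ (fun y => A y i j) Ω) (hf : ContDiffOn ℝ ∞ f Ω) (c : ℝ)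
    (i j k : Fin 2) :
    cov2 G (fun y i j => c * A y i j + f y * G y i j) x i j k =
      c * cov2 G A x i j k + pd k f x * G x i j := by
  have h0 := hG.cov2_metric hx i j k
  unfold cov2 at *
  rw [pd_add k (hG.diff hx (contDiffOn_const.mul (hA i j))) (hG.diff hx (hf.mul (hG.smooth i j))),
    pd_const_mul k c (hG.diff hx (hA i j)), pd_mul k (hG.diff hx hf) (hG.diff hx (hG.smooth i j)),
    eq_add_of_sub_eq h0]
  simp only [Fin.sum_univ_two]
  ring

theorem cov2_const_mul {G : E2 → Matrix (Fin 2) (Fin 2) ℝ} {x : E2} {A : E2 → Fin 2 → Fin 2 → ℝ}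
    (hA : ∀ i j, DifferentiableAt ℝ (fun y => A y i j) x) (c : ℝ) (i j k : Fin 2) :
    cov2 G (fun y i j => c * A y i j) x i j k = c * cov2 G A x i j k := by
  unfold cov2
  rw [pd_const_mul k c (hA i j)]
  simp only [Fin.sum_univ_two]
  ring

/-- The derivative of `|S|²`; with `R = -(2/9) |S|²` it gives the derivative of the curvature. -/
theorem ClosedSystem.pd_normSq3 {G : E2 → Matrix (Fin 2) (Fin 2) ℝ} {Ω : Set E2} {x : E2}
    (hG : MetricOn G Ω) {S : E2 → Fin 2 → Fin 2 → Fin 2 → ℝ} {Ξ : E2 → Fin 2 → Fin 2 → ℝ}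
    (hx : x ∈ Ω) (hS : ∀ i j k, ContDiffOn ℝ ∞ (fun y => S y i j k) Ω)
    (hSs : IsSymmTracefree3 (G x) (S x))
    (hΞs : IsSymmTracefree2 (G x) (Ξ x))
    (hc : ∀ i j k l, cov3 G S x i j k l = rhsS (G x) (Ξ x) i j k l) (k : Fin 2) :
    pd k (fun y => normSq3 (G y) (S y)) x = 2 * contr32 (G x) (S x) (Ξ x) k := by
  rw [hG.pd_normSq3 hx hS]
  simp only [hc]
  rw [inner3_rhsS (hG.posDef x hx) hSs hΞs]

/-- The closed system implies the integrability conditions. By the system,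
`q = (4/3) Ξ + (11/18) |S|² g` and `γₖ = (7/9) Sₖₐᵦ Ξᵃᵇ = (7/18) ∇ₖ|S|²`; in particular `γ` is
closed. -/
theorem ClosedSystem.integrabilityConditions {G : E2 → Matrix (Fin 2) (Fin 2) ℝ} {Ω : Set E2}
    (hG : MetricOn G Ω) {S : E2 → Fin 2 → Fin 2 → Fin 2 → ℝ} {Ξ τ : E2 → Fin 2 → Fin 2 → ℝ}
    (hS : ∀ i j k, ContDiffOn ℝ ∞ (fun y => S y i j k) Ω)
    (hΞ : ∀ i j, ContDiffOn ℝ ∞ (fun y => Ξ y i j) Ω)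
    (hSs : ∀ y ∈ Ω, IsSymmTracefree3 (G y) (S y))
    (hΞs : ∀ y ∈ Ω, IsSymmTracefree2 (G y) (Ξ y))
    (hτ : ∀ y ∈ Ω, ∀ i j, τ y i j = 1 / 3 * Ξ y i j)
    (hc : ∀ y ∈ Ω, ClosedSystem G S Ξ y) {x : E2} (hx : x ∈ Ω) :
    IntegrabilityConditions G S τ x := by
  have hd : ∀ y ∈ Ω, ∀ i j, div3 G S y i j = Ξ y i j := by
    intro y hy i j
    rw [div3, ← div_rhsS (hG.posDef y hy) (hΞs y hy)]
    exact tr2_congr fun a b => (hc y hy).deriv_S i j a b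
  have hτs : ∀ y ∈ Ω, IsSymmTracefree2 (G y) (τ y) := by
    intro y hy
    rw [show τ y = fun i j => 1 / 3 * Ξ y i j from funext fun i => funext fun j => hτ y hy i j]
    refine ⟨fun i j => congrArg _ ((hΞs y hy).1 i j), ?_⟩
    rw [tr2_const_mul, (hΞs y hy).2, mul_zero]
  have hn := hG.smooth_normSq3 hS
  have hq : ∀ y ∈ Ω, ∀ i j, smallQ G S τ y i j =
      4 / 3 * Ξ y i j + (11 / 18 * normSq3 (G y) (S y)) * G y i j := by
    intro y hy i j
    rw [hG.smallQ_eq hy hS hSs (hτs y hy), hd y hy, hτ y hy, (hc y hy).curvature]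
    ring
  have hg : ∀ y ∈ Ω, ∀ k, smallGamma G S τ y k = 7 / 9 * contr32 (G y) (S y) (Ξ y) k := by
    intro y hy k
    rw [MetricOn.smallGamma_eq (hSs y hy) (hτs y hy)]
    have h1 : (tr2 (G y) fun a b => cov2 G τ y a k b) = 1 / 3
        * (4 / 3 * contr32 (G y) (S y) (Ξ y) k) := by
      rw [← div_rhsXi (hG.posDef y hy) (hSs y hy), ← tr2_const_mul]
      refine tr2_congr fun a b => ?_
      rw [MetricOn.cov2_congr hG.isOpen hy hτ, cov2_const_mul fun i j => hG.diff hy (hΞ i j),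
        (hc y hy).deriv_Xi]
    have h2 : contr32 (G y) (S y) (τ y) k = 1 / 3 * contr32 (G y) (S y) (Ξ y) k := by
      simp only [contr32, hτ y hy, Fin.sum_univ_two]; ring
    rw [h1, h2]; ring
  have hp : ∀ y ∈ Ω, ∀ k, pd k (fun y => normSq3 (G y) (S y)) y = 2 * contr32 (G y) (S y) (Ξ y) k :=
    fun y hy k => ClosedSystem.pd_normSq3 hG hy hS (hSs y hy) (hΞs y hy) (hc y hy).deriv_S k
  have hh := hG.posDef x hx
  refine ⟨hSs x hx, ?_, ?_, ?_, ?_, ?_⟩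
  · rw [(hc x hx).curvature]; ring
  · intro i j k l
    rw [show cov3 G S x = rhsS (G x) (Ξ x) by ext i j k l; exact (hc x hx).deriv_S i j k l]
    exact tracefree4_young4_rhsS hh (hΞs x hx) i j k l
  · intro i j
    simp only [tracefree2, hd x hx]
    rw [tr2_const_mul, (hΞs x hx).2, hτ x hx]; ring
  · intro k l n
    have h1 : ∀ k l n, cov2 G (smallQ G S τ) x k n l = 4 / 3 * rhsXi (G x) (S x) (Ξ x) k n l +
        11 / 9 * contr32 (G x) (S x) (Ξ x) l * G x k n := by
      intro k l n
      rw [MetricOn.cov2_congr hG.isOpen hx hq, cov2_const_mul_add_mul_metric hG hx hΞ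
        (contDiffOn_const.mul hn), (hc x hx).deriv_Xi, pd_const_mul _ _ (hG.diff hx hn), hp x hx]
      ring
    unfold qTerm
    simp only [h1, hq x hx, hg x hx]
    rw [sub_eq_zero]
    exact qTerm_symm_aux hh (hSs x hx) (hΞs x hx) _ k l n
  · intro i j
    -- the one-form is exact, hence closed
    have h1 : ∀ y ∈ Ω, ∀ k, smallGamma G S τ y k =
        7 / 18 * pd k (fun y => normSq3 (G y) (S y)) y := by
      intro y hy k
      rw [hg y hy, hp y hy]; ring
    have h2 : cov1 G (smallGamma G S τ) x i j = cov1 G (smallGamma G S τ) x j i := by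
      rw [MetricOn.cov1_congr hG.isOpen hx h1, MetricOn.cov1_congr hG.isOpen hx h1]
      unfold cov1
      rw [pd_const_mul _ _ (hG.diff hx (contDiffOn_pd hG.isOpen hn _)),
        pd_const_mul _ _ (hG.diff hx (contDiffOn_pd hG.isOpen hn _)), pd_pd_comm hG.isOpen hn hx]
      simp only [hG.christoffel_symm hx _ i j]
    have h3 : ∀ i j, (tr2 (G x) fun a b => smallQ G S τ x i a * τ x b j) =
        4 / 9 * (tr2 (G x) fun a b => Ξ x i a * Ξ x b j)
          + 11 / 54 * normSq3 (G x) (S x) * Ξ x i j := by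
      intro i j
      rw [← tr2_metric_mul hh (fun b => Ξ x b j) i, ← tr2_const_mul, ← tr2_const_mul, ← tr2_add]
      refine tr2_congr fun a b => ?_
      rw [hq x hx, hτ x hx, hG.symm hx i a]; ring
    unfold gammaTerm
    rw [h2, h3, h3, (hΞs x hx).1 i j, ← tr2_swap hh fun a b => Ξ x i a * Ξ x b j]
    have h4 : (tr2 (G x) fun a b => Ξ x i b * Ξ x a j) = tr2 (G x) fun a b => Ξ x j a * Ξ x b i :=
      tr2_congr fun a b => by rw [(hΞs x hx).1 i b, (hΞs x hx).1 a j]; ring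
    rw [h4]; ring

end

/-! ### Components in the charts of the surface -/

section

open Matrix Bundle

section Surface

variable {M : Type*} [TopologicalSpace M] [ChartedSpace E2 M]

theorem contMDiffOn_symm_of_mem_charts {c : OpenPartialHomeomorph M E2} (hc : c ∈ charts M) :
    ContMDiffOn (𝓡 2) (𝓡 2) ∞ c.symm c.target := contMDiffOn_symm_of_mem_maximalAtlas hc

theorem contDiffOn_comp_symm {U : M → ℝ} (hU : ContMDiff (𝓡 2) 𝓘(ℝ) ∞ U)
    {c : OpenPartialHomeomorph M E2} (hc : c ∈ charts M) :
    ContDiffOn ℝ ∞ (U ∘ c.symm) c.target :=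
  contMDiffOn_iff_contDiffOn.1 (hU.comp_contMDiffOn (contMDiffOn_symm_of_mem_charts hc))

theorem IsSmooth.comp2 {A : CovTensor 2 M} (hA : IsSmooth A) {c : OpenPartialHomeomorph M E2}
    (hc : c ∈ charts M) (i j : Fin 2) : ContDiffOn ℝ ∞ (fun x => comp2 c A x i j) c.target :=
  hA c hc ![i, j]

theorem IsSmooth.comp3 {A : CovTensor 3 M} (hA : IsSmooth A) {c : OpenPartialHomeomorph M E2}
    (hc : c ∈ charts M) (i j k : Fin 2) : ContDiffOn ℝ ∞ (fun x => comp3 c A x i j k) c.target :=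
  hA c hc ![i, j, k]

theorem ee_sum (v : E2) : v = v 0 • ee 0 + v 1 • ee 1 := by
  ext i; fin_cases i <;> simp [ee]

theorem mfderiv_symm_apply (c : OpenPartialHomeomorph M E2) (x w : E2) :
    (mfderiv (𝓡 2) (𝓡 2) c.symm x : E2 →L[ℝ] TangentSpace (𝓡 2) (c.symm x)) w =
      w 0 • frame c x 0 + w 1 • frame c x 1 := by
  let F : E2 →L[ℝ] TangentSpace (𝓡 2) (c.symm x) := mfderiv (𝓡 2) (𝓡 2) c.symm x
  calc F w = F (w 0 • ee 0 + w 1 • ee 1) := congrArg F (ee_sum w)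
    _ = _ := by rw [map_add, map_smul, map_smul]; rfl

theorem mdifferentiable_of_mem_charts {c : OpenPartialHomeomorph M E2} (hc : c ∈ charts M) :
    c.MDifferentiable (𝓡 2) (𝓡 2) :=
  ⟨(contMDiffOn_of_mem_maximalAtlas hc).mdifferentiableOn (by simp),
    (contMDiffOn_symm_of_mem_charts hc).mdifferentiableOn (by simp)⟩

/-- The coordinate vector fields span every tangent space. -/
theorem exists_frame_eq {c : OpenPartialHomeomorph M E2} (hc : c ∈ charts M) {x : E2}
    (hx : x ∈ c.target) (v : TangentSpace (𝓡 2) (c.symm x)) :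
    ∃ a : Fin 2 → ℝ, v = a 0 • frame c x 0 + a 1 • frame c x 1 := by
  have h := (mdifferentiable_of_mem_charts hc).symm_comp_deriv (c.map_target hx)
  rw [c.right_inv hx] at h
  have hv := DFunLike.congr_fun h v
  set w : E2 := mfderiv (𝓡 2) (𝓡 2) c (c.symm x) v with hw
  refine ⟨fun i => w i, ?_⟩
  exact hv.symm.trans (mfderiv_symm_apply c x w)

/-- The coordinate vector fields are linearly independent. -/
theorem frame_inj {c : OpenPartialHomeomorph M E2} (hc : c ∈ charts M) {x : E2}
    (hx : x ∈ c.target) {a : Fin 2 → ℝ} (h : a 0 • frame c x 0 + a 1 • frame c x 1 = 0) :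
    a = 0 := by
  have h1 := (mdifferentiable_of_mem_charts hc).comp_symm_deriv hx
  set w : E2 := WithLp.toLp 2 a with hw
  have hv := DFunLike.congr_fun h1 w
  have h2 : mfderiv (𝓡 2) (𝓡 2) c.symm x w = 0 := by
    rw [← h]
    exact mfderiv_symm_apply c x w
  have h3 : w = 0 := by
    rw [show w = _ from hv.symm]
    change mfderiv (𝓡 2) (𝓡 2) c (c.symm x) (mfderiv (𝓡 2) (𝓡 2) c.symm x w) = 0
    rw [h2, map_zero]
  ext i
  have := congrArg (fun v : E2 => v i) h3
  simpa [hw] using this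

variable [IsManifold (𝓡 2) ∞ M]

theorem contMDiffOn_frame {c : OpenPartialHomeomorph M E2} (hc : c ∈ charts M) (i : Fin 2) :
    ContMDiffOn (𝓡 2) (𝓡 2).tangent ∞
      (fun x => (TotalSpace.mk' E2 (c.symm x) (frame c x i) : TangentBundle (𝓡 2) M)) c.target := by
  have h1 := (contMDiffOn_symm_of_mem_charts hc).contMDiffOn_tangentMapWithin (m := ∞) (by simp)
    c.open_target.uniqueMDiffOn
  have h2 : ContMDiffOn (𝓡 2) (𝓡 2).tangent ∞
      (fun x : E2 => (TotalSpace.mk' E2 x (ee i) : TangentBundle (𝓡 2) E2)) c.target :=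
    contMDiffOn_vectorSpace_iff_contDiffOn.2 contDiffOn_const
  refine (h1.comp h2 fun x hx => hx).congr fun x hx => ?_
  simp only [Function.comp, tangentMapWithin, frame]
  rw [mfderivWithin_of_isOpen c.open_target hx]

theorem metricOn_metricComp (g : ConfSuperint.Metric M) {c : OpenPartialHomeomorph M E2}
    (hc : c ∈ charts M) : MetricOn (metricComp c g) c.target := by
  refine ⟨c.open_target, fun i j => ?_, fun x hx => ?_⟩
  · have h1 : ContMDiffOn (𝓡 2) ((𝓡 2).prod 𝓘(ℝ)) ∞
      (fun x => TotalSpace.mk' ℝ (E := Bundle.Trivial M ℝ) (c.symm x)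
        (g.inner (c.symm x) (frame c x i) (frame c x j))) c.target := by
      apply ContMDiffOn.clm_bundle_apply₂ (F₁ := E2) (F₂ := E2)
      · exact g.contMDiff.comp_contMDiffOn (contMDiffOn_symm_of_mem_charts hc)
      · exact contMDiffOn_frame hc i
      · exact contMDiffOn_frame hc j
    have h2 : ContMDiffOn (𝓡 2) 𝓘(ℝ) ∞
        (fun x => g.inner (c.symm x) (frame c x i) (frame c x j)) c.target := fun x hx => by
      have := h1 x hx
      simp only [contMDiffWithinAt_totalSpace] at this
      exact this.2
    exact contMDiffOn_iff_contDiffOn.1 h2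
  · refine Matrix.PosDef.of_dotProduct_mulVec_pos ?_ fun a ha => ?_
    · ext i j
      simp [metricComp, g.symm _ (frame c x i)]
    · have hne : a 0 • frame c x 0 + a 1 • frame c x 1 ≠ 0 := fun h => ha (frame_inj hc hx h)
      have := g.pos _ _ hne
      simp only [map_add, map_smul, _root_.add_apply, _root_.smul_apply,
        smul_eq_mul] at this
      simp [dotProduct, Matrix.mulVec, Fin.sum_univ_two, metricComp]
      linarith

end Surface

end

/-! ### Conformal Killing tensors -/

section

open Matrix

variable {h : Matrix (Fin 2) (Fin 2) ℝ}

/-- In dimension two, a tensor that is trace-free and symmetric in its first two indices and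
has vanishing remaining trace is totally symmetric: such tensors have four components, and the two
trace conditions identify `T 0 1 i` with a component `T 0 0 j` up to sign. -/
theorem isSymmTracefree3_of_traceForm_eq_zero (hh : h.PosDef) {T : Fin 2 → Fin 2 → Fin 2 → ℝ}
    (h1 : ∀ k, IsSymmTracefree2 h fun i j => T i j k) (h2 : ∀ j, traceForm h T j = 0) :
    IsSymmTracefree3 h T := by
  obtain ⟨L, hL, rfl⟩ := exists_frame hh
  obtain ⟨T, rfl⟩ := act3_surj hL T
  rw [isSymmTracefree3_act hL]
  have e := isSymmTracefree2_of_act3 hL h1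
  have e1 : ∀ i j k, T i j k = T j i k := fun i j k => (e k).1 i j
  have e2 : ∀ k, T 0 0 k + T 1 1 k = 0 := fun k => by simpa only [tr2_one] using (e k).2
  have e3 : ∀ j, T 0 j 0 + T 1 j 1 = 0 := by
    have : act1 L (fun j => T 0 j 0 + T 1 j 1) = act1 L fun _ => 0 := by
      ext j
      have := h2 j
      rw [traceForm, tr2_act3_outer hL] at this
      simp only [act1, Fin.sum_univ_two] at this ⊢
      linarith
    exact fun k => congrFun (act1_inj hL this) k
  refine ⟨fun i j k => ⟨e1 i j k, ?_⟩, fun k => by rw [tr2_one]; exact e2 k⟩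
  have a1 := e1 0 1
  have a2 := e2 0
  have a3 := e2 1
  have a4 := e3 0
  have a5 := e3 1
  have a6 := a1 0
  have a7 := a1 1
  fin_cases i <;> fin_cases j <;> fin_cases k <;> simp only [Fin.zero_eta, Fin.mk_one] <;> linarith

theorem confStruct_eq_self {T : Fin 2 → Fin 2 → Fin 2 → ℝ} (h2 : ∀ j, traceForm h T j = 0) :
    confStruct h T = T := by
  ext i j k
  simp [confStruct, youngTf2, tr2, h2]

/-- The trace of the conformal Killing equation: the one-form on its right hand side is the
divergence. -/
theorem conformalKilling_trace (hh : h.PosDef) {N : Fin 2 → Fin 2 → Fin 2 → ℝ} {ℓ : Fin 2 → ℝ}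
    (hN : ∀ k, IsSymmTracefree2 h fun i j => N i j k)
    (hK : ∀ i j k, N i j k + N j k i + N k i j = 1 / 2 * (ℓ i * h j k + ℓ j * h k i + ℓ k * h i j))
    (k : Fin 2) : ℓ k = tr2 h fun a b => N k a b := by
  have hs := metric_symm hh
  have h1 : (tr2 h fun a b => (N a b k + N b k a) + N k a b) =
      tr2 h fun a b => 1 / 2 * ((ℓ a * h b k + h a k * ℓ b) + h a b * ℓ k) :=
    tr2_congr fun a b => by rw [hK, hs k a]; ring
  rw [tr2_add, tr2_add, tr2_const_mul, tr2_add, tr2_add, tr2_mul_metric hh, tr2_metric_mul hh,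
    tr2_metric_mul_const hh, (hN k).2, ← tr2_swap hh] at h1
  have h2 : (tr2 h fun a b => N a k b) = tr2 h fun a b => N k a b :=
    tr2_congr fun a b => (hN b).1 a k
  rw [h2] at h1
  linarith

/-- The covariant derivative of a trace-free conformal Killing tensor is determined by its
divergence. -/
theorem conformalKilling_eq (hh : h.PosDef) {N : Fin 2 → Fin 2 → Fin 2 → ℝ} {ℓ : Fin 2 → ℝ}
    (hN : ∀ k, IsSymmTracefree2 h fun i j => N i j k)
    (hK : ∀ i j k, N i j k + N j k i + N k i j = 1 / 2 * (ℓ i * h j k + ℓ j * h k i + ℓ k * h i j))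
    (i j k : Fin 2) : N i j k = 1 / 2 * (h i k * ℓ j + h j k * ℓ i - h i j * ℓ k) := by
  obtain ⟨L, hL, rfl⟩ := exists_frame hh
  obtain ⟨N, rfl⟩ := act3_surj hL N
  obtain ⟨ℓ, rfl⟩ := act1_surj hL ℓ
  have e := isSymmTracefree2_of_act3 hL hN
  have e1 : ∀ i j k, N i j k = N j i k := fun i j k => (e k).1 i j
  have e2 : ∀ k, N 0 0 k + N 1 1 k = 0 := fun k => by simpa only [tr2_one] using (e k).2
  have e3 : ∀ i j k, N i j k + N j k i + N k i j = 1 / 2 * (ℓ i * (1 : Matrix (Fin 2) (Fin 2) ℝ) j k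
      + ℓ j * (1 : Matrix (Fin 2) (Fin 2) ℝ) k i + ℓ k * (1 : Matrix (Fin 2) (Fin 2) ℝ) i j) := by
    have : act3 L (fun i j k => N i j k + N j k i + N k i j) =
        act3 L fun i j k => 1 / 2 * (ℓ i * (1 : Matrix (Fin 2) (Fin 2) ℝ) j k
      + ℓ j * (1 : Matrix (Fin 2) (Fin 2) ℝ) k i + ℓ k * (1 : Matrix (Fin 2) (Fin 2) ℝ) i j) := by
      ext i j k
      have := hK i j k
      simp only [act3, act1, Fin.sum_univ_two, mul_transpose_apply_two] at this ⊢
      simp only [Matrix.one_apply_eq, Matrix.one_apply_ne zero_ne_one,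
        Matrix.one_apply_ne one_ne_zero]
      linear_combination this
    intro i j k
    exact congrFun (congrFun (congrFun (act3_inj hL this) i) j) k
  have f1 := e3 0 0 0
  have f2 := e3 0 0 1
  have f3 := e3 0 1 1
  have f4 := e3 1 1 1
  simp [e1 1 0] at f1 f2 f3 f4
  have n1 : N 0 0 0 = ℓ 0 / 2 := by linarith
  have n2 : N 1 1 1 = ℓ 1 / 2 := by linarith
  have n3 : N 1 1 0 = - (ℓ 0 / 2) := by linarith [e2 0]
  have n4 : N 0 0 1 = - (ℓ 1 / 2) := by linarith [e2 1]
  have n5 : N 0 1 0 = ℓ 1 / 2 := by linarith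
  have n6 : N 0 1 1 = ℓ 0 / 2 := by linarith
  simp only [act3, act1, Fin.sum_univ_two, mul_transpose_apply_two, e1 1 0, n1, n2, n3, n4, n5, n6]
  ring

/-- The Bertrand-Darboux condition determines the divergence `D` of a trace-free conformal Killing
tensor `C` with covariant derivative `N`: take the trace over `l, n`. -/
theorem divergence_eq_of_bertrandDarboux (hh : h.PosDef) {N T : Fin 2 → Fin 2 → Fin 2 → ℝ}
    {C : Fin 2 → Fin 2 → ℝ} {D : Fin 2 → ℝ} (hT : IsSymmTracefree3 h T)
    (hC : IsSymmTracefree2 h C)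
    (hN : ∀ k, IsSymmTracefree2 h fun i j => N i j k) (hD : ∀ k, D k = tr2 h fun a b => N k a b)
    (hBD : ∀ k l n, N k n l + (tr2 h fun a b => C k a * T b l n) + 1 / 2 * D k * h l n =
      N l n k + (tr2 h fun a b => C l a * T b k n) + 1 / 2 * D l * h k n) (k : Fin 2) :
    D k = 2 / 3 * contr32 h T C k := by
  have h1 : (tr2 h fun l n => N k n l + (tr2 h fun a b => C k a * T b l n)
      + h l n * (1 / 2 * D k)) =
      tr2 h fun l n => N n l k + (tr2 h fun a b => C l a * T b k n) + 1 / 2 * (D l * h n k) :=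
    tr2_congr fun l n => by
      have hs := metric_symm hh
      have := hBD k l n
      have h3 := (hN k).1 l n
      simp only at h3
      rw [hs n k, ← h3]; linarith
  rw [tr2_add, tr2_add, tr2_add, tr2_add, tr2_const_mul, tr2_mul_metric hh, tr2_metric_mul_const hh,
    tr2_swap hh fun a b => N k a b, tr2_swap hh fun a b => N a b k, (hN k).2, ← hD] at h1
  have h4 : (tr2 h fun l n => tr2 h fun a b => C k a * T b l n) = 0 := by
    have e : (tr2 h fun l n => tr2 h fun a b => C k a * T b l n) =
        tr2 h fun a b => C k a * tr2 h fun l n => T l n b := by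
      have : ∀ b l n, T b l n = T l n b := fun b l n => by rw [(hT.1 b l n).1, (hT.1 l b n).2]
      simp only [this]
      simp only [tr2, Fin.sum_univ_two]; ring
    rw [e]; simp only [hT.2]; simp [tr2]
  have h5 : (tr2 h fun l n => tr2 h fun a b => C l a * T b k n) = contr32 h T C k := by
    rw [← contr32_eq_of_symm hT hC, ← tr2_swap hh]
    refine tr2_congr fun l n => ?_
    rw [← tr2_swap hh]
    refine tr2_congr fun a b => ?_
    rw [hC.1 n b, (hT.1 a k l).1, (hT.1 k a l).2, (hT.1 k l a).1]; ring
  rw [h4, h5] at h1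
  linarith

end

/-! ### Algebraic consequences of the Ricci identity and of the Bertrand-Darboux condition -/

section

open Matrix

variable {h : Matrix (Fin 2) (Fin 2) ℝ}

/-- The covariant derivative `∇ₖ Cᵢⱼ` of a trace-free conformal Killing tensor `C` on a surface, as
a function of its divergence `D`. -/
noncomputable def killRhs (h : Matrix (Fin 2) (Fin 2) ℝ) (D : Fin 2 → ℝ) (i j k : Fin 2) : ℝ :=
  1 / 2 * (h i k * D j + h j k * D i - h i j * D k)

/-- The derivative `∇ₘ Dⱼ` of the divergence `Dⱼ = (2/3) Tⱼₐᵦ Cᵃᵇ` of a trace-free conformal Killing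
tensor `C`, where `M` is the covariant derivative of `T`. -/
noncomputable def divDeriv (h : Matrix (Fin 2) (Fin 2) ℝ) (T : Fin 2 → Fin 2 → Fin 2 → ℝ)
    (M : Fin 2 → Fin 2 → Fin 2 → Fin 2 → ℝ) (C : Fin 2 → Fin 2 → ℝ) (j m : Fin 2) : ℝ :=
  2 / 3 * (contr32 h (fun a b c => M a b c m) C j
    + contr32 h T (fun a b => killRhs h (fun k => 2 / 3 * contr32 h T C k) a b m) j)

/-- For trace-free `T` only one of the three terms of `killRhs` contributes to the contraction with
`T`. -/
theorem contr32_killRhs (hh : h.PosDef) {T : Fin 2 → Fin 2 → Fin 2 → ℝ}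
    (hT : IsSymmTracefree3 h T) (D : Fin 2 → ℝ) (j m : Fin 2) :
    contr32 h T (fun a b => killRhs h D a b m) j = tr2 h fun a b => T j m a * D b := by
  have h0 : ∀ k : Fin 2, (tr2 h fun a b => T k a b) = 0 := fun k => by
    rw [← hT.2 k]
    exact tr2_congr fun a b => by rw [(hT.1 k a b).1, (hT.1 a k b).2]
  have hs := metric_symm hh
  rw [contr32_eq]
  have h1 : ∀ a c, (tr2 h fun b d => T j a b * killRhs h D c d m) =
      1 / 2 * ((tr2 h fun b d => T j a b * D d) * h c m + T j a m * D c - T j a c * D m) := by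
    intro a c
    rw [show (fun b d => T j a b * killRhs h D c d m) = fun b d => 1 / 2 *
      (((T j a b * D d) * h c m + (T j a b * h d m) * D c) - (T j a b * h d c) * D m) by
        ext b d; rw [killRhs, hs c d]; ring, tr2_const_mul, tr2_sub, tr2_add, tr2_mul_const,
      tr2_mul_const, tr2_mul_const, tr2_mul_metric hh (fun b => T j a b),
      tr2_mul_metric hh (fun b => T j a b)]
  simp only [h1]
  rw [tr2_const_mul, tr2_sub, tr2_add, tr2_mul_const, h0,
    tr2_mul_metric hh (fun a => tr2 h fun b d => T j a b * D d)]
  rw [show (fun a b => T j a m * D b) = fun a b => T j m a * D b by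
    ext a b; rw [(hT.1 j a m).2]]
  ring

theorem contr32_act1 (L : Matrix (Fin 2) (Fin 2) ℝ) (μ : Fin 2 → Fin 2 → Fin 2 → Fin 2 → ℝ)
    (b : Fin 2 → Fin 2 → ℝ) (m : Fin 2) (k : Fin 2) :
    contr32 1 (fun α β γ => act1 L (μ α β γ) m) b k =
      ∑ δ, L m δ * contr32 1 (fun α β γ => μ α β γ δ) b k := by
  simp [contr32, act1, Fin.sum_univ_two, Matrix.one_apply]
  ring

variable {L : Matrix (Fin 2) (Fin 2) ℝ}

theorem divDeriv_act (hL : IsUnit L.det) {T : Fin 2 → Fin 2 → Fin 2 → ℝ}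
    (hT : IsSymmTracefree3 1 T) (M : Fin 2 → Fin 2 → Fin 2 → Fin 2 → ℝ) (B : Fin 2 → Fin 2 → ℝ) :
    divDeriv (L * Lᵀ) (act3 L T) (act4 L M) (act2 L B) = act2 L (divDeriv 1 T M B) := by
  ext j m
  have hT' := (isSymmTracefree3_act hL T).2 hT
  have h1 : ∀ b, 2 / 3 * act1 L (contr32 1 T B) b =
      act1 L (fun k => 2 / 3 * contr32 1 T B k) b := by
    intro b; simp only [act1, Fin.sum_univ_two]; ring
  simp only [divDeriv, contr32_killRhs (posDef_mul_transpose hL) hT', contr32_act hL, act4_fix,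
    act3_eq_act1, h1, tr2_mul_act1 hL,
    show contr32 1 (fun α β γ => act1 L (M α β γ) m) B = _ from
      funext (contr32_act1 L M B m)]
  simp only [act2, act1, divDeriv, contr32_killRhs PosDef.one hT, tr2_one, Fin.sum_univ_two]
  ring

theorem isSymmTracefree3_act4 (hL : IsUnit L.det) {M : Fin 2 → Fin 2 → Fin 2 → Fin 2 → ℝ}
    (hM : ∀ l, IsSymmTracefree3 (L * Lᵀ) fun i j k => act4 L M i j k l) (δ : Fin 2) :
    IsSymmTracefree3 1 fun α β γ => M α β γ δ := by
  have h1 : ∀ l, IsSymmTracefree3 1 fun α β γ => act1 L (M α β γ) l := fun l => by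
    rw [← isSymmTracefree3_act hL, ← act4_fix]; exact hM l
  refine ⟨fun i j k => ⟨?_, ?_⟩, fun k => ?_⟩
  · have : act1 L (M i j k) = act1 L (M j i k) := funext fun l => ((h1 l).1 i j k).1
    exact congrFun (act1_inj hL this) δ
  · have : act1 L (M i j k) = act1 L (M i k j) := funext fun l => ((h1 l).1 i j k).2
    exact congrFun (act1_inj hL this) δ
  · have : act1 L (fun δ => M 0 0 k δ + M 1 1 k δ) = act1 L fun _ => 0 := by
      ext l
      have := (h1 l).2 k
      rw [tr2_one] at this
      simp only [act1, Fin.sum_univ_two] at this ⊢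
      linarith
    rw [tr2_one]
    exact congrFun (act1_inj hL this) δ

/-- The components of `divDeriv` in an orthonormal frame. -/
theorem divDeriv_one {T : Fin 2 → Fin 2 → Fin 2 → ℝ} (hT : IsSymmTracefree3 1 T)
    {M : Fin 2 → Fin 2 → Fin 2 → Fin 2 → ℝ} (hM : ∀ l, IsSymmTracefree3 1 fun i j k => M i j k l)
    {B : Fin 2 → Fin 2 → ℝ} (hB : IsSymmTracefree2 1 B) (m : Fin 2) :
    divDeriv 1 T M B 0 m = 2 / 3 * (2 * (M 0 0 0 m * B 0 0 + M 0 0 1 m * B 0 1)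
      + 4 / 3 * (T 0 0 0 ^ 2 + T 0 0 1 ^ 2) * B 0 m) ∧
    divDeriv 1 T M B 1 m = 2 / 3 * (2 * (M 0 0 1 m * B 0 0 - M 0 0 0 m * B 0 1)
      + 4 / 3 * (T 0 0 0 ^ 2 + T 0 0 1 ^ 2) * B 1 m) := by
  obtain ⟨h1, h2, h3, h4, h5, h6⟩ := hT.comps
  obtain ⟨h7, h8⟩ := hB.comps
  simp only [divDeriv, contr32_killRhs PosDef.one hT, tr2_one, (contr32_one hT hB).1,
    (contr32_one hT hB).2, (contr32_one (hM m) hB).1, (contr32_one (hM m) hB).2]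
  constructor <;> fin_cases m <;> simp [h1, h2, h3, h4, h5, h6, h7, h8] <;> ring

theorem exists_symmTracefree2 (x y : ℝ) :
    ∃ B : Fin 2 → Fin 2 → ℝ, IsSymmTracefree2 1 B ∧ B 0 0 = x ∧ B 0 1 = y := by
  refine ⟨fun i j => !![x, y; y, -x] i j, ⟨fun i j => ?_, ?_⟩, rfl, rfl⟩
  · fin_cases i <;> fin_cases j <;> rfl
  · rw [tr2_one]; simp

/-- If the Ricci identity holds for trace-free conformal Killing tensors with arbitrary value `B` at
a point, then `M = ∇T` is determined by the divergence of `T`, and `R = -(2/9) |T|²`. In an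
orthonormal frame the values `B` with components `(1, 0)` and `(0, 1)` suffice. -/
theorem rhsS_of_ricci (hh : h.PosDef) {T : Fin 2 → Fin 2 → Fin 2 → ℝ}
    (hT : IsSymmTracefree3 h T) {M : Fin 2 → Fin 2 → Fin 2 → Fin 2 → ℝ}
    (hM : ∀ l, IsSymmTracefree3 h fun i j k => M i j k l) {R : ℝ}
    (H : ∀ B, IsSymmTracefree2 h B → ∀ i j l m,
      killRhs h (fun k => divDeriv h T M B k m) i j l - killRhs h
          (fun k => divDeriv h T M B k l) i j m
        = R / 2 * (h i m * B l j - h i l * B m j + (h j m * B i l - h j l * B i m))) :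
    (∀ i j k l, M i j k l = rhsS h (fun i j => tr2 h fun a b => M i j a b) i j k l) ∧
      R = -(2 / 9) * normSq3 h T := by
  obtain ⟨L, hL, rfl⟩ := exists_frame hh
  obtain ⟨T, rfl⟩ := act3_surj hL T
  obtain ⟨M, rfl⟩ := act4_surj hL M
  rw [isSymmTracefree3_act hL] at hT
  have hM := isSymmTracefree3_act4 hL hM
  have H1 : ∀ B, IsSymmTracefree2 1 B → ∀ i j l m,
      killRhs 1 (fun k => divDeriv 1 T M B k m) i j l - killRhs 1
          (fun k => divDeriv 1 T M B k l) i j m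
        = R / 2 * ((1 : Matrix (Fin 2) (Fin 2) ℝ) i m * B l j
          - (1 : Matrix (Fin 2) (Fin 2) ℝ) i l * B m j
          + ((1 : Matrix (Fin 2) (Fin 2) ℝ) j m * B i l
          - (1 : Matrix (Fin 2) (Fin 2) ℝ) j l * B i m)) := by
    intro B hB
    have h0 := H (act2 L B) ((isSymmTracefree2_act hL B).2 hB)
    rw [divDeriv_act hL hT] at h0
    have : act4 L (fun i j l m => killRhs 1 (fun k => divDeriv 1 T M B k m) i j l
        - killRhs 1 (fun k => divDeriv 1 T M B k l) i j m) =
        act4 L fun i j l m => R / 2 * ((1 : Matrix (Fin 2) (Fin 2) ℝ) i m * B l j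
          - (1 : Matrix (Fin 2) (Fin 2) ℝ) i l * B m j
          + ((1 : Matrix (Fin 2) (Fin 2) ℝ) j m * B i l
          - (1 : Matrix (Fin 2) (Fin 2) ℝ) j l * B i m)) := by
      ext i j l m
      have := h0 i j l m
      simp only [killRhs, act2, act4, Fin.sum_univ_two, mul_transpose_apply_two,
        Matrix.one_apply_eq, Matrix.one_apply_ne zero_ne_one,
        Matrix.one_apply_ne one_ne_zero] at this ⊢
      linear_combination this
    intro i j l m
    exact congrFun (congrFun (congrFun (congrFun (act4_inj hL this) i) j) l) m
  obtain ⟨B1, hB1, x1, y1⟩ := exists_symmTracefree2 1 0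
  obtain ⟨B2, hB2, x2, y2⟩ := exists_symmTracefree2 0 1
  have a1 := H1 B1 hB1 0 0 0 1
  have a2 := H1 B2 hB2 0 0 0 1
  have a3 := H1 B1 hB1 0 1 0 1
  simp [killRhs, (divDeriv_one hT hM hB1 _).1, (divDeriv_one hT hM hB1 _).2, x1, y1, hB1.comps.1,
    hB1.comps.2] at a1 a3
  simp [killRhs, (divDeriv_one hT hM hB2 _).1, (divDeriv_one hT hM hB2 _).2, x2, y2,
      hB2.comps.1] at a2
  have r1 : M 0 0 0 1 = - M 0 0 1 0 := by linarith
  have r2 : M 0 0 1 1 = M 0 0 0 0 := by linarith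
  have r3 : R = -(8 / 9) * (T 0 0 0 ^ 2 + T 0 0 1 ^ 2) := by linarith
  refine ⟨?_, by rw [normSq3_act hL, normSq3_one hT, r3]; ring⟩
  have hΞ : (fun i j => tr2 (L * Lᵀ) fun a b => act4 L M i j a b) =
      act2 L fun i j => M i j 0 0 + M i j 1 1 := by
    ext i j
    rw [show (fun a b => act4 L M i j a b) = fun a b => ∑ α, ∑ β, L a α * L b β *
      ∑ μ, ∑ ν, L i μ * L j ν * M μ ν α β by
        ext a b; simp only [act4, Fin.sum_univ_two]; ring, tr2_act hL]
    simp only [act2, Fin.sum_univ_two]; ring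
  rw [hΞ, rhsS_act]
  have : M = rhsS 1 fun i j => M i j 0 0 + M i j 1 1 := by
    obtain ⟨b1, b2, b3, b4, b5, b6⟩ := (hM 0).comps
    obtain ⟨c1, c2, c3, c4, c5, c6⟩ := (hM 1).comps
    ext i j k l
    fin_cases i <;> fin_cases j <;> fin_cases k <;> fin_cases l <;>
      simp [rhsS, young3, b1, b2, b3, b4, b5, b6, c1, c2, c3, c4, c5, c6, r1, r2] <;> ring
  intro i j k l
  rw [← this]

/-- The part of the Bertrand-Darboux condition that multiplies the potential itself determines
`τ`. -/
theorem secondary_of_bertrandDarboux (hh : h.PosDef) {T : Fin 2 → Fin 2 → Fin 2 → ℝ}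
    (hT : IsSymmTracefree3 h T) {Ξ τ : Fin 2 → Fin 2 → ℝ} (hX : IsSymmTracefree2 h Ξ)
    (hτ : IsSymmTracefree2 h τ)
    (hS : ∀ l, IsSymmTracefree3 h fun i j k => rhsS h Ξ i j k l)
    (H : ∀ B, IsSymmTracefree2 h B → ∀ k l,
      (tr2 h fun a b => B k a * τ b l) + 1 / 2 * divDeriv h T (rhsS h Ξ) B k l =
      (tr2 h fun a b => B l a * τ b k) + 1 / 2 * divDeriv h T (rhsS h Ξ) B l k) (i j : Fin 2) :
    τ i j = 1 / 3 * Ξ i j := by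
  obtain ⟨L, hL, rfl⟩ := exists_frame hh
  obtain ⟨T, rfl⟩ := act3_surj hL T
  obtain ⟨Ξ, rfl⟩ := act2_surj hL Ξ
  obtain ⟨τ, rfl⟩ := act2_surj hL τ
  rw [isSymmTracefree3_act hL] at hT
  rw [isSymmTracefree2_act hL] at hX hτ
  simp only [rhsS_act] at H hS
  have hM := isSymmTracefree3_act4 hL hS
  have hm : ∀ A B, ∀ k l, (tr2 (L * Lᵀ) fun a b => act2 L A k a * act2 L B b l) =
      act2 L (fun k l => A k 0 * B 0 l + A k 1 * B 1 l) k l := by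
    intro A B k l
    rw [show (fun a b => act2 L A k a * act2 L B b l) = fun a b => ∑ α, ∑ β, L a α * L b β *
      ((∑ κ, L k κ * A κ α) * (∑ ν, L l ν * B β ν)) by
        ext b d; simp only [act2, Fin.sum_univ_two]; ring, tr2_act hL]
    simp only [act2, Fin.sum_univ_two]; ring
  have H1 : ∀ B, IsSymmTracefree2 1 B → ∀ k l,
      B k 0 * τ 0 l + B k 1 * τ 1 l + 1 / 2 * divDeriv 1 T (rhsS 1 Ξ) B k l =
      B l 0 * τ 0 k + B l 1 * τ 1 k + 1 / 2 * divDeriv 1 T (rhsS 1 Ξ) B l k := by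
    intro B hB
    have h0 := H (act2 L B) ((isSymmTracefree2_act hL B).2 hB)
    simp only [divDeriv_act hL hT, hm] at h0
    have : act2 L (fun k l => B k 0 * τ 0 l + B k 1 * τ 1 l + 1 / 2 * divDeriv 1 T
        (rhsS 1 Ξ) B k l) =
        act2 L fun k l => B l 0 * τ 0 k + B l 1 * τ 1 k
            + 1 / 2 * divDeriv 1 T (rhsS 1 Ξ) B l k := by
      ext k l
      have := h0 k l
      simp only [act2, Fin.sum_univ_two] at this ⊢
      linear_combination this
    intro k l
    exact congrFun (congrFun (act2_inj hL this) k) l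
  obtain ⟨B1, hB1, x1, y1⟩ := exists_symmTracefree2 1 0
  obtain ⟨B2, hB2, x2, y2⟩ := exists_symmTracefree2 0 1
  have a1 := H1 B1 hB1 0 1
  have a2 := H1 B2 hB2 0 1
  simp [(divDeriv_one hT hM hB1 _).1, (divDeriv_one hT hM hB1 _).2, x1, y1, hB1.comps.1,
    hB1.comps.2, rhsS, young3, hX.comps.1, hX.comps.2, hτ.comps.1, hτ.comps.2] at a1
  simp [(divDeriv_one hT hM hB2 _).1, (divDeriv_one hT hM hB2 _).2, x2, y2, hB2.comps.1,
    hB2.comps.2, rhsS, young3, hX.comps.1, hX.comps.2, hτ.comps.1, hτ.comps.2] at a2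
  have r1 : τ 0 1 = 1 / 3 * Ξ 0 1 := by linarith
  have r2 : τ 0 0 = 1 / 3 * Ξ 0 0 := by linarith
  simp only [act2, Fin.sum_univ_two, hτ.comps.1, hτ.comps.2, hX.comps.1, hX.comps.2, r1, r2]
  ring

/-- The Ricci identity for `S` (`H1`) and the symmetry condition on the coefficients of the
prolonged equation of the potentials (`H2`) determine `N = ∇Ξ`. Each gives two equations for the
four components of `N` in an orthonormal frame. -/
theorem rhsXi_of_ricci (hh : h.PosDef) {S N : Fin 2 → Fin 2 → Fin 2 → ℝ} {Ξ : Fin 2 → Fin 2 → ℝ}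
    (hS : IsSymmTracefree3 h S) (hX : IsSymmTracefree2 h Ξ)
    (hN : ∀ k, IsSymmTracefree2 h fun i j => N i j k)
    (H1 : ∀ i j k l m, rhsS h (fun a b => N a b m) i j k l - rhsS h (fun a b => N a b l) i j k m =
      -(2 / 9) * normSq3 h S / 2 * (h i m * S l j k - h i l * S m j k
        + (h j m * S i l k - h j l * S i m k) + (h k m * S i j l - h k l * S i j m)))
    (c : ℝ) (H2 : ∀ k l n,
      (4 / 3 * N k n l + 11 / 9 * contr32 h S Ξ l * h k n)
        + (tr2 h fun a b => (4 / 3 * Ξ k a + c * h k a) * S b l n)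
        + (1 / 3 * (tr2 h fun a b => N a k b) + 1 / 3 * contr32 h S Ξ k) * h l n =
      (4 / 3 * N l n k + 11 / 9 * contr32 h S Ξ k * h l n)
        + (tr2 h fun a b => (4 / 3 * Ξ l a + c * h l a) * S b k n)
        + (1 / 3 * (tr2 h fun a b => N a l b) + 1 / 3 * contr32 h S Ξ l) * h k n) (i j k : Fin 2) :
    N i j k = rhsXi h S Ξ i j k := by
  have hs := metric_symm hh
  have h0 : ∀ k l n, (tr2 h fun a b => (4 / 3 * Ξ k a + c * h k a) * S b l n) =
      4 / 3 * (tr2 h fun a b => S a l n * Ξ b k) + c * S k l n := by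
    intro k l n
    rw [← tr2_const_mul, ← tr2_mul_metric hh (fun a => S a l n) k, ← tr2_const_mul, ← tr2_add,
      ← tr2_swap hh]
    exact tr2_congr fun a b => by rw [hX.1 k b, hs k b]; ring
  simp only [h0] at H2
  obtain ⟨L, hL, rfl⟩ := exists_frame hh
  obtain ⟨S, rfl⟩ := act3_surj hL S
  obtain ⟨N, rfl⟩ := act3_surj hL N
  obtain ⟨Ξ, rfl⟩ := act2_surj hL Ξ
  rw [isSymmTracefree3_act hL] at hS
  rw [isSymmTracefree2_act hL] at hX
  have e := isSymmTracefree2_of_act3 hL hN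
  have e1 : ∀ i j k, N i j k = N j i k := fun i j k => (e k).1 i j
  have e2 : ∀ k, N 0 0 k + N 1 1 k = 0 := fun k => by simpa only [tr2_one] using (e k).2
  simp only [tr2_act3_mul_act2 hL, tr2_act3_outer hL, contr32_act hL, normSq3_act hL] at H1 H2
  have G2 : ∀ k l n, 4 / 3 * N k n l + 11 / 9 * contr32 1 S Ξ l * (1 : Matrix (Fin 2) (Fin 2) ℝ) k n
      + (4 / 3 * (∑ a, S a l n * Ξ a k) + c * S k l n)
      + (1 / 3 * (N 0 k 0 + N 1 k 1) + 1 / 3 * contr32 1 S Ξ k)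
          * (1 : Matrix (Fin 2) (Fin 2) ℝ) l n =
      4 / 3 * N l n k + 11 / 9 * contr32 1 S Ξ k * (1 : Matrix (Fin 2) (Fin 2) ℝ) l n
      + (4 / 3 * (∑ a, S a k n * Ξ a l) + c * S l k n)
      + (1 / 3 * (N 0 l 0 + N 1 l 1) + 1 / 3 * contr32 1 S Ξ l)
          * (1 : Matrix (Fin 2) (Fin 2) ℝ) k n := by
    have : act3 L (fun k l n => 4 / 3 * N k n l
      + 11 / 9 * contr32 1 S Ξ l * (1 : Matrix (Fin 2) (Fin 2) ℝ) k n
      + (4 / 3 * (∑ a, S a l n * Ξ a k) + c * S k l n)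
      + (1 / 3 * (N 0 k 0 + N 1 k 1) + 1 / 3 * contr32 1 S Ξ k)
          * (1 : Matrix (Fin 2) (Fin 2) ℝ) l n) =
      act3 L fun k l n => 4 / 3 * N l n k
      + 11 / 9 * contr32 1 S Ξ k * (1 : Matrix (Fin 2) (Fin 2) ℝ) l n
      + (4 / 3 * (∑ a, S a k n * Ξ a l) + c * S l k n)
      + (1 / 3 * (N 0 l 0 + N 1 l 1) + 1 / 3 * contr32 1 S Ξ l)
        * (1 : Matrix (Fin 2) (Fin 2) ℝ) k n := by
      ext k l n
      have := H2 k l n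
      simp only [act1, act3, Fin.sum_univ_two, mul_transpose_apply_two,
        Matrix.one_apply_eq, Matrix.one_apply_ne zero_ne_one,
        Matrix.one_apply_ne one_ne_zero] at this ⊢
      linear_combination this
    intro k l n
    exact congrFun (congrFun (congrFun (act3_inj hL this) k) l) n
  have G1 : ∀ i j k l m, rhsS 1 (fun a b => N a b m) i j k l - rhsS 1 (fun a b => N a b l) i j k m =
      -(2 / 9) * normSq3 1 S / 2 * ((1 : Matrix (Fin 2) (Fin 2) ℝ) i m * S l j k
        - (1 : Matrix (Fin 2) (Fin 2) ℝ) i l * S m j k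
        + ((1 : Matrix (Fin 2) (Fin 2) ℝ) j m * S i l k - (1 : Matrix (Fin 2) (Fin 2) ℝ) j l
            * S i m k)
        + ((1 : Matrix (Fin 2) (Fin 2) ℝ) k m * S i j l
          - (1 : Matrix (Fin 2) (Fin 2) ℝ) k l * S i j m)) := by
    have : ∀ i j k l, (fun m => act4 L (fun i j k l =>
        rhsS 1 (fun a b => N a b m) i j k l - rhsS 1 (fun a b => N a b l) i j k m) i j k l) =
      fun m => act4 L (fun i j k l =>
        -(2 / 9) * normSq3 1 S / 2 * ((1 : Matrix (Fin 2) (Fin 2) ℝ) i m * S l j k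
        - (1 : Matrix (Fin 2) (Fin 2) ℝ) i l * S m j k
        + ((1 : Matrix (Fin 2) (Fin 2) ℝ) j m * S i l k - (1 : Matrix (Fin 2) (Fin 2) ℝ) j l
            * S i m k)
        + ((1 : Matrix (Fin 2) (Fin 2) ℝ) k m * S i j l
          - (1 : Matrix (Fin 2) (Fin 2) ℝ) k l * S i j m))) i j k l := by
      intro i j k l
      refine act1_inj hL (funext fun m => ?_)
      have := H1 i j k l m
      simp only [rhsS, young3, act1, act3, act4, Fin.sum_univ_two, mul_transpose_apply_two,
        Matrix.one_apply_eq, Matrix.one_apply_ne zero_ne_one,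
        Matrix.one_apply_ne one_ne_zero] at this ⊢
      linear_combination this
    intro i j k l m
    exact congrFun (congrFun (congrFun (congrFun (act4_inj hL (funext fun i => funext fun j =>
      funext fun k => funext fun l => congrFun (this i j k l) m)) i) j) k) l
  obtain ⟨b1, b2, b3, b4, b5, b6⟩ := hS.comps
  have a1 := G2 0 1 0
  have a2 := G2 0 1 1
  have a3 := G1 0 0 0 0 1
  have a4 := G1 0 0 1 0 1
  simp [rhsS, young3, e1 1 0, hX.comps.1, hX.comps.2, b1, b2, b3, b4, b5, b6, (contr32_one hS hX).1,
    (contr32_one hS hX).2, normSq3_one hS] at a1 a2 a3 a4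
  have c0 := e2 0
  have c1 := e2 1
  have : N = rhsXi 1 S Ξ := by
    ext i j k
    rw [rhsXi_eq PosDef.one]
    fin_cases i <;> fin_cases j <;> fin_cases k <;>
      simp [e1 1 0, b1, b2, b3, b4, b5, b6,
        (contr32_one hS hX).1, (contr32_one hS hX).2, normSq3_one hS] <;> linarith
  rw [rhsXi_act hL, ← this]

end

/-! ### Prolongation of the equation of the potentials -/

section

open Matrix

/-- The Laplacian `ΔV = gⁱʲ V,ᵢⱼ` of a function in a chart. -/
noncomputable def lapl (G : E2 → Matrix (Fin 2) (Fin 2) ℝ) (u : E2 → ℝ) (x : E2) : ℝ :=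
  tr2 (G x) (hess G u x)

/-- The function `u` satisfies, over `Ω`, the equation
`u,ᵢⱼ = Tᵢⱼᵏ u,ₖ + (1/2) gᵢⱼ Δu + τᵢⱼ u` of the potentials. -/
structure IsPotentialOn (G : E2 → Matrix (Fin 2) (Fin 2) ℝ) (T : E2 → Fin 2 → Fin 2 → Fin 2 → ℝ)
    (τ : E2 → Fin 2 → Fin 2 → ℝ) (Ω : Set E2) (u : E2 → ℝ) : Prop where
  smooth : ContDiffOn ℝ ∞ u Ω
  hess_eq : ∀ x ∈ Ω, ∀ i j, hess G u x i j =
    (tr2 (G x) fun a b => T x i j a * pd b u x) + 1 / 2 * G x i j * lapl G u x + τ x i j * u x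

variable {G : E2 → Matrix (Fin 2) (Fin 2) ℝ} {Ω : Set E2} {x : E2}

namespace MetricOn

theorem smooth_hess (hG : MetricOn G Ω) {u : E2 → ℝ} (hu : ContDiffOn ℝ ∞ u Ω) (i j : Fin 2) :
    ContDiffOn ℝ ∞ (fun y => hess G u y i j) Ω :=
  hG.smooth_cov1 (fun i => contDiffOn_pd hG.isOpen hu i) i j

theorem smooth_lapl (hG : MetricOn G Ω) {u : E2 → ℝ} (hu : ContDiffOn ℝ ∞ u Ω) :
    ContDiffOn ℝ ∞ (lapl G u) Ω :=
  hG.smooth_tr2 fun i j => hG.smooth_hess hu i j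

theorem pd_lapl (hG : MetricOn G Ω) (hx : x ∈ Ω) {u : E2 → ℝ} (hu : ContDiffOn ℝ ∞ u Ω)
    (k : Fin 2) :
    pd k (lapl G u) x = tr2 (G x) fun a b => cov2 G (hess G u) x a b k :=
  hG.pd_tr2 hx (fun i j => hG.smooth_hess hu i j) k

/-- The covariant derivative of the one-form `Aₖᵐ u,ₘ + Dₖ u`. -/
theorem cov1_contract (hG : MetricOn G Ω) (hx : x ∈ Ω) {A : E2 → Fin 2 → Fin 2 → ℝ}
    {D : E2 → Fin 2 → ℝ} {u : E2 → ℝ} (hA : ∀ i j, ContDiffOn ℝ ∞ (fun y => A y i j) Ω)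
    (hD : ∀ i, ContDiffOn ℝ ∞ (fun y => D y i) Ω) (hu : ContDiffOn ℝ ∞ u Ω) (k l : Fin 2) :
    cov1 G (fun y k => (tr2 (G y) fun a b => A y k a * pd b u y) + D y k * u y) x k l =
      (tr2 (G x) fun a b => cov2 G A x k a l * pd b u x)
        + (tr2 (G x) fun a b => A x k a * hess G u x b l) + cov1 G D x k l * u x
        + D x k * pd l u x := by
  have hp := fun b => contDiffOn_pd hG.isOpen hu b
  have h1 := fun a b => (hA k a).mul (hp b)
  have h2 := hG.smooth_tr2 (A := fun y a b => A y k a * pd b u y) h1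
  unfold cov1
  rw [pd_add l (hG.diff hx h2) (hG.diff hx ((hD k).mul hu)),
    hG.pd_tr2 hx (A := fun y a b => A y k a * pd b u y) h1, pd_mul l (hG.diff hx (hD k))
      (hG.diff hx hu)]
  simp only [cov2, hess, cov1, pd_mul l (hG.diff hx (hA _ _)) (hG.diff hx (hp _))]
  simp only [tr2, Fin.sum_univ_two]
  ring

end MetricOn

variable {T : E2 → Fin 2 → Fin 2 → Fin 2 → ℝ} {τ : E2 → Fin 2 → Fin 2 → ℝ} {u : E2 → ℝ}

/-- The covariant derivative of the equation of the potentials. -/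
theorem IsPotentialOn.cov2_hess (hu : IsPotentialOn G T τ Ω u) (hG : MetricOn G Ω) (hx : x ∈ Ω)
    (hT : ∀ i j k, ContDiffOn ℝ ∞ (fun y => T y i j k) Ω)
    (hτ : ∀ i j, ContDiffOn ℝ ∞ (fun y => τ y i j) Ω) (i j k : Fin 2) :
    cov2 G (hess G u) x i j k = (tr2 (G x) fun a b => cov3 G T x i j a k * pd b u x)
      + (tr2 (G x) fun a b => T x i j a * hess G u x b k) + 1 / 2 * G x i j * pd k (lapl G u) x
      + cov2 G τ x i j k * u x + τ x i j * pd k u x := by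
  have hp := fun b => contDiffOn_pd hG.isOpen hu.smooth b
  have h1 := fun a b => (hT i j a).mul (hp b)
  have h2 := hG.smooth_tr2 (A := fun y a b => T y i j a * pd b u y) h1
  have hl := hG.smooth_lapl hu.smooth
  have h3 := contDiffOn_const (c := (1 / 2 : ℝ)) |>.mul (hG.smooth i j)
  rw [MetricOn.cov2_congr hG.isOpen hx hu.hess_eq]
  unfold cov2
  rw [pd_add k (hG.diff hx (h2.add (h3.mul hl))) (hG.diff hx ((hτ i j).mul hu.smooth)),
    pd_add k (hG.diff hx h2) (hG.diff hx (h3.mul hl)),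
    hG.pd_tr2 hx (A := fun y a b => T y i j a * pd b u y) h1, pd_mul k (hG.diff hx (hτ i j))
      (hG.diff hx hu.smooth), pd_mul k (hG.diff hx h3) (hG.diff hx hl),
    pd_const_mul k _ (hG.diff hx (hG.smooth i j)), hG.pd_metric hx]
  simp only [cov2, hess, cov1, pd_mul k (hG.diff hx (hT _ _ _)) (hG.diff hx (hp _)), cov3]
  simp only [tr2, Fin.sum_univ_two]
  ring

theorem tr2_tr2_comm (h : Matrix (Fin 2) (Fin 2) ℝ) (A : Fin 2 → Fin 2 → Fin 2 → Fin 2 → ℝ) :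
    (tr2 h fun a b => tr2 h fun c d => A a b c d) =
        tr2 h fun c d => tr2 h fun a b => A a b c d := by
  simp only [tr2, Fin.sum_univ_two]; ring

/-- The prolongation of the equation of the potentials: `(1/2) (Δu),ₖ = qₖᵐ u,ₘ + γₖ u`. It is the
divergence of that equation, with `∇ⁱ u,ᵢₖ` rewritten as `(Δu),ₖ + (R/2) u,ₖ` by the Ricci identity.
-/
theorem IsPotentialOn.pd_lapl (hu : IsPotentialOn G T τ Ω u) (hG : MetricOn G Ω) (hx : x ∈ Ω)
    (hT : ∀ i j k, ContDiffOn ℝ ∞ (fun y => T y i j k) Ω)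
    (hTs : ∀ y ∈ Ω, IsSymmTracefree3 (G y) (T y))
    (hτ : ∀ i j, ContDiffOn ℝ ∞ (fun y => τ y i j) Ω)
    (hτs : ∀ y ∈ Ω, IsSymmTracefree2 (G y) (τ y)) (k : Fin 2) :
    pd k (lapl G u) x = 2 * ((tr2 (G x) fun a b => smallQ G T τ x k a * pd b u x)
      + smallGamma G T τ x k * u x) := by
  have hh := hG.posDef x hx
  have hTx := hTs x hx
  have hτx := hτs x hx
  have hM := fun l => hG.cov3_symmTracefree hx hT hTs l
  have hN := fun l => hG.cov2_symmTracefree hx hτ hτs l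
  set X := fun i j k => cov2 G (hess G u) x i j k with hX
  -- the two contractions of the third derivative differ by a curvature term
  have h1 : (tr2 (G x) fun i l => X i k l) - pd k (lapl G u) x =
      scalarCurv G x / 2 * pd k u x := by
    rw [hG.pd_lapl hx hu.smooth, ← tr2_sub]
    have : ∀ i l, X i k l - cov2 G (hess G u) x i l k = scalarCurv G x / 2 *
        (G x i l * pd k u x - G x i k * pd l u x) := fun i l =>
      hG.ricci1 hx (fun i => contDiffOn_pd hG.isOpen hu.smooth i) i k l
    rw [tr2_congr this, tr2_const_mul, tr2_sub, tr2_metric_mul_const hh, tr2_metric_mul hh]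
    ring
  -- the divergence of the right hand side
  have e1 : (tr2 (G x) fun i l => tr2 (G x) fun a b => cov3 G T x i k a l * pd b u x) =
      tr2 (G x) fun a b => div3 G T x k a * pd b u x := by
    rw [tr2_tr2_comm]
    refine tr2_congr fun a b => ?_
    rw [tr2_mul_const, div3]
    congr 1
    exact tr2_congr fun i l => ((hM l).1 i k a).1.trans ((hM l).1 k i a).2
  have e2 : (tr2 (G x) fun i l => tr2 (G x) fun a b => T x i k a * hess G u x b l) =
      1 / 2 * normSq3 (G x) (T x) * pd k u x + contr32 (G x) (T x) (τ x) k * u x := by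
    have : ∀ i l, (tr2 (G x) fun a b => T x i k a * hess G u x b l) =
        ((tr2 (G x) fun c d => (tr2 (G x) fun a b => T x i k a * T x b l c) * pd d u x)
          + T x i l k * (1 / 2 * lapl G u x))
              + (tr2 (G x) fun a b => T x i k a * τ x b l) * u x := by
      intro i l
      have f1 : (fun a b => T x i k a * hess G u x b l) = fun a b =>
          ((tr2 (G x) fun c d => (T x i k a * T x b l c) * pd d u x)
          + (T x i k a * G x b l) * (1 / 2 * lapl G u x)) + (T x i k a * τ x b l) * u x := by
        ext a b
        rw [hu.hess_eq x hx, ← tr2_mul_metric hh (fun a => 1) b]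
        have : (tr2 (G x) fun c d => T x i k a * T x b l c * pd d u x) =
          T x i k a * tr2 (G x) fun c d => T x b l c * pd d u x := by
            rw [← tr2_const_mul]; exact tr2_congr fun c d => by ring
        rw [this]; ring
      rw [f1, tr2_add, tr2_add, tr2_mul_const, tr2_mul_const, tr2_mul_metric hh
          (fun a => T x i k a),
        tr2_tr2_comm, (hTx.1 i k l).2]
      congr 2
      exact tr2_congr fun c d => tr2_mul_const _ _ _
    rw [tr2_congr this, tr2_add, tr2_add, tr2_mul_const, hTx.2, tr2_mul_const,
      contr32_eq_of_symm hTx hτx, tr2_tr2_comm]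
    have f2 : ∀ c d, (tr2 (G x) fun i l => (tr2 (G x) fun a b => T x i k a * T x b l c)
        * pd d u x) =
        1 / 2 * normSq3 (G x) (T x) * (G x c k * pd d u x) := by
      intro c d
      rw [tr2_mul_const, tr2_tr2_mul_self hh hTx, hG.symm hx k c]; ring
    rw [tr2_congr f2, tr2_const_mul, tr2_metric_mul hh]
    ring
  have h2 : (tr2 (G x) fun i l => X i k l) =
      (tr2 (G x) fun a b => div3 G T x k a * pd b u x)
      + (1 / 2 * normSq3 (G x) (T x) * pd k u x + contr32 (G x) (T x) (τ x) k * u x)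
      + 1 / 2 * pd k (lapl G u) x
      + (tr2 (G x) fun a b => cov2 G τ x a k b) * u x
      + (tr2 (G x) fun a b => τ x k a * pd b u x) := by
    have f3 : (tr2 (G x) fun i l => 1 / 2 * G x i k * pd l (lapl G u) x) =
        1 / 2 * pd k (lapl G u) x := by
      rw [← tr2_metric_mul hh (fun l => pd l (lapl G u) x) k, ← tr2_const_mul]
      exact tr2_congr fun a b => by ring
    have f4 : (tr2 (G x) fun i l => τ x i k * pd l u x) = tr2 (G x) fun a b => τ x k a * pd b u x :=
      tr2_congr fun a b => by rw [hτx.1 a k]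
    rw [tr2_congr fun i l => hu.cov2_hess hG hx hT hτ i k l, tr2_add, tr2_add, tr2_add, tr2_add, e1,
      e2, tr2_mul_const, f3, f4]
  have h3 : (tr2 (G x) fun a b => smallQ G T τ x k a * pd b u x) =
      (tr2 (G x) fun a b => div3 G T x k a * pd b u x)
      + 1 / 2 * (normSq3 (G x) (T x) - scalarCurv G x) * pd k u x
      + (tr2 (G x) fun a b => τ x k a * pd b u x) := by
    rw [← tr2_metric_mul hh (fun b => pd b u x) k, ← tr2_const_mul, ← tr2_add, ← tr2_add]
    exact tr2_congr fun a b => by rw [hG.smallQ_eq hx hT hTs hτx, hG.symm hx k a]; ring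
  rw [h3, MetricOn.smallGamma_eq hTx hτx]
  linarith

/-- If, for all solutions `u` of the equation of the potentials with given value, gradient and
Laplacian at `x`, the one-form `Aₖᵐ u,ₘ + Dₖ u` is closed near `x`, its coefficients satisfy two
symmetry conditions at `x`. -/
theorem closed_coefficients (hG : MetricOn G Ω) (hx : x ∈ Ω) {A : E2 → Fin 2 → Fin 2 → ℝ}
    {D : E2 → Fin 2 → ℝ} (hA : ∀ i j, ContDiffOn ℝ ∞ (fun y => A y i j) Ω)
    (hD : ∀ i, ContDiffOn ℝ ∞ (fun y => D y i) Ω)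
    (H : ∀ (a d : ℝ) (b : Fin 2 → ℝ), ∃ u, IsPotentialOn G T τ Ω u ∧ u x = a ∧
        (∀ i, pd i u x = b i) ∧
      lapl G u x = d ∧ ∀ k l,
      pd l (fun y => (tr2 (G y) fun a b => A y k a * pd b u y) + D y k * u y) x =
      pd k (fun y => (tr2 (G y) fun a b => A y l a * pd b u y) + D y l * u y) x) :
    (∀ k l n, cov2 G A x k n l + (tr2 (G x) fun a b => A x k a * T x b l n) + D x k * G x l n =
      cov2 G A x l n k + (tr2 (G x) fun a b => A x l a * T x b k n) + D x l * G x k n) ∧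
    ∀ k l, (tr2 (G x) fun a b => A x k a * τ x b l) + cov1 G D x k l =
      (tr2 (G x) fun a b => A x l a * τ x b k) + cov1 G D x l k := by
  have hh := hG.posDef x hx
  have key : ∀ u, IsPotentialOn G T τ Ω u → (∀ k l,
      pd l (fun y => (tr2 (G y) fun a b => A y k a * pd b u y) + D y k * u y) x =
      pd k (fun y => (tr2 (G y) fun a b => A y l a * pd b u y) + D y l * u y) x) → ∀ k l,
      (tr2 (G x) fun a b => cov2 G A x k a l * pd b u x)
        + (tr2 (G x) fun a b => A x k a * hess G u x b l) + cov1 G D x k l * u x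
        + D x k * pd l u x =
      (tr2 (G x) fun a b => cov2 G A x l a k * pd b u x)
        + (tr2 (G x) fun a b => A x l a * hess G u x b k) + cov1 G D x l k * u x
        + D x l * pd k u x := by
    intro u hu hc k l
    rw [← hG.cov1_contract hx hA hD hu.smooth, ← hG.cov1_contract hx hA hD hu.smooth]
    unfold cov1
    simp only [hG.christoffel_symm hx _ k l]
    rw [hc k l]
  constructor
  -- the potential with `u x = 0`, `Δu x = 0` and gradient dual to `∂ₙ`
  · intro k l n
    obtain ⟨u, hu, h0, h1, h2, h3⟩ := H 0 0 (fun i => G x i n)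
    have h4 := key u hu h3 k l
    have e1 : ∀ k l, (tr2 (G x) fun a b => cov2 G A x k a l * pd b u x) = cov2 G A x k n l := by
      intro k l
      simp only [h1]
      rw [tr2_mul_metric hh (fun a => cov2 G A x k a l)]
    have e2 : ∀ i j, hess G u x i j = T x i j n := by
      intro i j
      rw [hu.hess_eq x hx, h0, h2]
      simp only [h1]
      rw [tr2_mul_metric hh (fun a => T x i j a)]; ring
    rw [e1, e1] at h4
    simp only [e2, h0, h1] at h4
    linarith
  -- the potential with `u x = 1` and vanishing gradient and Laplacian
  · intro k l
    obtain ⟨u, hu, h0, h1, h2, h3⟩ := H 1 0 (fun i => 0)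
    have h4 := key u hu h3 k l
    have e2 : ∀ i j, hess G u x i j = τ x i j := by
      intro i j
      rw [hu.hess_eq x hx, h0, h2]
      simp only [h1]
      simp [tr2]
    simp only [e2, h0, h1] at h4
    simp only [mul_zero, mul_one, add_zero] at h4
    simpa [tr2] using h4

end

/-! ### Unique continuation of potentials -/

section

open Matrix Filter Topology

theorem fderiv_apply_eq_sum_pd (f : E2 → ℝ) (y v : E2) : fderiv ℝ f y v = ∑ k, v k * pd k f y := by
  conv_lhs => rw [ee_sum v]
  simp [pd, Fin.sum_univ_two]

/-- Unique continuation: solutions of a closed first order linear system that vanish at a point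
vanish near that point. Along the segment from `x` the solution satisfies a linear ordinary
differential equation, so Grönwall's inequality applies. -/
theorem eventually_eq_zero_of_pd_eq_linear {n : ℕ} {Ω : Set E2} {x : E2} (hΩ : IsOpen Ω)
    (hx : x ∈ Ω) {w : Fin n → E2 → ℝ} {A : Fin 2 → Fin n → Fin n → E2 → ℝ}
    (hw : ∀ i, DifferentiableOn ℝ (w i) Ω) (hA : ∀ k i j, ContinuousOn (A k i j) Ω)
    (h : ∀ y ∈ Ω, ∀ k i, pd k (w i) y = ∑ j, A k i j y * w j y) (h0 : ∀ i, w i x = 0) :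
    ∀ᶠ y in 𝓝 x, ∀ i, w i y = 0 := by
  obtain ⟨ε, hε, hb⟩ := Metric.nhds_basis_closedBall.mem_iff.1 (hΩ.mem_nhds hx)
  have hcont : ContinuousOn (fun y => ∑ k, ∑ i, ∑ j, |A k i j y|) (Metric.closedBall x ε) := by
    have := fun k i j => ((hA k i j).mono hb).abs
    fun_prop
  -- a bound for the coefficients on a compact ball
  obtain ⟨K, hK⟩ := (isCompact_closedBall x ε).exists_bound_of_continuousOn hcont
  have hK' : ∀ y ∈ Metric.closedBall x ε, ∀ i, ∑ k, ∑ j, |A k i j y| ≤ K := fun y hy i => by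
    refine le_trans ?_ ((le_abs_self _).trans (hK y hy))
    rw [Finset.sum_comm]
    simp_rw [Finset.sum_comm (s := (Finset.univ : Finset (Fin 2)))]
    exact Finset.single_le_sum (f := fun i => ∑ j, ∑ k, |A k i j y|)
      (fun _ _ => by positivity) (Finset.mem_univ i)
  filter_upwards [Metric.closedBall_mem_nhds x hε] with y hy
  have hγ : ∀ t ∈ Set.Icc (0 : ℝ) 1, x + t • (y - x) ∈ Metric.closedBall x ε := fun t ht => by
    rw [Metric.mem_closedBall, dist_eq_norm] at hy ⊢
    rw [add_sub_cancel_left, norm_smul, Real.norm_of_nonneg ht.1]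
    exact (mul_le_of_le_one_left (norm_nonneg _) ht.2).trans hy
  have hd : ∀ t ∈ Set.Icc (0 : ℝ) 1, HasDerivAt (fun t : ℝ => fun i => w i (x + t • (y - x)))
      (fun i => ∑ k, (y - x) k * ∑ j, A k i j (x + t • (y - x)) * w j (x + t • (y - x))) t := by
    intro t ht
    refine hasDerivAt_pi.2 fun i => ?_
    have hm := hb (hγ t ht)
    have h1 : HasDerivAt (fun t : ℝ => x + t • (y - x)) (y - x) t := by
      simpa using ((hasDerivAt_id t).smul_const (y - x)).const_add x
    have h2 := (((hw i).differentiableAt (hΩ.mem_nhds hm)).hasFDerivAt).comp_hasDerivAt t h1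
    rw [fderiv_apply_eq_sum_pd] at h2
    simp only [h _ hm] at h2
    exact h2
  have key := eq_zero_of_abs_deriv_le_mul_abs_self_of_eq_zero_right (K := ε * K)
    (fun t ht => (hd t ht).continuousAt.continuousWithinAt)
    (fun t ht => (hd t (Set.Ico_subset_Icc_self ht)).hasDerivWithinAt)
    (by ext i; simp [h0]) (fun t ht => ?_) 1 (by simp)
  · intro i
    have := congrFun key i
    simpa using this
  · have hm := hγ t (Set.Ico_subset_Icc_self ht)
    have hK0 : 0 ≤ K := (norm_nonneg _).trans (hK _ hm)
    refine (pi_norm_le_iff_of_nonneg (by positivity)).2 fun i => ?_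
    set z := x + t • (y - x)
    rw [Real.norm_eq_abs]
    calc |∑ k, (y - x) k * ∑ j, A k i j z * w j z|
        ≤ ∑ k, ε * ∑ j, |A k i j z| * ‖fun i => w i z‖ := by
          refine (Finset.abs_sum_le_sum_abs _ _).trans (Finset.sum_le_sum fun k _ => ?_)
          rw [abs_mul]
          refine mul_le_mul ?_ ?_ (abs_nonneg _) hε.le
          · have := PiLp.norm_apply_le (y - x) k
            rw [Metric.mem_closedBall, dist_eq_norm] at hy
            exact this.trans hy
          · refine (Finset.abs_sum_le_sum_abs _ _).trans (Finset.sum_le_sum fun j _ => ?_)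
            rw [abs_mul]
            gcongr
            exact norm_le_pi_norm (fun i => w i z) j
      _ = ε * (∑ k, ∑ j, |A k i j z|) * ‖fun i => w i z‖ := by
          simp_rw [Finset.mul_sum, Finset.sum_mul, mul_assoc]
      _ ≤ ε * K * ‖fun i => w i z‖ := by
          gcongr
          exact hK' z hm i

variable {G : E2 → Matrix (Fin 2) (Fin 2) ℝ} {Ω : Set E2} {x : E2}
  {T : E2 → Fin 2 → Fin 2 → Fin 2 → ℝ} {τ : E2 → Fin 2 → Fin 2 → ℝ} {u : E2 → ℝ}

namespace MetricOn

theorem smooth_riem (hG : MetricOn G Ω) (l k i j : Fin 2) :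
    ContDiffOn ℝ ∞ (fun y => riem G y l k i j) Ω := by
  have h1 := hG.smooth_christoffel
  have h2 := fun a b c d => contDiffOn_pd hG.isOpen (h1 a b c) d
  refine ((h2 l j k i).sub (h2 l i k j)).add (ContDiffOn.sum fun a _ => ?_)
  exact ((h1 l i a).mul (h1 a j k)).sub ((h1 l j a).mul (h1 a i k))

theorem smooth_scalarCurv (hG : MetricOn G Ω) : ContDiffOn ℝ ∞ (scalarCurv G) Ω :=
  ContDiffOn.sum fun k _ => ContDiffOn.sum fun j _ => (hG.smooth_inv k j).mul
    (ContDiffOn.sum fun i _ => hG.smooth_riem i k i j)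

theorem smooth_div3 (hG : MetricOn G Ω) (hT : ∀ i j k, ContDiffOn ℝ ∞ (fun y => T y i j k) Ω)
    (i j : Fin 2) : ContDiffOn ℝ ∞ (fun y => div3 G T y i j) Ω :=
  hG.smooth_tr2 fun a b => hG.smooth_cov3 hT i j a b

theorem smooth_smallQ (hG : MetricOn G Ω) (hT : ∀ i j k, ContDiffOn ℝ ∞ (fun y => T y i j k) Ω)
    (hτ : ∀ i j, ContDiffOn ℝ ∞ (fun y => τ y i j) Ω) (j m : Fin 2) :
    ContDiffOn ℝ ∞ (fun y => smallQ G T τ y j m) Ω := by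
  refine hG.smooth_tr2 fun i k => ?_
  have h1 := hG.smooth_tr2 (A := fun y a b => T y i j a * T y b k m) fun a b =>
    (hT i j a).mul (hT b k m)
  have h2 : ContDiffOn ℝ ∞ (fun y => curv (G y) (scalarCurv G y) i j k m) Ω :=
    (hG.smooth_scalarCurv.div_const 2).mul
      (((hG.smooth i k).mul (hG.smooth j m)).sub ((hG.smooth i m).mul (hG.smooth j k)))
  exact (((hG.smooth_cov3 hT i j m k).add h1).sub h2).add ((hτ i j).mul (hG.smooth k m))

theorem smooth_smallGamma (hG : MetricOn G Ω)
    (hT : ∀ i j k, ContDiffOn ℝ ∞ (fun y => T y i j k) Ω)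
    (hτ : ∀ i j, ContDiffOn ℝ ∞ (fun y => τ y i j) Ω) (k : Fin 2) :
    ContDiffOn ℝ ∞ (fun y => smallGamma G T τ y k) Ω := by
  refine hG.smooth_tr2 fun c d => (hG.smooth_cov2 hτ c k d).add ?_
  exact hG.smooth_tr2 (A := fun y a b => T y c k a * τ y b d) fun a b => (hT c k a).mul (hτ b d)

end MetricOn

/-- A solution of the equation of the potentials whose value, gradient and Laplacian vanish at a
point vanishes near that point. -/
theorem IsPotentialOn.eventually_eq_zero (hu : IsPotentialOn G T τ Ω u) (hG : MetricOn G Ω)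
    (hx : x ∈ Ω) (hT : ∀ i j k, ContDiffOn ℝ ∞ (fun y => T y i j k) Ω)
    (hTs : ∀ y ∈ Ω, IsSymmTracefree3 (G y) (T y))
    (hτ : ∀ i j, ContDiffOn ℝ ∞ (fun y => τ y i j) Ω)
    (hτs : ∀ y ∈ Ω, IsSymmTracefree2 (G y) (τ y))
    (h0 : u x = 0) (h1 : ∀ i, pd i u x = 0) (h2 : lapl G u x = 0) : ∀ᶠ y in 𝓝 x, u y = 0 := by
  -- the raised components of a one-form
  let up : (E2 → Fin 2 → ℝ) → Fin 2 → E2 → ℝ := fun θ b y => ∑ a, (G y)⁻¹ a b * θ y a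
  have hup : ∀ (θ : E2 → Fin 2 → ℝ) y, (tr2 (G y) fun a b => θ y a * pd b u y) =
      up θ 0 y * pd 0 u y + up θ 1 y * pd 1 u y := fun θ y => by
    simp [up, tr2, Fin.sum_univ_two]; ring
  have sup : ∀ {θ : E2 → Fin 2 → ℝ}, (∀ i, ContDiffOn ℝ ∞ (fun y => θ y i) Ω) → ∀ b,
      ContinuousOn (up θ b) Ω := fun hθ b =>
    (ContDiffOn.sum fun a _ => (hG.smooth_inv a b).mul (hθ a) : ContDiffOn ℝ ∞ _ Ω).continuousOn
  have hp := fun b => contDiffOn_pd hG.isOpen hu.smooth b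
  -- the closed linear system for `(u, ∂₀u, ∂₁u, Δu)`
  let A : Fin 2 → Fin 4 → Fin 4 → E2 → ℝ := fun k => ![
    ![fun _ => 0, fun _ => if k = 0 then 1 else 0, fun _ => if k = 1 then 1 else 0, fun _ => 0],
    ![fun y => τ y 0 k, fun y => up (fun y a => T y 0 k a) 0 y + christoffel G y 0 k 0,
      fun y => up (fun y a => T y 0 k a) 1 y + christoffel G y 1 k 0, fun y => 1 / 2 * G y 0 k],
    ![fun y => τ y 1 k, fun y => up (fun y a => T y 1 k a) 0 y + christoffel G y 0 k 1,
      fun y => up (fun y a => T y 1 k a) 1 y + christoffel G y 1 k 1, fun y => 1 / 2 * G y 1 k],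
    ![fun y => 2 * smallGamma G T τ y k, fun y => 2 * up (fun y a => smallQ G T τ y k a) 0 y,
      fun y => 2 * up (fun y a => smallQ G T τ y k a) 1 y, fun _ => 0]]
  have key := eventually_eq_zero_of_pd_eq_linear hG.isOpen hx
    (w := ![u, pd 0 u, pd 1 u, lapl G u]) (A := A) ?_ ?_ ?_ ?_
  · filter_upwards [key] with y hy using hy 0
  · intro i
    fin_cases i
    exacts [hu.smooth.differentiableOn (by simp), (hp 0).differentiableOn (by simp),
      (hp 1).differentiableOn (by simp), (hG.smooth_lapl hu.smooth).differentiableOn (by simp)]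
  · intro k i j
    have e1 : ∀ i b, ContinuousOn (fun y => up (fun y a => T y i k a) b y
        + christoffel G y b k i) Ω :=
      fun i b => (sup (fun a => hT i k a) b).add (hG.smooth_christoffel b k i).continuousOn
    have e2 := fun b => (continuousOn_const (c := (2 : ℝ))).mul
      (sup (fun a => hG.smooth_smallQ hT hτ k a) b)
    have e3 := (continuousOn_const (c := (2 : ℝ))).mul (hG.smooth_smallGamma hT hτ k).continuousOn
    have e4 := fun i => (continuousOn_const (c := (1 / 2 : ℝ))).mul (hG.smooth i k).continuousOn
    have e5 := fun i => (hτ i k).continuousOn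
    have e6 : ∀ c : ℝ, ContinuousOn (fun _ : E2 => c) Ω := fun c => continuousOn_const
    fin_cases i <;> fin_cases j
    exacts [e6 _, e6 _, e6 _, e6 _, e5 0, e1 0 0, e1 0 1, e4 0, e5 1, e1 1 0, e1 1 1, e4 1, e3,
        e2 0,
      e2 1, e6 _]
  · intro y hy k i
    have hh : ∀ i, pd k (pd i u) y = hess G u y i k + ∑ a, christoffel G y a k i * pd a u y :=
      fun i => by simp [hess, cov1]
    have hk := hup (fun y a => smallQ G T τ y k a) y
    have hi := fun i => hup (fun y a => T y i k a) y
    have h2 := hu.hess_eq y hy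
    have h3 := hu.pd_lapl hG hy hT hTs hτ hτs k
    fin_cases i
    · fin_cases k <;> simp [A, Fin.sum_univ_four]
    · change pd k (pd 0 u) y = _
      rw [hh, h2, hi 0]
      simp [A, Fin.sum_univ_four, Fin.sum_univ_two]; ring
    · change pd k (pd 1 u) y = _
      rw [hh, h2, hi 1]
      simp [A, Fin.sum_univ_four, Fin.sum_univ_two]; ring
    · change pd k (lapl G u) y = _
      rw [h3, hk]
      simp [A, Fin.sum_univ_four]; ring
  · intro i
    fin_cases i
    exacts [h0, h1 0, h1 1, h2]

end

/-! ### Jets of potentials -/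

section

open Matrix Filter Topology

theorem pd_eventuallyEq {u v : E2 → ℝ} {y : E2} (h : u =ᶠ[𝓝 y] v) (i : Fin 2) :
    pd i u =ᶠ[𝓝 y] pd i v := by
  filter_upwards [h.fderiv (𝕜 := ℝ)] with z hz
  rw [pd, pd, hz]

theorem lapl_congr_of_eventuallyEq {G : E2 → Matrix (Fin 2) (Fin 2) ℝ} {u v : E2 → ℝ} {y : E2}
    (h : u =ᶠ[𝓝 y] v) : lapl G u y = lapl G v y := by
  refine tr2_congr fun i j => ?_
  have h1 := (pd_eventuallyEq (pd_eventuallyEq h i) j).eq_of_nhds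
  have h2 := fun a => (pd_eventuallyEq h a).eq_of_nhds
  simp only [hess, cov1, h2]
  rw [← h1]

section Linear

variable {G : E2 → Matrix (Fin 2) (Fin 2) ℝ} {Ω : Set E2} {x : E2} {u v : E2 → ℝ}

theorem MetricOn.lapl_add (hG : MetricOn G Ω) (hx : x ∈ Ω) (hu : ContDiffOn ℝ ∞ u Ω)
    (hv : ContDiffOn ℝ ∞ v Ω) : lapl G (u + v) x = lapl G u x + lapl G v x := by
  rw [lapl, lapl, lapl, ← tr2_add]
  refine tr2_congr fun i j => ?_
  have h1 : ∀ y ∈ Ω, ∀ i, pd i (u + v) y = pd i u y + pd i v y := fun y hy i =>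
    pd_add i (hG.diff hy hu) (hG.diff hy hv)
  have hp := fun i => contDiffOn_pd hG.isOpen hu i
  have hq := fun i => contDiffOn_pd hG.isOpen hv i
  simp only [hess, cov1, h1 x hx]
  rw [pd_congr hG.isOpen hx j (fun y hy => h1 y hy i), pd_add j (hG.diff hx (hp i))
      (hG.diff hx (hq i))]
  simp only [Fin.sum_univ_two]; ring

theorem MetricOn.lapl_const_smul (hG : MetricOn G Ω) (hx : x ∈ Ω) (hu : ContDiffOn ℝ ∞ u Ω)
    (c : ℝ) : lapl G (c • u) x = c * lapl G u x := by
  rw [lapl, lapl, ← tr2_const_mul]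
  refine tr2_congr fun i j => ?_
  have h1 : ∀ y ∈ Ω, ∀ i, pd i (c • u) y = c * pd i u y := fun y hy i =>
    pd_const_mul i c (hG.diff hy hu)
  have hp := fun i => contDiffOn_pd hG.isOpen hu i
  simp only [hess, cov1, h1 x hx]
  rw [pd_congr hG.isOpen hx j (fun y hy => h1 y hy i), pd_const_mul j c (hG.diff hx (hp i))]
  simp only [Fin.sum_univ_two]; ring

end Linear

variable {M : Type*} [TopologicalSpace M] [ChartedSpace E2 M] [IsManifold (𝓡 2) ∞ M]
  {g : ConfSuperint.Metric M} {V : M → ℝ} {C : Fin 2 → CovTensor 2 M} {W : Fin 2 → M → ℝ}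
  {𝒱 : Submodule ℝ (M → ℝ)} {T : CovTensor 3 M} {τ : CovTensor 2 M}
  {c : OpenPartialHomeomorph M E2} {x : E2} {U : M → ℝ}

theorem InStandardGauge.isSymmTracefree3 (hg : InStandardGauge g T)
    (hN : IsNondegenerate g V C W 𝒱 T τ) (hc : c ∈ charts M) (hx : x ∈ c.target) :
    IsSymmTracefree3 (metricComp c g x) (comp3 c T x) :=
  isSymmTracefree3_of_traceForm_eq_zero ((metricOn_metricComp g hc).posDef x hx)
    (hN.structureTensors.symm_tracefree_T c hc x hx) (hg c hc x hx)

namespace IsNondegenerate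

theorem isPotentialOn (hN : IsNondegenerate g V C W 𝒱 T τ) (hU : U ∈ 𝒱) (hc : c ∈ charts M) :
    IsPotentialOn (metricComp c g) (comp3 c T) (comp2 c τ) c.target (U ∘ c.symm) :=
  ⟨contDiffOn_comp_symm (hN.smooth U hU) hc,
    fun x hx i j => hN.structureTensors.wilczynski U hU c hc x hx i j⟩

theorem eventually_eq_zero (hN : IsNondegenerate g V C W 𝒱 T τ) (hg : InStandardGauge g T)
    (hU : U ∈ 𝒱) (hc : c ∈ charts M) (hx : x ∈ c.target) (h0 : U (c.symm x) = 0)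
    (h1 : ∀ i, pd i (U ∘ c.symm) x = 0) (h2 : lapl (metricComp c g) (U ∘ c.symm) x = 0) :
    ∀ᶠ q in 𝓝 (c.symm x), U q = 0 := by
  have h := (hN.isPotentialOn hU hc).eventually_eq_zero (metricOn_metricComp g hc) hx
    (hN.structureTensors.smooth_T.comp3 hc) (fun y hy => hg.isSymmTracefree3 hN hc hy)
    (hN.structureTensors.smooth_τ.comp2 hc)
    (fun y hy => hN.structureTensors.symm_tracefree_τ c hc y hy) h0 h1 h2
  have hs := c.map_target hx
  have h3 := c.continuousAt hs
  rw [ContinuousAt, c.right_inv hx] at h3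
  filter_upwards [h3.eventually h, c.open_source.mem_nhds hs] with q hq hq'
  simpa [c.left_inv hq'] using hq

/-- A potential of the system is determined by its value, its gradient and its Laplacian at a
point: the set near which it vanishes is open and closed. -/
theorem eq_zero [ConnectedSpace M] (hN : IsNondegenerate g V C W 𝒱 T τ) (hg : InStandardGauge g T)
    (hU : U ∈ 𝒱) (hc : c ∈ charts M) (hx : x ∈ c.target) (h0 : U (c.symm x) = 0)
    (h1 : ∀ i, pd i (U ∘ c.symm) x = 0) (h2 : lapl (metricComp c g) (U ∘ c.symm) x = 0) :
    U = 0 := by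
  set Z : Set M := {p | ∀ᶠ q in 𝓝 p, U q = 0} with hZ
  have hopen : IsOpen Z := isOpen_setOfPred_eventually_nhds
  have hclosed : IsClosed Z := by
    refine isClosed_of_closure_subset fun p hp => ?_
    set e := chartAt E2 p
    have he : e ∈ charts M := IsManifold.chart_mem_maximalAtlas p
    have hps : p ∈ e.source := mem_chart_source E2 p
    have hG := metricOn_metricComp g he
    have hy := e.map_source hps
    have hsm := contDiffOn_comp_symm (hN.smooth U hU) he
    -- points near which `U` vanishes accumulate at `p`, so the jet of `U` vanishes at `p` by
    -- continuity
    have hf : ∃ᶠ y in 𝓝 (e p), ∀ᶠ z in 𝓝 y, (U ∘ e.symm) z = 0 := by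
      rw [← e.map_nhds_eq hps, frequently_map]
      refine ((mem_closure_iff_frequently.1 hp).and_eventually
        (e.open_source.mem_nhds hps)).mono fun q hq => ?_
      have h3 := e.symm.continuousAt (x := e q) (e.map_source hq.2)
      rw [ContinuousAt, e.left_inv hq.2] at h3
      exact h3.eventually hq.1
    have hzero : ∀ f : E2 → ℝ, ContDiffOn ℝ ∞ f e.target →
        (∀ y, (∀ᶠ z in 𝓝 y, (U ∘ e.symm) z = 0) → f y = 0) → f (e p) = 0 := by
      intro f hfc hfz
      by_contra hne
      have h4 := (hfc.continuousOn.continuousAt (e.open_target.mem_nhds hy)).eventually_ne hne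
      obtain ⟨y, hy1, hy2⟩ := (hf.and_eventually h4).exists
      exact hy2 (hfz y hy1)
    have := hN.eventually_eq_zero hg hU he hy
      (hzero _ hsm fun y hy => hy.self_of_nhds)
      (fun i => hzero _ (contDiffOn_pd e.open_target hsm i) fun y hy => by
        rw [(pd_eventuallyEq (v := 0) hy i).eq_of_nhds]; simp [pd])
      (hzero _ (hG.smooth_lapl hsm) fun y hy => by
        rw [lapl_congr_of_eventuallyEq (v := 0) hy]; simp [lapl, tr2, hess, cov1, pd])
    rwa [e.left_inv hps] at this
  have hne : Z.Nonempty := ⟨c.symm x, hN.eventually_eq_zero hg hU hc hx h0 h1 h2⟩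
  have := IsClopen.eq_univ ⟨hclosed, hopen⟩ hne
  ext p
  have hp : p ∈ Z := this ▸ Set.mem_univ p
  exact Filter.Eventually.self_of_nhds (p := fun q => U q = 0) hp

/-- At every point, some potential of the system has prescribed value, gradient and Laplacian: the
linear map that takes them is injective by unique continuation, and its source and its target have
dimension four. -/
theorem exists_potential [ConnectedSpace M] (hN : IsNondegenerate g V C W 𝒱 T τ)
    (hg : InStandardGauge g T) (hc : c ∈ charts M) (hx : x ∈ c.target) (a d : ℝ) (b : Fin 2 → ℝ) :
    ∃ U ∈ 𝒱, U (c.symm x) = a ∧ (∀ i, pd i (U ∘ c.symm) x = b i) ∧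
      lapl (metricComp c g) (U ∘ c.symm) x = d := by
  have hG := metricOn_metricComp g hc
  have hs : ∀ U : 𝒱, ContDiffOn ℝ ∞ ((U : M → ℝ) ∘ c.symm) c.target := fun U =>
    contDiffOn_comp_symm (hN.smooth U U.2) hc
  let J : 𝒱 →ₗ[ℝ] ℝ × (Fin 2 → ℝ) × ℝ :=
    { toFun := fun U => (U.1 (c.symm x), (fun i => pd i (U.1 ∘ c.symm) x),
        lapl (metricComp c g) (U.1 ∘ c.symm) x)
      map_add' := fun U U' => by
        refine Prod.ext rfl (Prod.ext (funext fun i => ?_) ?_)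
        · exact pd_add i (hG.diff hx (hs U)) (hG.diff hx (hs U'))
        · exact hG.lapl_add hx (hs U) (hs U')
      map_smul' := fun r U => by
        refine Prod.ext rfl (Prod.ext (funext fun i => ?_) ?_)
        · exact pd_const_mul i r (hG.diff hx (hs U))
        · exact hG.lapl_const_smul hx (hs U) r }
  have : Module.Finite ℝ 𝒱 := Module.finite_of_finrank_pos (by rw [hN.dim]; norm_num)
  have hinj : Function.Injective J := by
    rw [← LinearMap.ker_eq_bot, LinearMap.ker_eq_bot']
    intro U hU
    have h0 := congrArg Prod.fst hU
    have h1 := congrArg (fun z => z.2.1) hU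
    have h2 := congrArg (fun z => z.2.2) hU
    exact Subtype.ext (hN.eq_zero hg U.2 hc hx h0 (fun i => congrFun h1 i) h2)
  have hsurj := (LinearMap.injective_iff_surjective_of_finrank_eq_finrank
    (by rw [hN.dim]; simp)).1 hinj
  obtain ⟨U, hU⟩ := hsurj (a, b, d)
  exact ⟨U.1, U.2, congrArg Prod.fst hU, fun i => congrFun (congrArg (fun z => z.2.1) hU) i,
    congrArg (fun z => z.2.2) hU⟩

end IsNondegenerate

end

/-! ### Polynomials in the momenta -/

section

open Matrix

theorem pd_coord (k i : Fin 2) (p : E2) : pd k (fun q => q i) p = if i = k then 1 else 0 := by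
  have : (fun q : E2 => q i) = EuclideanSpace.proj (𝕜 := ℝ) i := rfl
  rw [pd, this, ContinuousLinearMap.fderiv]
  simp [ee]

/-- The derivatives of `Bⁱʲ(y) pᵢ pⱼ + w(y)` with respect to position and momentum. -/
theorem fderiv_quadratic {B : E2 → Fin 2 → Fin 2 → ℝ} {w : E2 → ℝ} {x : E2} (p : E2)
    (hB : ∀ i j, DifferentiableAt ℝ (fun y => B y i j) x) (hw : DifferentiableAt ℝ w x)
    (k : Fin 2) :
    fderiv ℝ (fun z : E2 × E2 => (∑ i, ∑ j, B z.1 i j * z.2 i * z.2 j) + w z.1) (x, p) (ee k, 0) =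
      (∑ i, ∑ j, pd k (fun y => B y i j) x * p i * p j) + pd k w x ∧
    fderiv ℝ (fun z : E2 × E2 => (∑ i, ∑ j, B z.1 i j * z.2 i * z.2 j) + w z.1) (x, p) (0, ee k) =
      ∑ j, (B x k j + B x j k) * p j := by
  set f : E2 × E2 → ℝ := fun z => (∑ i, ∑ j, B z.1 i j * z.2 i * z.2 j) + w z.1 with hf
  have hc : ∀ i, Differentiable ℝ fun q : E2 => q i := fun i =>
    (EuclideanSpace.proj (𝕜 := ℝ) i).differentiable
  have hd : DifferentiableAt ℝ f (x, p) := by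
    have h1 : ∀ i j, DifferentiableAt ℝ (fun z : E2 × E2 => B z.1 i j) (x, p) := fun i j =>
      DifferentiableAt.comp (x, p) (f := Prod.fst) (g := fun y => B y i j) (hB i j)
        differentiableAt_fst
    have h2 : ∀ i, DifferentiableAt ℝ (fun z : E2 × E2 => z.2 i) (x, p) := fun i =>
      DifferentiableAt.comp (x, p) (f := Prod.snd) (g := fun q : E2 => q i) (hc i _)
        differentiableAt_snd
    have h3 : DifferentiableAt ℝ (fun z : E2 × E2 => w z.1) (x, p) :=
      DifferentiableAt.comp (x, p) (f := Prod.fst) (g := w) hw differentiableAt_fst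
    fun_prop
  constructor
  · have h1 := HasFDerivAt.comp (g := f) (f := fun y => (y, p)) x hd.hasFDerivAt
      (hasFDerivAt_prodMk_left x p)
    have h2 : fderiv ℝ f (x, p) (ee k, 0) = pd k (fun y => f (y, p)) x := by
      rw [pd, show (fun y => f (y, p)) = f ∘ fun y => (y, p) from rfl, h1.fderiv]
      simp
    rw [h2]
    have h3 : ∀ i j, DifferentiableAt ℝ (fun y => B y i j * p i * p j) x := fun i j =>
      ((hB i j).mul_const _).mul_const _
    have h4 : ∀ i, DifferentiableAt ℝ (fun y => ∑ j, B y i j * p i * p j) x := fun i =>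
      DifferentiableAt.fun_sum fun j _ => h3 i j
    simp only [hf]
    rw [pd_add k (DifferentiableAt.fun_sum fun i _ => h4 i) hw, pd_sum k fun i _ => h4 i]
    simp only [pd_sum k fun j _ => h3 _ j]
    congr 1
    refine Finset.sum_congr rfl fun i _ => Finset.sum_congr rfl fun j _ => ?_
    rw [pd_mul k ((hB i j).mul_const _) (differentiableAt_const _), pd_mul k (hB i j)
      (differentiableAt_const _), pd_const, pd_const]
    ring
  · have h1 := HasFDerivAt.comp (g := f) (f := fun q => (x, q)) p hd.hasFDerivAt
      (hasFDerivAt_prodMk_right x p)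
    have h2 : fderiv ℝ f (x, p) (0, ee k) = pd k (fun q => f (x, q)) p := by
      rw [pd, show (fun q => f (x, q)) = f ∘ fun q => (x, q) from rfl, h1.fderiv]
      simp
    rw [h2]
    have h3 : ∀ i j, DifferentiableAt ℝ (fun q : E2 => B x i j * q i * q j) p := fun i j =>
      ((hc i p).const_mul _).mul (hc j p)
    have h4 : ∀ i, DifferentiableAt ℝ (fun q : E2 => ∑ j, B x i j * q i * q j) p := fun i =>
      DifferentiableAt.fun_sum fun j _ => h3 i j
    simp only [hf]
    rw [pd_add k (DifferentiableAt.fun_sum fun i _ => h4 i) (differentiableAt_const _),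
      pd_sum k fun i _ => h4 i]
    simp only [pd_sum k fun j _ => h3 _ j, pd_mul k ((hc _ p).const_mul _) (hc _ p),
      pd_const_mul k _ (hc _ p), pd_coord, pd_const]
    fin_cases k <;> simp [Fin.sum_univ_two] <;> ring

/-- Comparison of degrees in the momenta, along lines through the origin: if
`ρ(t p) (q t² + u) = c t³ + d t` for all `t`, the linear part `ℓ` of the polynomial `ρ` satisfies
`q ℓ(p) = c` and `u ℓ(p) = d`. -/
theorem eval_linear_part (ρ : MvPolynomial (Fin 2) ℝ) : ∃ ℓ : E2 →ₗ[ℝ] ℝ, ∀ (p : E2) (q u c d : ℝ),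
    q ≠ 0 → (∀ t : ℝ, MvPolynomial.eval (fun i => t * p i) ρ * (q * t ^ 2 + u) = c * t ^ 3
        + d * t) →
    q * ℓ p = c ∧ u * ℓ p = d := by
  set f : E2 → ℝ := fun p => MvPolynomial.eval (fun i => p i) ρ with hf
  have hd : Differentiable ℝ f := by
    clear_value f
    subst hf
    induction ρ using MvPolynomial.induction_on with
    | C a => simp
    | add p q hp hq => simp only [map_add]; exact hp.add hq
    | mul_X p i hp =>
      simp only [map_mul, MvPolynomial.eval_X]
      exact hp.mul (EuclideanSpace.proj (𝕜 := ℝ) i).differentiable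
  refine ⟨(fderiv ℝ f 0 : E2 →ₗ[ℝ] ℝ), fun p q u c d hq H => ?_⟩
  set r : Polynomial ℝ := MvPolynomial.aeval (fun i => Polynomial.X * Polynomial.C (p i)) ρ with hr
  have hre : ∀ t, r.eval t = MvPolynomial.eval (fun i => t * p i) ρ := fun t => by
    rw [hr]
    clear hr H r hd hf f
    induction ρ using MvPolynomial.induction_on with
    | C a => simp
    | add p q hp hq => simp only [map_add, Polynomial.eval_add, hp, hq]
    | mul_X p i hp =>
      simp only [map_mul, Polynomial.eval_mul, hp, MvPolynomial.aeval_X, MvPolynomial.eval_X,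
        Polynomial.eval_X, Polynomial.eval_C]
  have hpoly : r * (Polynomial.C q * Polynomial.X ^ 2 + Polynomial.C 0 * Polynomial.X +
      Polynomial.C u) = Polynomial.C c * Polynomial.X ^ 3 + Polynomial.C 0 * Polynomial.X ^ 2 +
      Polynomial.C d * Polynomial.X + Polynomial.C 0 := by
    refine Polynomial.funext fun t => ?_
    simp [hre, H]
  -- a cubic divided by a quadratic polynomial is at most linear
  have hdeg : r.natDegree ≤ 1 := by
    by_cases h0 : r = 0
    · simp [h0]
    have h2 := Polynomial.natDegree_quadratic (R := ℝ) (b := 0) (c := u) hq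
    have h3 := Polynomial.natDegree_cubic_le (R := ℝ) (a := c) (b := 0) (c := d) (d := 0)
    rw [← hpoly, Polynomial.natDegree_mul h0 (fun h => by rw [h] at h2; simp at h2), h2] at h3
    omega
  obtain ⟨a, b, hab⟩ := Polynomial.exists_eq_X_add_C_of_natDegree_le_one hdeg
  have hval : ∀ t, MvPolynomial.eval (fun i => t * p i) ρ = a * t + b := fun t => by
    rw [← hre, hab]; simp
  -- the linear part is the derivative of `ρ` at the origin
  have hl : fderiv ℝ f 0 p = a := by
    have h1 : HasDerivAt (fun t : ℝ => t • p) p 0 := by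
      simpa using (hasDerivAt_id (0 : ℝ)).smul_const p
    have h2 : HasFDerivAt f (fderiv ℝ f 0) ((0 : ℝ) • p) := by
      rw [zero_smul]; exact (hd 0).hasFDerivAt
    have h3 := h2.comp_hasDerivAt (0 : ℝ) h1
    have h4 : (f ∘ fun t : ℝ => t • p) = fun t => a * t + b := by
      ext t
      rw [← hval]; simp [hf]
    rw [h4] at h3
    have h5 : HasDerivAt (fun t : ℝ => a * t + b) a 0 := by
      simpa using ((hasDerivAt_id (0 : ℝ)).const_mul a).add_const b
    exact h3.unique h5
  change q * fderiv ℝ f 0 p = c ∧ u * fderiv ℝ f 0 p = d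
  rw [hl]
  have h1 := H 1
  have h2 := H (-1)
  have h3 := H 2
  have h4 := H 0
  rw [hval] at h1 h2 h3 h4
  have hb : b = 0 := by
    have : b * q = 0 := by linarith
    exact (mul_eq_zero.1 this).resolve_right hq
  subst hb
  constructor <;> linarith

end

/-! ### The Poisson bracket of quadratic integrals -/

section

open Matrix

variable {G : E2 → Matrix (Fin 2) (Fin 2) ℝ} {Ω : Set E2} {x : E2}

theorem inv_symm_of_posDef {h : Matrix (Fin 2) (Fin 2) ℝ} (hh : h.PosDef) (i j : Fin 2) :
    h⁻¹ i j = h⁻¹ j i := by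
  simpa using hh.inv.isHermitian.apply j i

/-- The bracket `{Aⁱʲ pᵢ pⱼ + w, gⁱʲ pᵢ pⱼ + u}` in terms of the velocity `vⁱ = gⁱʲ pⱼ`: its cubic
part is `2 ∇ₖAᵢⱼ vⁱ vʲ vᵏ`, its linear part `2 (∂ₖw - Aₖᵐ ∂ₘu) vᵏ`. -/
theorem MetricOn.poisson_eq (hG : MetricOn G Ω) (hx : x ∈ Ω) {A : E2 → Fin 2 → Fin 2 → ℝ}
    {u w : E2 → ℝ} (hA : ∀ i j, ContDiffOn ℝ ∞ (fun y => A y i j) Ω)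
    (hAs : ∀ i j, A x i j = A x j i) (hu : DifferentiableAt ℝ u x) (hw : DifferentiableAt ℝ w x)
    (p : E2) (v : Fin 2 → ℝ) (hv : ∀ i, v i = ∑ j, (G x)⁻¹ i j * p j) :
    poisson (fun z => (∑ i, ∑ j, ∑ a, ∑ b, (G z.1)⁻¹ i a * (G z.1)⁻¹ j b * A z.1 a b * z.2 i
        * z.2 j)
      + w z.1) (fun z => (∑ i, ∑ j, (G z.1)⁻¹ i j * z.2 i * z.2 j) + u z.1) (x, p) =
    2 * (∑ i, ∑ j, ∑ k, cov2 G A x i j k * v i * v j * v k)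
      + 2 * ∑ k, (pd k w x - tr2 (G x) fun a b => A x k a * pd b u x) * v k := by
  set B : E2 → Fin 2 → Fin 2 → ℝ := fun y i j => ∑ a, ∑ b, (G y)⁻¹ i a *
      (G y)⁻¹ j b * A y a b with hB
  have hI := fun i j => hG.diff hx (hG.smooth_inv i j)
  have hAd := fun i j => hG.diff hx (hA i j)
  have h1 : ∀ i j a b, DifferentiableAt ℝ (fun y => (G y)⁻¹ i a * (G y)⁻¹ j b * A y a b) x :=
    fun i j a b => ((hI i a).mul (hI j b)).mul (hAd a b)
  have h2 : ∀ i j a, DifferentiableAt ℝ (fun y => ∑ b, (G y)⁻¹ i a * (G y)⁻¹ j b * A y a b) x :=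
    fun i j a => DifferentiableAt.fun_sum fun b _ => h1 i j a b
  have h3 : ∀ i j, DifferentiableAt ℝ (fun y => B y i j) x := fun i j =>
    DifferentiableAt.fun_sum fun a _ => h2 i j a
  have hF : (fun z : E2 × E2 => (∑ i, ∑ j, ∑ a, ∑ b, (G z.1)⁻¹ i a * (G z.1)⁻¹ j b * A z.1 a b
      * z.2 i * z.2 j) + w z.1) = fun z => (∑ i, ∑ j, B z.1 i j * z.2 i * z.2 j) + w z.1 := by
    ext z
    simp only [hB, Finset.sum_mul]
  have hdB : ∀ i j k, pd k (fun y => B y i j) x = ∑ a, ∑ b,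
      ((pd k (fun y => (G y)⁻¹ i a) x * (G x)⁻¹ j b + (G x)⁻¹ i a * pd k (fun y => (G y)⁻¹ j b) x)
        * A x a b + (G x)⁻¹ i a * (G x)⁻¹ j b * pd k (fun y => A y a b) x) := by
    intro i j k
    simp only [hB]
    rw [pd_sum k fun a _ => h2 i j a]
    refine Finset.sum_congr rfl fun a _ => ?_
    rw [pd_sum k fun b _ => h1 i j a b]
    refine Finset.sum_congr rfl fun b _ => ?_
    have h4 : DifferentiableAt ℝ (fun y => (G y)⁻¹ i a * (G y)⁻¹ j b) x := (hI i a).mul (hI j b)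
    rw [pd_mul k h4 (hAd a b), pd_mul k (hI i a) (hI j b)]
  have hi := inv_symm_of_posDef (hG.posDef x hx) 1 0
  have hΓ := fun k => hG.christoffel_symm hx k 1 0
  rw [hF]
  unfold poisson
  simp only [fderiv_quadratic p h3 hw, fderiv_quadratic p hI hu]
  -- first contract the momenta with the inverse metric, then expand
  have e1 : ∀ k, ∑ j, ((G x)⁻¹ k j + (G x)⁻¹ j k) * p j = 2 * v k := by
    intro k
    rw [hv]
    fin_cases k <;> simp [Fin.sum_univ_two, hi] <;> ring
  have e2 : ∀ k, ∑ j, (B x k j + B x j k) * p j = 2 * ∑ a, ∑ b, (G x)⁻¹ k a * A x a b * v b := by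
    intro k
    simp only [hv, hB, Fin.sum_univ_two, hAs 1 0]
    fin_cases k <;> simp [hi] <;> ring
  have e3 : ∀ k, ∑ i, ∑ j, pd k (fun y => (G y)⁻¹ i j) x * p i * p j =
      -2 * ∑ i, ∑ a, christoffel G x i k a * p i * v a := by
    intro k
    simp only [hv, hG.pd_inv hx, Fin.sum_univ_two, hi]
    ring
  have e4 : ∀ k, ∑ i, ∑ j, pd k (fun y => B y i j) x * p i * p j =
      (∑ a, ∑ b, pd k (fun y => A y a b) x * v a * v b)
      - 2 * (∑ a, ∑ b, ∑ m, christoffel G x a k m * v m * A x a b * v b)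
      - 2 * (∑ i, ∑ a, ∑ b, ∑ m, christoffel G x i k m * p i * (G x)⁻¹ m a * A x a b * v b) := by
    intro k
    simp only [hv, hdB, hG.pd_inv hx, Fin.sum_univ_two, hi, hAs 1 0]
    ring
  simp only [e1, e2, e3, e4, cov2, tr2]
  clear hv e1 e2 e3 e4
  simp only [Fin.sum_univ_two, hi, hAs 1 0, hΓ]
  ring

/-- The cubic part of the condition for a conformal integral is the conformal Killing equation, by
polarisation. -/
theorem conformalKilling_of_cubic {h : Matrix (Fin 2) (Fin 2) ℝ} (hs : ∀ i j, h i j = h j i)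
    {N : Fin 2 → Fin 2 → Fin 2 → ℝ} {ℓ : Fin 2 → ℝ} (hN : ∀ i j k, N i j k = N j i k)
    (H : ∀ v : Fin 2 → ℝ, 2 * (∑ i, ∑ j, ∑ k, N i j k * v i * v j * v k) =
      (∑ k, ℓ k * v k) * ∑ i, ∑ j, h i j * v i * v j) (i j k : Fin 2) :
    N i j k + N j k i + N k i j = 1 / 2 * (ℓ i * h j k + ℓ j * h k i + ℓ k * h i j) := by
  have h1 := H ![1, 0]
  have h2 := H ![0, 1]
  have h3 := H ![1, 1]
  have h4 := H ![1, -1]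
  simp [Fin.sum_univ_two, hN 1 0, hs 1 0] at h1 h2 h3 h4
  fin_cases i <;> fin_cases j <;> fin_cases k <;> simp [hN 1 0, hs 1 0] <;> linarith

/-- The conditions for `Aⁱʲ pᵢ pⱼ + w` to be a conformal integral of `gⁱʲ pᵢ pⱼ + u`: the tensor `A`
is conformal Killing, and the derivative of `w` is determined by `A` and `u`. -/
theorem MetricOn.conformalIntegral (hG : MetricOn G Ω) (hx : x ∈ Ω) {A : E2 → Fin 2 → Fin 2 → ℝ}
    {u w : E2 → ℝ} (hA : ∀ i j, ContDiffOn ℝ ∞ (fun y => A y i j) Ω)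
    (hAs : ∀ y ∈ Ω, IsSymmTracefree2 (G y) (A y)) (hu : DifferentiableAt ℝ u x)
    (hw : DifferentiableAt ℝ w x) (ρ : MvPolynomial (Fin 2) ℝ)
    (H : ∀ p : E2, poisson (fun z => (∑ i, ∑ j, ∑ a, ∑ b, (G z.1)⁻¹ i a * (G z.1)⁻¹ j b * A z.1 a b
      * z.2 i * z.2 j) + w z.1) (fun z => (∑ i, ∑ j, (G z.1)⁻¹ i j * z.2 i * z.2 j) + u z.1)
          (x, p) =
      MvPolynomial.eval (fun i => p i) ρ * ((∑ i, ∑ j, (G x)⁻¹ i j * p i * p j) + u x)) :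
    (∀ i j k, cov2 G A x i j k =
      killRhs (G x) (fun k => tr2 (G x) fun a b => cov2 G A x k a b) i j k) ∧
    ∀ k, pd k w x = (tr2 (G x) fun a b => A x k a * pd b u x)
      + 1 / 2 * (tr2 (G x) fun a b => cov2 G A x k a b) * u x := by
  have hh := hG.posDef x hx
  have hN := fun k => hG.cov2_symmTracefree hx hA hAs k
  obtain ⟨ℓ, hℓ⟩ := eval_linear_part ρ
  -- lower the velocity to obtain the momentum
  let P : (Fin 2 → ℝ) → E2 := fun v => WithLp.toLp 2 (G x *ᵥ v)
  have hP : ∀ v i, v i = ∑ j, (G x)⁻¹ i j * P v j := fun v i => by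
    have h1 : (G x)⁻¹ *ᵥ (G x *ᵥ v) = v := by
      rw [Matrix.mulVec_mulVec, Matrix.nonsing_inv_mul _ (hG.isUnit_det hx), Matrix.one_mulVec]
    exact (congrFun h1 i).symm
  have hq : ∀ v, ∑ i, ∑ j, (G x)⁻¹ i j * P v i * P v j = ∑ i, ∑ j, G x i j * v i * v j := by
    intro v
    have h1 : ∀ i, P v i = ∑ j, G x i j * v j := fun i => rfl
    calc ∑ i, ∑ j, (G x)⁻¹ i j * P v i * P v j = ∑ i, P v i * ∑ j, (G x)⁻¹ i j * P v j := by
          simp only [Finset.mul_sum]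
          exact Finset.sum_congr rfl fun i _ => Finset.sum_congr rfl fun j _ => by ring
      _ = ∑ i, P v i * v i := by simp only [← hP]
      _ = _ := by
          simp only [h1, Fin.sum_univ_two]; ring
  let lam : Fin 2 → ℝ := fun k => ℓ (P (Pi.single k 1))
  have hlam : ∀ v, ℓ (P v) = ∑ k, lam k * v k := by
    intro v
    have h1 : P v = v 0 • P (Pi.single 0 1) + v 1 • P (Pi.single 1 1) := by
      ext i
      fin_cases i <;> simp [P, Matrix.mulVec, dotProduct, Fin.sum_univ_two] <;> ring
    rw [h1, map_add, map_smul, map_smul]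
    simp [lam, Fin.sum_univ_two]; ring
  have key : ∀ v : Fin 2 → ℝ, v ≠ 0 →
      (∑ i, ∑ j, G x i j * v i * v j) * ℓ (P v) =
        2 * (∑ i, ∑ j, ∑ k, cov2 G A x i j k * v i * v j * v k) ∧
      u x * ℓ (P v) = 2 * ∑ k, (pd k w x - tr2 (G x) fun a b => A x k a * pd b u x) * v k := by
    intro v hv
    refine hℓ (P v) _ _ _ _ ?_ fun t => ?_
    · have := hh.dotProduct_mulVec_pos hv
      simp [dotProduct, Matrix.mulVec, Fin.sum_univ_two] at this
      simp only [Fin.sum_univ_two]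
      refine ne_of_gt ?_
      linarith
    · have h1 := H (t • P v)
      have h2 : P (t • v) = t • P v := by
        ext i; simp [P, Matrix.mulVec_smul]
      rw [hG.poisson_eq hx hA (hAs x hx).1 hu hw (t • P v) (t • v)
        (fun i => by rw [← h2]; exact hP _ i)] at h1
      have h3 : ∑ i, ∑ j, (G x)⁻¹ i j * (t • P v) i * (t • P v) j =
          (∑ i, ∑ j, G x i j * v i * v j) * t ^ 2 := by
        rw [← h2, hq]
        simp only [Pi.smul_apply, smul_eq_mul, Fin.sum_univ_two]; ring
      rw [h3] at h1
      simp only [PiLp.smul_apply, smul_eq_mul] at h1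
      rw [← h1]
      simp only [Pi.smul_apply, smul_eq_mul, Fin.sum_univ_two]; ring
  have hK := conformalKilling_of_cubic (hG.symm hx) (N := cov2 G A x) (ℓ := lam)
    (fun i j k => (hN k).1 i j) fun v => by
      by_cases hv : v = 0
      · subst hv; simp
      · rw [← (key v hv).1, hlam]; ring
  have hl := conformalKilling_trace hh hN hK
  have hl' : lam = fun k => tr2 (G x) fun a b => cov2 G A x k a b := funext hl
  constructor
  · intro i j k
    rw [← hl']
    exact conformalKilling_eq hh hN hK i j k
  · intro k
    rw [← hl]
    have h1 := (key (Pi.single k 1) (by simp)).2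
    rw [hlam] at h1
    have h2 : ∀ f : Fin 2 → ℝ, ∑ i, f i * (Pi.single k 1 : Fin 2 → ℝ) i = f k := fun f => by
      simp [Pi.single_apply]
    rw [h2, h2] at h1
    linarith

end

/-! ### Irreducibility -/

section

open Matrix

section Pointwise

variable {h : Matrix (Fin 2) (Fin 2) ℝ}

theorem contr32_linear (S : Fin 2 → Fin 2 → Fin 2 → ℝ) (A B : Fin 2 → Fin 2 → ℝ) (s t : ℝ)
    (k : Fin 2) : contr32 h S (fun i j => s * A i j + t * B i j) k =
      s * contr32 h S A k + t * contr32 h S B k := by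
  rw [contr32_eq, contr32_eq, contr32_eq, ← tr2_const_mul, ← tr2_const_mul, ← tr2_add]
  refine tr2_congr fun a c => ?_
  rw [← tr2_const_mul, ← tr2_const_mul, ← tr2_add]
  exact tr2_congr fun b d => by ring

theorem divDeriv_linear (T : Fin 2 → Fin 2 → Fin 2 → ℝ) (M : Fin 2 → Fin 2 → Fin 2 → Fin 2 → ℝ)
    (A B : Fin 2 → Fin 2 → ℝ) (s t : ℝ) (j m : Fin 2) :
    divDeriv h T M (fun i j => s * A i j + t * B i j) j m =
      s * divDeriv h T M A j m + t * divDeriv h T M B j m := by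
  have h1 : (fun a b => killRhs h (fun k => 2 / 3 * contr32 h T
      (fun i j => s * A i j + t * B i j) k)
      a b m) = fun a b => s * killRhs h (fun k => 2 / 3 * contr32 h T A k) a b m
        + t * killRhs h (fun k => 2 / 3 * contr32 h T B k) a b m := by
    ext a b
    simp only [killRhs, contr32_linear]; ring
  rw [divDeriv, h1, contr32_linear, contr32_linear, divDeriv, divDeriv]
  ring

/-- Two vectors of the plane with vanishing determinant are multiples of a single vector. -/
theorem exists_common_multiple (b : Fin 2 → Fin 2 → ℝ) (hb : b 0 0 * b 1 1 - b 0 1 * b 1 0 = 0) :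
    ∃ x y : ℝ, ∃ s : Fin 2 → ℝ, ∀ α, b α 0 = s α * x ∧ b α 1 = s α * y := by
  by_cases h0 : b 0 0 = 0 ∧ b 0 1 = 0
  · refine ⟨b 1 0, b 1 1, ![0, 1], fun α => ?_⟩
    fin_cases α <;> simp [h0]
  · have h1 : b 0 0 ^ 2 + b 0 1 ^ 2 ≠ 0 := fun h => h0
      ⟨by nlinarith [sq_nonneg (b 0 0), sq_nonneg (b 0 1)],
        by nlinarith [sq_nonneg (b 0 0), sq_nonneg (b 0 1)]⟩
    refine ⟨b 0 0, b 0 1, ![1, (b 0 0 * b 1 0 + b 0 1 * b 1 1) / (b 0 0 ^ 2 + b 0 1 ^ 2)],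
      fun α => ?_⟩
    fin_cases α
    · simp
    · constructor
      · simp; field_simp; linear_combination (-b 0 1) * hb
      · simp; field_simp; linear_combination (b 0 0) * hb

/-- A real symmetric trace-free matrix of size two has an eigenvector. -/
theorem exists_eigenvector (x y : ℝ) : ∃ w : Fin 2 → ℝ, w ≠ 0 ∧ ∃ μ : ℝ,
    x * w 0 + y * w 1 = μ * w 0 ∧ y * w 0 - x * w 1 = μ * w 1 := by
  have hr : √(x ^ 2 + y ^ 2) ^ 2 = x ^ 2 + y ^ 2 := Real.sq_sqrt (by positivity)
  by_cases hy : y = 0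
  · exact ⟨![1, 0], fun h => by simpa using congrFun h 0, x, by simp, by simp [hy]⟩
  · refine ⟨![y, √(x ^ 2 + y ^ 2) - x], fun h => hy (by simpa using congrFun h 0),
      √(x ^ 2 + y ^ 2), ?_, ?_⟩ <;> simp <;> linarith

/-- Two symmetric trace-free tensors without a common eigenvector span the space of all symmetric
trace-free tensors. As this space is two-dimensional, they are otherwise multiples of one tensor,
and any eigenvector of the latter is a common eigenvector. -/
theorem exists_linear_combination (hh : h.PosDef) {B : Fin 2 → Fin 2 → Fin 2 → ℝ}
    (hB : ∀ α, IsSymmTracefree2 h (B α))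
    (H : ∀ v : Fin 2 → ℝ, v ≠ 0 → ¬ ∀ α, ∃ μ : ℝ, ∀ j, ∑ i, B α i j * v i = μ * ∑ i, h i j * v i)
    {B' : Fin 2 → Fin 2 → ℝ} (hB' : IsSymmTracefree2 h B') :
    ∃ s t : ℝ, B' = fun i j => s * B 0 i j + t * B 1 i j := by
  obtain ⟨L, hL, rfl⟩ := exists_frame hh
  choose b hb using fun α => act2_surj hL (B α)
  obtain rfl : (fun α => act2 L (b α)) = B := funext fun α => hb α
  obtain ⟨b', rfl⟩ := act2_surj hL B'
  simp only [isSymmTracefree2_act hL] at hB hB'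
  have hc := fun α => (hB α).comps
  by_cases hd : b 0 0 0 * b 1 0 1 - b 0 0 1 * b 1 0 0 = 0
  · obtain ⟨x, y, s, hs⟩ := exists_common_multiple (fun α j => b α 0 j) hd
    obtain ⟨w, hw, μ, h1, h2⟩ := exists_eigenvector x y
    have hLt : IsUnit Lᵀ.det := by rwa [Matrix.det_transpose]
    have hv : Lᵀ *ᵥ (Lᵀ⁻¹ *ᵥ w) = w := by
      rw [Matrix.mulVec_mulVec, Matrix.mul_nonsing_inv _ hLt, Matrix.one_mulVec]
    set v := Lᵀ⁻¹ *ᵥ w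
    have hv' : ∀ i, w i = ∑ a, L a i * v a := fun i => by
      rw [← hv]; simp [Matrix.mulVec, dotProduct]
    refine (H v (fun h0 => hw ?_) fun α => ⟨s α * μ, fun j => ?_⟩).elim
    · rw [← hv, h0, Matrix.mulVec_zero]
    · have e1 : ∑ i, act2 L (b α) i j * v i = ∑ β, (∑ γ, b α γ β * w γ) * L j β := by
        simp only [hv', act2, Fin.sum_univ_two]; ring
      have e2 : ∑ i, (L * Lᵀ) i j * v i = ∑ β, w β * L j β := by
        simp only [hv', mul_transpose_apply_two, Fin.sum_univ_two]; ring
      rw [e1, e2]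
      simp only [Fin.sum_univ_two, (hc α).1, (hc α).2, (hs α).1, (hs α).2]
      linear_combination s α * L j 0 * h1 + s α * L j 1 * h2
  · set d := b 0 0 0 * b 1 0 1 - b 0 0 1 * b 1 0 0 with hdd
    obtain ⟨s, t, e0, e1⟩ : ∃ s t : ℝ, s * b 0 0 0 + t * b 1 0 0 = b' 0 0 ∧
        s * b 0 0 1 + t * b 1 0 1 = b' 0 1 := by
      refine ⟨(b' 0 0 * b 1 0 1 - b' 0 1 * b 1 0 0) / d,
        (b 0 0 0 * b' 0 1 - b 0 0 1 * b' 0 0) / d, ?_, ?_⟩ <;> field_simp <;> rw [hdd] <;> ring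
    refine ⟨s, t, ?_⟩
    ext i j
    simp only [act2, Fin.sum_univ_two, (hc _).1, (hc _).2, hB'.comps.1, hB'.comps.2]
    rw [← e0, ← e1]
    ring

end Pointwise

variable {G : E2 → Matrix (Fin 2) (Fin 2) ℝ} {Ω : Set E2} {x : E2}

namespace MetricOn

/-- As the metric is parallel, covariant differentiation passes through `killRhs`. -/
theorem cov3_killRhs (hG : MetricOn G Ω) (hx : x ∈ Ω) {θ : E2 → Fin 2 → ℝ}
    (hθ : ∀ i, ContDiffOn ℝ ∞ (fun y => θ y i) Ω) (i j k m : Fin 2) :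
    cov3 G (fun y => killRhs (G y) (θ y)) x i j k m =
      killRhs (G x) (fun i => cov1 G θ x i m) i j k := by
  have h1 : ∀ a b c, DifferentiableAt ℝ (fun y => G y a b * θ y c) x := fun a b c =>
    (hG.diff hx (hG.smooth a b)).mul (hG.diff hx (hθ c))
  have h2 : DifferentiableAt ℝ (fun y => G y i k * θ y j + G y j k * θ y i) x :=
    (h1 i k j).add (h1 j k i)
  have h3 : DifferentiableAt ℝ (fun y => G y i k * θ y j + G y j k * θ y i - G y i j * θ y k) x :=
    h2.sub (h1 i j k)
  unfold cov3 killRhs cov1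
  rw [pd_const_mul m _ h3, pd_sub m h2 (h1 i j k), pd_add m (h1 i k j) (h1 j k i)]
  simp only [pd_mul m (hG.diff hx (hG.smooth _ _)) (hG.diff hx (hθ _)), hG.pd_metric hx,
    Fin.sum_univ_two]
  ring

/-- As the metric is parallel, covariant differentiation passes through `rhsS`. -/
theorem cov4_rhsS (hG : MetricOn G Ω) (hx : x ∈ Ω) {X : E2 → Fin 2 → Fin 2 → ℝ}
    (hX : ∀ i j, ContDiffOn ℝ ∞ (fun y => X y i j) Ω) (i j k l m : Fin 2) :
    cov4 G (fun y => rhsS (G y) (X y)) x i j k l m =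
      rhsS (G x) (fun a b => cov2 G X x a b m) i j k l := by
  have h0 := fun a b => hG.diff hx (hG.smooth a b)
  have h1 := fun a b => hG.diff hx (hX a b)
  have h2 : ∀ a b c, DifferentiableAt ℝ (fun y => X y a b * G y c l - 1 / 2 *
      (G y a b * X y c l)) x :=
    fun a b c => ((h1 a b).mul (h0 c l)).sub (((h0 a b).mul (h1 c l)).const_mul _)
  have h3 : ∀ a b c, pd m (fun y => X y a b * G y c l - 1 / 2 * (G y a b * X y c l)) x =
      pd m (fun y => X y a b) x * G x c l + X x a b * pd m (fun y => G y c l) x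
        - 1 / 2 * (pd m (fun y => G y a b) x * X x c l + G x a b * pd m (fun y => X y c l) x) := by
    intro a b c
    have h4 : DifferentiableAt ℝ (fun y => G y a b * X y c l) x := (h0 a b).mul (h1 c l)
    have h6 : DifferentiableAt ℝ (fun y => X y a b * G y c l) x := (h1 a b).mul (h0 c l)
    rw [pd_sub m h6 (h4.const_mul _), pd_mul m (h1 a b) (h0 c l),
      pd_const_mul m _ h4, pd_mul m (h0 a b) (h1 c l)]
  have h5 : pd m (fun y => rhsS (G y) (X y) i j k l) x = 1 / 6 * young3 (fun a b c =>
      pd m (fun y => X y a b * G y c l - 1 / 2 * (G y a b * X y c l)) x) i j k := by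
    simp only [rhsS, young3]
    have e2 := (h2 i j k).fun_add (h2 i k j)
    have e3 := e2.fun_add (h2 j i k)
    have e4 := e3.fun_add (h2 j k i)
    have e5 := e4.fun_add (h2 k i j)
    rw [pd_const_mul m _ (e5.fun_add (h2 k j i)), pd_add m e5 (h2 k j i), pd_add m e4 (h2 k i j),
      pd_add m e3 (h2 j k i), pd_add m e2 (h2 j i k), pd_add m (h2 i j k) (h2 i k j)]
  unfold cov4
  rw [h5]
  simp only [h3, hG.pd_metric hx]
  simp only [rhsS, young3, cov2, Fin.sum_univ_two]
  ring

end MetricOn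

end

/-! ### Structure equations in a chart -/

section

open Matrix

variable {G : E2 → Matrix (Fin 2) (Fin 2) ℝ} {Ω : Set E2} {x : E2}
  {T : E2 → Fin 2 → Fin 2 → Fin 2 → ℝ} {τ : E2 → Fin 2 → Fin 2 → ℝ}

/-- The data of a non-degenerate system in standard gauge, in a chart: two trace-free conformal
Killing tensors that span the trace-free symmetric tensors at every point, and potentials with
arbitrary value, gradient and Laplacian at every point that satisfy the Bertrand-Darboux condition.
The latter is the closedness of the one-form `Aₖᵐ u,ₘ + (1/2) (div A)ₖ u`. -/
structure IsSystemOn (G : E2 → Matrix (Fin 2) (Fin 2) ℝ) (T : E2 → Fin 2 → Fin 2 → Fin 2 → ℝ)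
    (τ : E2 → Fin 2 → Fin 2 → ℝ) (A : Fin 2 → E2 → Fin 2 → Fin 2 → ℝ) (Ω : Set E2) : Prop where
  metric : MetricOn G Ω
  smooth_T : ∀ i j k, ContDiffOn ℝ ∞ (fun y => T y i j k) Ω
  symm_T : ∀ y ∈ Ω, IsSymmTracefree3 (G y) (T y)
  smooth_τ : ∀ i j, ContDiffOn ℝ ∞ (fun y => τ y i j) Ω
  symm_τ : ∀ y ∈ Ω, IsSymmTracefree2 (G y) (τ y)
  smooth_A : ∀ α i j, ContDiffOn ℝ ∞ (fun y => A α y i j) Ω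
  symm_A : ∀ α, ∀ y ∈ Ω, IsSymmTracefree2 (G y) (A α y)
  killing : ∀ α, ∀ y ∈ Ω, ∀ i j k, cov2 G (A α) y i j k =
    killRhs (G y) (fun k => tr2 (G y) fun a b => cov2 G (A α) y k a b) i j k
  span : ∀ y ∈ Ω, ∀ B, IsSymmTracefree2 (G y) B →
    ∃ s t : ℝ, B = fun i j => s * A 0 y i j + t * A 1 y i j
  potential : ∀ α, ∀ y ∈ Ω, ∀ (a d : ℝ) (b : Fin 2 → ℝ), ∃ u, IsPotentialOn G T τ Ω u ∧ u y = a ∧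
    (∀ i, pd i u y = b i) ∧ lapl G u y = d ∧ ∀ k l,
      pd l (fun z => (tr2 (G z) fun a b => A α z k a * pd b u z)
        + 1 / 2 * (tr2 (G z) fun a b => cov2 G (A α) z k a b) * u z) y =
      pd k (fun z => (tr2 (G z) fun a b => A α z l a * pd b u z)
        + 1 / 2 * (tr2 (G z) fun a b => cov2 G (A α) z l a b) * u z) y

theorem MetricOn.div3_symmTracefree (hG : MetricOn G Ω) (hx : x ∈ Ω)
    (hT : ∀ i j k, ContDiffOn ℝ ∞ (fun y => T y i j k) Ω)
    (hTs : ∀ y ∈ Ω, IsSymmTracefree3 (G y) (T y)) : IsSymmTracefree2 (G x) (div3 G T x) := by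
  have hM := fun l => hG.cov3_symmTracefree hx hT hTs l
  refine ⟨fun i j => tr2_congr fun a b => ((hM b).1 i j a).1, ?_⟩
  unfold div3
  rw [tr2_tr2_comm, tr2_congr (B := fun _ _ => 0) fun a b => (hM b).2 a]
  simp [tr2]

namespace IsSystemOn

variable {A : Fin 2 → E2 → Fin 2 → Fin 2 → ℝ}

theorem smooth_div (H : IsSystemOn G T τ A Ω) (α k : Fin 2) :
    ContDiffOn ℝ ∞ (fun y => tr2 (G y) fun a b => cov2 G (A α) y k a b) Ω :=
  H.metric.smooth_tr2 fun a b => H.metric.smooth_cov2 (H.smooth_A α) k a b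

/-- The Bertrand-Darboux condition for all potentials, at the level of the coefficients. -/
theorem closed (H : IsSystemOn G T τ A Ω) (α : Fin 2) (hx : x ∈ Ω) :
    (∀ k l n, cov2 G (A α) x k n l + (tr2 (G x) fun a b => A α x k a * T x b l n)
        + 1 / 2 * (tr2 (G x) fun a b => cov2 G (A α) x k a b) * G x l n =
      cov2 G (A α) x l n k + (tr2 (G x) fun a b => A α x l a * T x b k n)
        + 1 / 2 * (tr2 (G x) fun a b => cov2 G (A α) x l a b) * G x k n) ∧
    ∀ k l, (tr2 (G x) fun a b => A α x k a * τ x b l)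
        + cov1 G (fun y k => 1 / 2 * tr2 (G y) fun a b => cov2 G (A α) y k a b) x k l =
      (tr2 (G x) fun a b => A α x l a * τ x b k)
        + cov1 G (fun y k => 1 / 2 * tr2 (G y) fun a b => cov2 G (A α) y k a b) x l k :=
  closed_coefficients H.metric hx (H.smooth_A α)
    (fun k => (contDiffOn_const (c := (1 / 2 : ℝ))).mul (H.smooth_div α k)) (H.potential α x hx)

theorem divergence_eq (H : IsSystemOn G T τ A Ω) (α : Fin 2) (hx : x ∈ Ω) (k : Fin 2) :
    (tr2 (G x) fun a b => cov2 G (A α) x k a b) = 2 / 3 * contr32 (G x) (T x) (A α x) k :=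
  divergence_eq_of_bertrandDarboux (H.metric.posDef x hx) (H.symm_T x hx) (H.symm_A α x hx)
    (fun k => H.metric.cov2_symmTracefree hx (H.smooth_A α) (H.symm_A α) k)
    (D := fun k => tr2 (G x) fun a b => cov2 G (A α) x k a b) (fun _ => rfl)
    (H.closed α hx).1 k

theorem cov2_eq (H : IsSystemOn G T τ A Ω) (α : Fin 2) (hx : x ∈ Ω) (i j k : Fin 2) :
    cov2 G (A α) x i j k =
      killRhs (G x) (fun k => 2 / 3 * contr32 (G x) (T x) (A α x) k) i j k := by
  rw [H.killing α x hx]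
  simp only [H.divergence_eq α hx]

/-- The derivative of the divergence of the Killing tensors. -/
theorem cov1_div (H : IsSystemOn G T τ A Ω) (α : Fin 2) (hx : x ∈ Ω) (k m : Fin 2) :
    cov1 G (fun y k => 2 / 3 * contr32 (G y) (T y) (A α y) k) x k m =
      divDeriv (G x) (T x) (cov3 G T x) (A α x) k m := by
  have hs : ∀ k, ContDiffOn ℝ ∞ (fun y => contr32 (G y) (T y) (A α y) k) Ω := fun k => by
    simp only [contr32_eq]
    exact H.metric.smooth_tr2 fun a c => H.metric.smooth_tr2
        (A := fun y b d => T y k a b * A α y c d)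
      fun b d => (H.smooth_T k a b).mul (H.smooth_A α c d)
  have h1 : cov1 G (fun y k => 2 / 3 * contr32 (G y) (T y) (A α y) k) x k m =
      2 / 3 * cov1 G (fun y => contr32 (G y) (T y) (A α y)) x k m := by
    unfold cov1
    rw [pd_const_mul m _ (H.metric.diff hx (hs k))]
    simp only [Fin.sum_univ_two]; ring
  rw [h1, H.metric.cov1_contr32 hx H.smooth_T (H.smooth_A α), divDeriv]
  simp only [H.cov2_eq α hx]

/-- The Ricci identity for the conformal Killing tensors determines `∇T` and the curvature. -/
theorem deriv_S (H : IsSystemOn G T τ A Ω) (hx : x ∈ Ω) :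
    (∀ i j k l, cov3 G T x i j k l = rhsS (G x) (div3 G T x) i j k l) ∧
      scalarCurv G x = -(2 / 9) * normSq3 (G x) (T x) := by
  have hG := H.metric
  refine rhsS_of_ricci (hG.posDef x hx) (H.symm_T x hx)
    (fun l => hG.cov3_symmTracefree hx H.smooth_T H.symm_T l) ?_
  have hθ : ∀ α k, ContDiffOn ℝ ∞ (fun y => 2 / 3 * contr32 (G y) (T y) (A α y) k) Ω := fun α k =>
    (H.smooth_div α k).congr fun y hy => (H.divergence_eq α hy k).symm
  have h1 : ∀ α i j l m,
      killRhs (G x) (fun k => divDeriv (G x) (T x) (cov3 G T x) (A α x) k m) i j l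
        - killRhs (G x) (fun k => divDeriv (G x) (T x) (cov3 G T x) (A α x) k l) i j m =
      scalarCurv G x / 2 * (G x i m * A α x l j - G x i l * A α x m j
        + (G x j m * A α x i l - G x j l * A α x i m)) := by
    intro α i j l m
    have h2 := hG.ricci2 hx (H.smooth_A α) i j l m
    have h3 : ∀ y ∈ Ω, ∀ i j k, cov2 G (A α) y i j k = killRhs (G y)
        (fun k => 2 / 3 * contr32 (G y) (T y) (A α y) k) i j k := fun y hy => H.cov2_eq α hy
    rw [MetricOn.cov3_congr hG.isOpen hx h3, MetricOn.cov3_congr hG.isOpen hx h3,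
      hG.cov3_killRhs hx (hθ α), hG.cov3_killRhs hx (hθ α)] at h2
    simp only [H.cov1_div α hx] at h2
    exact h2
  intro B hB i j l m
  obtain ⟨s, t, rfl⟩ := H.span x hx B hB
  have h2 := h1 0 i j l m
  have h3 := h1 1 i j l m
  simp only [killRhs, divDeriv_linear] at *
  linear_combination s * h2 + t * h3

/-- The secondary structure tensor is a third of the divergence of `T`. -/
theorem secondary_eq (H : IsSystemOn G T τ A Ω) (hx : x ∈ Ω) (i j : Fin 2) :
    τ x i j = 1 / 3 * div3 G T x i j := by
  have hG := H.metric
  have hS : cov3 G T x = rhsS (G x) (div3 G T x) := by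
    ext i j k l; exact (H.deriv_S hx).1 i j k l
  refine secondary_of_bertrandDarboux (hG.posDef x hx) (H.symm_T x hx)
    (hG.div3_symmTracefree hx H.smooth_T H.symm_T) (H.symm_τ x hx)
    (fun l => hS ▸ hG.cov3_symmTracefree hx H.smooth_T H.symm_T l) ?_ i j
  have h1 : ∀ α k l, (tr2 (G x) fun a b => A α x k a * τ x b l)
        + 1 / 2 * divDeriv (G x) (T x) (rhsS (G x) (div3 G T x)) (A α x) k l =
      (tr2 (G x) fun a b => A α x l a * τ x b k)
        + 1 / 2 * divDeriv (G x) (T x) (rhsS (G x) (div3 G T x)) (A α x) l k := by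
    intro α k l
    have h2 := (H.closed α hx).2 k l
    have h3 : ∀ k l, cov1 G (fun y k => 1 / 2 * tr2 (G y) fun a b => cov2 G (A α) y k a b) x k l =
        1 / 2 * divDeriv (G x) (T x) (rhsS (G x) (div3 G T x)) (A α x) k l := by
      intro k l
      rw [← hS, ← H.cov1_div α hx, ← MetricOn.cov1_congr hG.isOpen hx
        fun y hy k => H.divergence_eq α hy k]
      unfold cov1
      rw [pd_const_mul l _ (hG.diff hx (H.smooth_div α k))]
      simp only [Fin.sum_univ_two]; ring
    rwa [h3, h3] at h2
  intro B hB k l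
  obtain ⟨s, t, rfl⟩ := H.span x hx B hB
  have h2 : ∀ k l, (tr2 (G x) fun a b => (s * A 0 x k a + t * A 1 x k a) * τ x b l) =
      s * (tr2 (G x) fun a b => A 0 x k a * τ x b l)
        + t * tr2 (G x) fun a b => A 1 x k a * τ x b l := by
    intro k l
    rw [← tr2_const_mul, ← tr2_const_mul, ← tr2_add]
    exact tr2_congr fun a b => by ring
  rw [h2, h2, divDeriv_linear, divDeriv_linear]
  linear_combination s * h1 0 k l + t * h1 1 k l

/-- The Ricci identity for `T` and the integrability condition of the prolonged equation of the
potentials determine `∇Ξ`. -/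
theorem deriv_Xi (H : IsSystemOn G T τ A Ω) (hx : x ∈ Ω) (i j k : Fin 2) :
    cov2 G (div3 G T) x i j k = rhsXi (G x) (T x) (div3 G T x) i j k := by
  have hG := H.metric
  have hT := H.smooth_T
  have hΞ : ∀ i j, ContDiffOn ℝ ∞ (fun y => div3 G T y i j) Ω := hG.smooth_div3 hT
  have hΞs : ∀ y ∈ Ω, IsSymmTracefree2 (G y) (div3 G T y) := fun y hy =>
    hG.div3_symmTracefree hy hT H.symm_T
  have hn := hG.smooth_normSq3 hT
  have hτ : ∀ y ∈ Ω, ∀ i j, τ y i j = 1 / 3 * div3 G T y i j := fun y hy => H.secondary_eq hy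
  have hq : ∀ y ∈ Ω, ∀ i j, smallQ G T τ y i j =
      4 / 3 * div3 G T y i j + (11 / 18 * normSq3 (G y) (T y)) * G y i j := by
    intro y hy i j
    rw [hG.smallQ_eq hy hT H.symm_T (H.symm_τ y hy), hτ y hy, (H.deriv_S hy).2]
    ring
  have hq' : ∀ k n l, cov2 G (smallQ G T τ) x k n l = 4 / 3 * cov2 G (div3 G T) x k n l
      + 11 / 9 * contr32 (G x) (T x) (div3 G T x) l * G x k n := by
    intro k n l
    rw [MetricOn.cov2_congr hG.isOpen hx hq, cov2_const_mul_add_mul_metric hG hx hΞ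
      (contDiffOn_const.mul hn), pd_const_mul _ _ (hG.diff hx hn), ClosedSystem.pd_normSq3 hG hx hT
      (H.symm_T x hx) (hΞs x hx) (H.deriv_S hx).1]
    ring
  have hg : ∀ k, smallGamma G T τ x k = 1 / 3 * (tr2 (G x) fun a b => cov2 G (div3 G T) x a k b)
      + 1 / 3 * contr32 (G x) (T x) (div3 G T x) k := by
    intro k
    rw [MetricOn.smallGamma_eq (H.symm_T x hx) (H.symm_τ x hx), ← tr2_const_mul]
    congr 1
    · refine tr2_congr fun a b => ?_
      rw [MetricOn.cov2_congr hG.isOpen hx hτ, cov2_const_mul fun i j => hG.diff hx (hΞ i j)]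
    · simp only [contr32, hτ x hx, Fin.sum_univ_two]; ring
  have hclosed := (closed_coefficients (T := T) (τ := τ) hG hx
    (hG.smooth_smallQ hT H.smooth_τ) (hG.smooth_smallGamma hT H.smooth_τ) ?_).1
  · refine rhsXi_of_ricci (hG.posDef x hx) (H.symm_T x hx) (hΞs x hx)
      (fun k => hG.cov2_symmTracefree hx hΞ hΞs k) (fun i j k l m => ?_)
      (11 / 18 * normSq3 (G x) (T x)) (fun k l n => ?_) i j k
    · have h1 := hG.ricci3 hx hT i j k l m
      have h2 : ∀ y ∈ Ω, ∀ i j k l, cov3 G T y i j k l = rhsS (G y) (div3 G T y) i j k l :=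
        fun y hy => (H.deriv_S hy).1
      rwa [MetricOn.cov4_congr hG.isOpen hx h2, MetricOn.cov4_congr hG.isOpen hx h2,
        hG.cov4_rhsS hx hΞ, hG.cov4_rhsS hx hΞ, (H.deriv_S hx).2] at h1
    · have h1 := hclosed k l n
      simpa only [hq', hq x hx, hg] using h1
  -- the one-form `qₖᵐ u,ₘ + γₖ u` is half the differential of the Laplacian, hence closed
  · intro a d b
    obtain ⟨u, hu, h0, h1, h2, -⟩ := H.potential 0 x hx a d b
    refine ⟨u, hu, h0, h1, h2, fun k l => ?_⟩
    have h3 : ∀ k, ∀ y ∈ Ω, (tr2 (G y) fun a b => smallQ G T τ y k a * pd b u y)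
        + smallGamma G T τ y k * u y = 1 / 2 * pd k (lapl G u) y := fun k y hy => by
      rw [hu.pd_lapl hG hy hT H.symm_T H.smooth_τ H.symm_τ]; ring
    have hl := hG.smooth_lapl hu.smooth
    have hp := fun k => hG.diff hx (contDiffOn_pd hG.isOpen hl k)
    rw [pd_congr hG.isOpen hx l (h3 k), pd_congr hG.isOpen hx k (h3 l), pd_const_mul l _ (hp k),
      pd_const_mul k _ (hp l), pd_pd_comm hG.isOpen hl hx]

theorem closedSystem (H : IsSystemOn G T τ A Ω) (hx : x ∈ Ω) : ClosedSystem G T (div3 G T) x :=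
  ⟨(H.deriv_S hx).1, H.deriv_Xi hx, (H.deriv_S hx).2⟩

end IsSystemOn

end

/-! ### Systems on a surface -/

section

open Matrix

variable {M : Type*} [TopologicalSpace M] [ChartedSpace E2 M]

theorem bilinear_apply_combination {E : Type*} [AddCommGroup E] [Module ℝ E]
    (A : MultilinearMap ℝ (fun _ : Fin 2 => E) ℝ) (X : Fin 2 → E) (v w : Fin 2 → ℝ) :
    A ![v 0 • X 0 + v 1 • X 1, w 0 • X 0 + w 1 • X 1] = ∑ i, ∑ j, A ![X i, X j] * v i * w j := by
  have hl : ∀ (a b : ℝ) (Y Y' Z : E), A ![a • Y + b • Y', Z] = a * A ![Y, Z] + b * A ![Y', Z] := by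
    intro a b Y Y' Z
    have hu : ∀ Y' : E, Function.update ![Y, Z] 0 Y' = ![Y', Z] := fun Y' => by
      ext i; fin_cases i <;> rfl
    simpa [hu] using A.map_update_add ![Y, Z] 0 (a • Y) (b • Y') |>.trans (congrArg₂ (· + ·)
      (A.map_update_smul ![Y, Z] 0 a Y) (A.map_update_smul ![Y, Z] 0 b Y'))
  have hr : ∀ (a b : ℝ) (Y Y' Z : E), A ![Z, a • Y + b • Y'] = a * A ![Z, Y] + b * A ![Z, Y'] := by
    intro a b Y Y' Z
    have hu : ∀ Y' : E, Function.update ![Z, Y] 1 Y' = ![Z, Y'] := fun Y' => by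
      ext i; fin_cases i <;> rfl
    simpa [hu] using A.map_update_add ![Z, Y] 1 (a • Y) (b • Y') |>.trans (congrArg₂ (· + ·)
      (A.map_update_smul ![Z, Y] 1 a Y) (A.map_update_smul ![Z, Y] 1 b Y'))
  simp only [hl, hr, Fin.sum_univ_two]
  ring

theorem comp2_eq (A : CovTensor 2 M) (c : OpenPartialHomeomorph M E2) (x : E2) (i j : Fin 2) :
    comp2 c A x i j = A (c.symm x) ![frame c x i, frame c x j] := by
  unfold comp2 comp
  congr 1
  ext a; fin_cases a <;> rfl

variable [IsManifold (𝓡 2) ∞ M]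
  {g : ConfSuperint.Metric M} {V : M → ℝ} {C : Fin 2 → CovTensor 2 M} {W : Fin 2 → M → ℝ}
  {𝒱 : Submodule ℝ (M → ℝ)} {T : CovTensor 3 M} {τ : CovTensor 2 M}
  {c : OpenPartialHomeomorph M E2} {x : E2} {U : M → ℝ}

namespace IsNondegenerate

/-- The tensors of an irreducible system span, at every point, the trace-free symmetric tensors. -/
theorem span (hN : IsNondegenerate g V C W 𝒱 T τ) (hc : c ∈ charts M) (hx : x ∈ c.target)
    {B : Fin 2 → Fin 2 → ℝ} (hB : IsSymmTracefree2 (metricComp c g x) B) :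
    ∃ s t : ℝ, B = fun i j => s * comp2 c (C 0) x i j + t * comp2 c (C 1) x i j := by
  refine exists_linear_combination ((metricOn_metricComp g hc).posDef x hx)
    (B := fun α => comp2 c (C α) x) (fun α => hN.superintegrable.symm_tracefree α c hc x hx) ?_ hB
  intro v hv H
  refine hN.irreducible (c.symm x) (v 0 • frame c x 0 + v 1 • frame c x 1)
    (fun h0 => hv (frame_inj hc hx h0)) fun α => ?_
  obtain ⟨μ, hμ⟩ := H α
  refine ⟨μ, fun w => ?_⟩
  obtain ⟨b, rfl⟩ := exists_frame_eq hc hx w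
  have h3 := bilinear_apply_combination (C α (c.symm x)) (frame c x) v b
  simp only [← comp2_eq] at h3
  rw [h3]
  have h1 := hμ 0
  have h2 := hμ 1
  simp only [map_add, map_smul, _root_.add_apply, _root_.smul_apply, smul_eq_mul]
  simp only [metricComp, Matrix.of_apply, Fin.sum_univ_two] at h1 h2 ⊢
  linear_combination b 0 * h1 + b 1 * h2

/-- The Bertrand-Darboux condition for a potential `U`: the conformal Killing equation, and the
closedness of the differential of the function `W`. -/
theorem closed_of_mem (hN : IsNondegenerate g V C W 𝒱 T τ) (hU : U ∈ 𝒱) (α : Fin 2)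
    (hc : c ∈ charts M) (hx : x ∈ c.target) :
    (∀ i j k, cov2 (metricComp c g) (comp2 c (C α)) x i j k = killRhs (metricComp c g x)
      (fun k => tr2 (metricComp c g x) fun a b => cov2 (metricComp c g) (comp2 c (C α)) x k a b)
      i j k) ∧
    ∀ k l, pd l (fun z => (tr2 (metricComp c g z) fun a b => comp2 c (C α) z k a *
          pd b (U ∘ c.symm) z) + 1 / 2 * (tr2 (metricComp c g z) fun a b =>
          cov2 (metricComp c g) (comp2 c (C α)) z k a b) * (U ∘ c.symm) z) x =
      pd k (fun z => (tr2 (metricComp c g z) fun a b => comp2 c (C α) z l a *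
          pd b (U ∘ c.symm) z) + 1 / 2 * (tr2 (metricComp c g z) fun a b =>
          cov2 (metricComp c g) (comp2 c (C α)) z l a b) * (U ∘ c.symm) z) x := by
  have hG := metricOn_metricComp g hc
  have hA := (hN.superintegrable.smooth_C α).comp2 hc
  have hAs := fun y hy => hN.superintegrable.symm_tracefree α c hc y hy
  have hu := contDiffOn_comp_symm (hN.smooth U hU) hc
  obtain ⟨O, hO, hxO, w, hw, hI⟩ := hN.bertrandDarboux U hU α (c.symm x)
  set Ω' : Set E2 := c.target ∩ c.symm ⁻¹' O with hΩ'
  have hΩo : IsOpen Ω' := c.isOpen_inter_preimage_symm hO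
  have hw' : ContDiffOn ℝ ∞ (w ∘ c.symm) Ω' := contMDiffOn_iff_contDiffOn.1
    (hw.comp ((contMDiffOn_symm_of_mem_charts hc).mono Set.inter_subset_left) fun y hy => hy.2)
  choose! ρ hρ using fun y (hy : y ∈ Ω') => hI c hc y hy.1 hy.2
  have key := fun y (hy : y ∈ Ω') => hG.conformalIntegral hy.1 hA hAs (hG.diff hy.1 hu)
    (differentiableAt_of_contDiffOn hΩo hw' hy) (ρ y) (hρ y hy)
  have hx' : x ∈ Ω' := ⟨hx, hxO⟩
  refine ⟨(key x hx').1, fun k l => ?_⟩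
  rw [← pd_congr hΩo hx' l fun y hy => (key y hy).2 k, ← pd_congr hΩo hx' k fun y hy =>
      (key y hy).2 l]
  exact pd_pd_comm hΩo hw' hx' l k

/-- In every chart, a non-degenerate system in standard gauge satisfies the local hypotheses from
which the structure equations are derived. -/
theorem isSystemOn [ConnectedSpace M] (hN : IsNondegenerate g V C W 𝒱 T τ)
    (hg : InStandardGauge g T) (hc : c ∈ charts M) :
    IsSystemOn (metricComp c g) (comp3 c T) (comp2 c τ) (fun α => comp2 c (C α)) c.target where
  metric := metricOn_metricComp g hc
  smooth_T := hN.structureTensors.smooth_T.comp3 hc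
  symm_T _ hy := hg.isSymmTracefree3 hN hc hy
  smooth_τ := hN.structureTensors.smooth_τ.comp2 hc
  symm_τ y hy := hN.structureTensors.symm_tracefree_τ c hc y hy
  smooth_A α := (hN.superintegrable.smooth_C α).comp2 hc
  symm_A α y hy := hN.superintegrable.symm_tracefree α c hc y hy
  killing α _ hy := (hN.closed_of_mem hN.mem α hc hy).1
  span _ hy _ hB := hN.span hc hy hB
  potential α _ hy a d b := by
    obtain ⟨U, hU, h0, h1, h2⟩ := hN.exists_potential hg hc hy a d b
    exact ⟨U ∘ c.symm, hN.isPotentialOn hU hc, h0, h1, h2, (hN.closed_of_mem hU α hc hy).2⟩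

end IsNondegenerate

end

end ConfSuperint

theorem mainTheorem2 {M : Type*} [TopologicalSpace M] [ChartedSpace E2 M]
    [IsManifold (𝓡 2) ∞ M] [ConnectedSpace M] (g : ConfSuperint.Metric M) :
    -- the structure equations of a system in standard gauge
    (∀ (V : M → ℝ) (C : Fin 2 → CovTensor 2 M) (W : Fin 2 → M → ℝ) (𝒱 : Submodule ℝ (M → ℝ))
      (T : CovTensor 3 M) (τ : CovTensor 2 M),
      IsNondegenerate g V C W 𝒱 T τ → InStandardGauge g T →
      ∀ c ∈ charts M, ∀ x ∈ c.target,
        let G : E2 → Matrix (Fin 2) (Fin 2) ℝ := metricComp c g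
        let S : E2 → Fin 2 → Fin 2 → Fin 2 → ℝ := fun y => confStruct (G y) (comp3 c T y)
        let Ξ : E2 → Fin 2 → Fin 2 → ℝ := confXi G (comp3 c T)
        (∀ i j k, comp3 c T x i j k = S x i j k) ∧
        IsSymmTracefree3 (G x) (S x) ∧
        IsSymmTracefree2 (G x) (Ξ x) ∧
        (∀ i j, Ξ x i j = div3 G S x i j) ∧
        ClosedSystem G S Ξ x ∧
        (∀ k, pd k (scalarCurv G) x = -(4 / 9) * contr32 (G x) (S x) (Ξ x) k) ∧
        (∀ i j, comp2 c τ x i j = 1 / 3 * Ξ x i j) ∧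
        IntegrabilityConditions G (comp3 c T) (comp2 c τ) x) ∧
    -- the structure equations imply the integrability conditions of the system
    (∀ (S : CovTensor 3 M) (Ξ : CovTensor 2 M), IsSmooth S → IsSmooth Ξ →
      (∀ c ∈ charts M, ∀ x ∈ c.target,
        IsSymmTracefree3 (metricComp c g x) (comp3 c S x) ∧
        IsSymmTracefree2 (metricComp c g x) (comp2 c Ξ x) ∧
        ClosedSystem (metricComp c g) (comp3 c S) (comp2 c Ξ) x) →
      ∀ c ∈ charts M, ∀ x ∈ c.target,
        IntegrabilityConditions (metricComp c g) (comp3 c S)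
          (fun y i j => 1 / 3 * comp2 c Ξ y i j) x) ∧
    -- the integrability conditions of the closed system itself
    (∀ (h : Matrix (Fin 2) (Fin 2) ℝ) (S : Fin 2 → Fin 2 → Fin 2 → ℝ) (Ξ : Fin 2 → Fin 2 → ℝ),
      h.PosDef → IsSymmTracefree3 h S → IsSymmTracefree2 h Ξ →
      RicciIdentityS h (-(2 / 9) * normSq3 h S) S Ξ ∧
      RicciIdentityXi h (-(2 / 9) * normSq3 h S) S Ξ) := by
  refine ⟨?_, fun S Ξ hS hΞ H c hc x hx => ?_, fun h S Ξ hh hS hΞ =>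
    ⟨ricciIdentityS hh hS hΞ, ricciIdentityXi hh hS hΞ⟩⟩
  · intro V C W 𝒱 T τ hN hg c hc x hx G S Ξ
    have H : IsSystemOn G (comp3 c T) (comp2 c τ) (fun α => comp2 c (C α)) c.target :=
      hN.isSystemOn hg hc
    have hG := H.metric
    have hS : ∀ y ∈ c.target, S y = comp3 c T y := fun y hy => confStruct_eq_self (hg c hc y hy)
    have hdiv : ∀ y ∈ c.target, div3 G S y = div3 G (comp3 c T) y := fun y hy => by
      ext i j
      exact tr2_congr fun a b => MetricOn.cov3_congr hG.isOpen hy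
        (fun z hz i j k => by rw [hS z hz]) i j a b
    have hΞ : ∀ y ∈ c.target, Ξ y = div3 G (comp3 c T) y := fun y hy => by
      ext i j
      have h1 : Ξ y i j = div3 G S y i j + 2 / 3 * tr2 (G y) fun a b =>
        S y i j a * traceForm (G y) (comp3 c T y) b := rfl
      rw [h1, hdiv y hy]
      simp [show ∀ b, traceForm (G y) (comp3 c T y) b = 0 from hg c hc y hy, tr2]
    have hcs : ∀ y ∈ c.target, ClosedSystem G S Ξ y := fun y hy => by
      obtain ⟨h1, h2, h3⟩ := H.closedSystem hy
      refine ⟨fun i j k l => ?_, fun i j k => ?_, ?_⟩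
      · rw [MetricOn.cov3_congr hG.isOpen hy (fun z hz i j k => by rw [hS z hz]), h1, hΞ y hy]
      · rw [MetricOn.cov2_congr hG.isOpen hy (fun z hz i j => by rw [hΞ z hz]), h2, hΞ y hy,
          hS y hy]
      · rw [h3, hS y hy]
    have hΞs : ∀ y ∈ c.target, IsSymmTracefree2 (G y) (div3 G (comp3 c T) y) := fun y hy =>
      hG.div3_symmTracefree hy H.smooth_T H.symm_T
    refine ⟨fun i j k => by rw [hS x hx], hS x hx ▸ H.symm_T x hx, hΞ x hx ▸ hΞs x hx,
      fun i j => by rw [hΞ x hx, hdiv x hx], hcs x hx, fun k => ?_,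
      fun i j => by rw [hΞ x hx]; exact H.secondary_eq hx i j, ?_⟩
    · rw [pd_congr hG.isOpen hx k fun y hy => (H.closedSystem hy).curvature, pd_const_mul k _
        (hG.diff hx (hG.smooth_normSq3 H.smooth_T)), ClosedSystem.pd_normSq3 hG hx H.smooth_T
        (H.symm_T x hx) (hΞs x hx) (H.closedSystem hx).deriv_S, hS x hx, hΞ x hx]
      ring
    · exact ClosedSystem.integrabilityConditions hG H.smooth_T (hG.smooth_div3 H.smooth_T) H.symm_T
        hΞs (fun y hy => H.secondary_eq hy) (fun y hy => H.closedSystem hy) hx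
  · exact ClosedSystem.integrabilityConditions (metricOn_metricComp g hc) (hS.comp3 hc)
      (hΞ.comp2 hc) (fun y hy => (H c hc y hy).1) (fun y hy => (H c hc y hy).2.1)
      (fun _ _ _ _ => rfl) (fun y hy => (H c hc y hy).2.2) hx
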